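/- **Setting.** A triangulation $T$ of the 3-ball is a finite set of tetrahedra (4-element sets of nodes) whose simplicial complex is homeomorphic to the closed 3-ball and in which the link of each node is a triangulated disk or a triangulated 2-sphere. Faces lying in exactly one tetrahedron, and their edges and nodes, are *external*; all other simplices are *internal*. For a node $n$, the *internal hemisphere* $\mathcal I(n)$ is the set of triangles $f\not\ni n$ with $f\cup\{n\}$ a tetrahedron; for external $n$ it is a 2d triangulation of a polygon (a triangulated disk). An internal node $x$ joined by an edge to an external node is of type C0 if it belongs to a tetrahedron with exactly one internal node and exactly one external face; of type C1 if it is not C0 but lies in a face $(x,m,m')$ for which $(m,m')$ is an external edge; and of type C2 otherwise. A *splitting path* of a triangulated disk $\mathcal K$ is a simple edge path that connects two different nodes of $\partial\mathcal K$, contains no edge of $\partial\mathcal K$, and meets $\partial\mathcal K$ only in its two ends. A path $\gamma$ *divides* $\mathcal K$ into $A$ and $B$ if $A$ and $B$ are triangulated disks without common triangles, $A\cup B=\mathcal K$, and $A\cap B=\gamma$. *Splitting* the external node $n$ along a splitting path $\gamma$ that divides $\mathcal I(n)$ into $A$ and $B$ means: remove all tetrahedra containing $n$, and with two new nodes $n_{\rm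 L},n_{\rm R}$ add the tetrahedra $(n_{\rm L},f)$ for $f\in A$, $(n_{\rm R},f)$ for $f\in B$, and $(n_{\rm L},n_{\rm R},e)$ for each edge $e$ of $\gamma$. **Algorithm.** Let $n_*$ be an external node of $T$ and $\mathcal I=\mathcal I(n_*)$. Start with the binary tree whose only leaf is the empty word $\mathbf S=\emptyset$, with node $n_{*,\emptyset}=n_*$, piece $\mathcal K_\emptyset=\mathcal I$, and the nodes of $\partial\mathcal I$ labeled bijectively by $-1,\dots,-|\partial\mathcal I|$. As long as some piece is not a single triangle, choose a leaf $\mathbf S$ (a word in L, R) whose piece $\mathcal K_{\mathbf S}$ is not a single triangle, and do the following. 1. Choose nodes $a,b\in\partial\mathcal K_{\mathbf S}$ with different labels that are the ends of some splitting path of $\mathcal K_{\mathbf S}$, and a shortest splitting path $\tilde\gamma_{\mathbf S}$ of $\mathcal K_{\mathbf S}$ from $a$ to $b$. 2. Extend $\tilde\gamma_{\mathbf S}$ to a path $\gamma_{\mathbf S}$ in the hemisphere $\mathcal I(n_{*,\mathbf S})$ of the present triangulation: at an end with a negative label do nothing; at an end $u$ whose label is a word $\mathbf S'$, add an edge of $\mathcal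 I(n_{*,\mathbf S})$ from $u$ to $n_{*,\mathbf S'}$ or, if $n_{*,\mathbf S'}$ has been split meanwhile, to one of its present descendants $n_{*,\mathbf S'\mathbf W}$. 3. Split $n_{*,\mathbf S}$ along $\gamma_{\mathbf S}$, which divides $\mathcal I(n_{*,\mathbf S})$ into $A$ and $B$, into new nodes $n_{*,\mathbf S{\rm L}}$ and $n_{*,\mathbf S{\rm R}}$. Replace the leaf $\mathbf S$ by the leaves $\mathbf S{\rm L},\mathbf S{\rm R}$ with pieces $\mathcal K_{\mathbf S{\rm L}}=\mathcal K_{\mathbf S}\cap A$, $\mathcal K_{\mathbf S{\rm R}}=\mathcal K_{\mathbf S}\cap B$. In the new pieces old labels are kept, and the nodes of $\partial\mathcal K_{\mathbf S{\rm L}}$ (respectively $\partial\mathcal K_{\mathbf S{\rm R}}$) without a label get the label $\mathbf S{\rm R}$ (respectively $\mathbf S{\rm L}$). **Theorem 4.1.** Let $T$ be a triangulation of the 3-ball and $n_*$ an external node of $T$. * The algorithm can always be carried out and ends. Whatever choices have been made so far, every piece that is not a single triangle admits a path as in 1; for every such path there is an extension as in 2; and every such extension is a splitting path of $\mathcal I(n_{*,\mathbf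 S})$ along which the split in 3 can be performed. There are always fewer than $|\mathcal I|$ steps (where $|\mathcal I|$ is the number of triangles of $\mathcal I$). In particular some run of the algorithm reaches a state in which all pieces are single triangles. * At every stage, for every leaf $\mathbf S$, $\mathcal K_{\mathbf S}$ and $\mathcal I(n_{*,\mathbf S})$ are triangulated disks with $\mathcal K_{\mathbf S}\subseteq\mathcal I(n_{*,\mathbf S})$; the pieces of different leaves have no common triangle, and their union is $\mathcal I$. In each step $\tilde\gamma_{\mathbf S}$ divides $\mathcal K_{\mathbf S}$ into $\mathcal K_{\mathbf S{\rm L}}$ and $\mathcal K_{\mathbf S{\rm R}}$. * Every edge in $\mathcal I\setminus\partial\mathcal I$ lies in at most one of the paths $\gamma_{\mathbf S}$. * When all pieces are single triangles, every node $x$ of $\mathcal I$ that was of type C2 in $T$ has been promoted: there is a step before which $x$ has always been of type C2, directly after which it is of type C1, and from which on it is always of type C1 or C0. -/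

import Mathlib

namespace BallSplit

variable {V : Type*} [DecidableEq V]

/- A pure finite simplicial complex is given by the finite set of its facets, each facet being
the finite set of its nodes: tetrahedra have 4 nodes, faces (triangles) 3 and edges 2. -/

/-- The nodes of the complex with facets `K`. -/
def nodes (K : Finset (Finset V)) : Finset V := K.biUnion id

/-- The simplices with `k` nodes of the complex with facets `K`. -/
def simplices (k : ℕ) (K : Finset (Finset V)) : Finset (Finset V) :=
  K.biUnion (Finset.powersetCard k)

/-- The simplices with `k` nodes that lie in exactly one facet. This is the boundary of a
2-dimensional complex for `k = 2` and of a 3-dimensional complex for `k = 3`. -/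
def bdry (k : ℕ) (K : Finset (Finset V)) : Finset (Finset V) :=
  (simplices k K).filter fun e => (K.filter fun t => e ⊆ t).card = 1

/-- The link of `v`: all `f` not containing `v` for which `f` together with `v` is a facet. -/
def link (K : Finset (Finset V)) (v : V) : Finset (Finset V) :=
  (K.filter fun t => v ∈ t).image fun t => t.erase v

/-- Two nodes are adjacent if they are the ends of an edge. -/
def Adj (K : Finset (Finset V)) (u v : V) : Prop := u ≠ v ∧ ∃ t ∈ K, u ∈ t ∧ v ∈ t

/-- Any two nodes are joined by a path of edges. -/
def Connected (K : Finset (Finset V)) : Prop :=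
  ∀ u ∈ nodes K, ∀ v ∈ nodes K, Relation.ReflTransGen (Adj K) u v

/-! ### Two-dimensional triangulations -/

/-- The edges of a 2-dimensional complex. -/
def edges (K : Finset (Finset V)) : Finset (Finset V) := simplices 2 K

/-- The boundary edges of a 2-dimensional complex. -/
def bdEdges (K : Finset (Finset V)) : Finset (Finset V) := bdry 2 K

/-- The boundary nodes of a 2-dimensional complex. -/
def bdNodes (K : Finset (Finset V)) : Finset V := nodes (bdEdges K)

/-- The Euler characteristic of a 2-dimensional complex. -/
def euler (K : Finset (Finset V)) : ℤ :=
  ((nodes K).card : ℤ) - (edges K).card + K.card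

/-- A connected triangulated compact surface, possibly with boundary. As every edge is in at
most two triangles, the link of a node is connected exactly if it is a path or a cycle. -/
structure IsSurface (K : Finset (Finset V)) : Prop where
  nonempty : K.Nonempty
  card_eq : ∀ t ∈ K, t.card = 3
  edge_le : ∀ e ∈ edges K, (K.filter fun t => e ⊆ t).card ≤ 2
  link_connected : ∀ v ∈ nodes K, Connected (link K v)
  connected : Connected K

/-- A 2d triangulation of a polygon, that is, a triangulated disk: among the connected compact
surfaces with non-empty boundary the disk is the one with Euler characteristic 1. -/
structure IsDisk (K : Finset (Finset V)) : Prop extends IsSurface K where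
  bdry_nonempty : (bdEdges K).Nonempty
  euler_eq : euler K = 1

/-- A triangulated 2-sphere. -/
structure IsSphere (K : Finset (Finset V)) : Prop extends IsSurface K where
  bdry_empty : bdEdges K = ∅
  euler_eq : euler K = 2

/-! ### Triangulated 3-balls -/

/-- The geometric realization, in barycentric coordinates. -/
def realization (T : Finset (Finset V)) : Set (V → ℝ) :=
  {p | (∀ v, 0 ≤ p v) ∧ ∃ t ∈ T, (∀ v, v ∉ t → p v = 0) ∧ ∑ v ∈ t, p v = 1}

/-- `T` is the set of tetrahedra of a triangulation of the 3-ball. The flower of each node is a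
triangulated disk (external node) or a triangulated sphere (internal node). -/
structure IsBall (T : Finset (Finset V)) : Prop where
  card_eq : ∀ t ∈ T, t.card = 4
  flower : ∀ v ∈ nodes T, IsDisk (link T v) ∨ IsSphere (link T v)
  homeo : Nonempty (realization T ≃ₜ Metric.closedBall (0 : EuclideanSpace ℝ (Fin 3)) 1)

/-- External faces. -/
def extFaces (T : Finset (Finset V)) : Finset (Finset V) := bdry 3 T

/-- External edges. -/
def extEdges (T : Finset (Finset V)) : Finset (Finset V) := simplices 2 (extFaces T)

/-- External nodes. -/
def extNodes (T : Finset (Finset V)) : Finset V := nodes (extFaces T)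

/-- Internal nodes. -/
def intNodes (T : Finset (Finset V)) : Finset V := nodes T \ extNodes T

/-- The internal hemisphere of the node `n`. Its boundary edges are the edges `e` for which `n`
and `e` form an external face, that is, the external flower of `n`. -/
def hemisphere (T : Finset (Finset V)) (n : V) : Finset (Finset V) := link T n

/-- A removable tetrahedron: one internal node and one external face. -/
def Removable (T : Finset (Finset V)) (t : Finset V) : Prop :=
  t ∈ T ∧ (t ∩ intNodes T).card = 1 ∧ (t.powersetCard 3 ∩ extFaces T).card = 1

/-- Internal nodes at depth 1: joined by an edge to an external node. -/
def DepthOne (T : Finset (Finset V)) (x : V) : Prop :=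
  x ∈ intNodes T ∧ ∃ n ∈ extNodes T, Adj T x n

/-- Type C0. -/
def IsC0 (T : Finset (Finset V)) (x : V) : Prop :=
  DepthOne T x ∧ ∃ t, Removable T t ∧ x ∈ t

/-- Type C1. -/
def IsC1 (T : Finset (Finset V)) (x : V) : Prop :=
  DepthOne T x ∧ ¬ IsC0 T x ∧ ∃ e ∈ extEdges T, insert x e ∈ simplices 3 T

/-- Type C2. -/
def IsC2 (T : Finset (Finset V)) (x : V) : Prop :=
  DepthOne T x ∧ ¬ IsC0 T x ∧ ¬ IsC1 T x

/-! ### Splitting paths and the move split-a-node-along-a-path -/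

/-- The list of edges of a path that is given by the list of its nodes. -/
def pathEdges (c : List V) : List (Finset V) :=
  List.zipWith (fun u v => {u, v}) c c.tail

/-- `c` is a splitting path of `K` from `a` to `b`: a simple path of edges of `K` between two
different nodes of the boundary that contains no boundary edge and that meets the boundary only
in its two ends. -/
structure IsSplittingPath (K : Finset (Finset V)) (a b : V) (c : List V) : Prop where
  nodup : c.Nodup
  head_eq : c.head? = some a
  last_eq : c.getLast? = some b
  ends_ne : a ≠ b
  head_mem : a ∈ bdNodes K
  last_mem : b ∈ bdNodes K
  interior : ∀ v ∈ c, v ∈ bdNodes K → v = a ∨ v = b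
  edge_mem : ∀ e ∈ pathEdges c, e ∈ edges K ∧ e ∉ bdEdges K

/-- The path `c` divides `K` into the two pieces `A` and `B`: both are triangulated polygons,
their union is `K`, and their intersection is `c`. -/
structure Divides (K : Finset (Finset V)) (c : List V) (A B : Finset (Finset V)) : Prop where
  left : IsDisk A
  right : IsDisk B
  union : A ∪ B = K
  disjoint : Disjoint A B
  nodes_inter : nodes A ∩ nodes B = c.toFinset
  edges_inter : edges A ∩ edges B = (pathEdges c).toFinset

/-- The tetrahedra after splitting `n` into `nL` and `nR` along the path `c` that divides the
hemisphere of `n` into `A` and `B`. -/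
def splitNode (T : Finset (Finset V)) (n : V) (c : List V) (A B : Finset (Finset V))
    (nL nR : V) : Finset (Finset V) :=
  (T.filter fun t => n ∉ t) ∪ A.image (fun f => insert nL f) ∪ B.image (fun f => insert nR f) ∪
    (pathEdges c).toFinset.image fun e => insert nL (insert nR e)

/-! ### The algorithm -/

inductive Side where
  | L
  | R
  deriving DecidableEq

/-- Sequences of letters L and R. The last letter of the sequence is the head of the list, so
that the children of `S` are `L :: S` and `R :: S`. -/
abbrev Word := List Side

/-- Labels of boundary nodes: integers for the nodes of the boundary of the hemisphere with
which the algorithm starts, sequences of letters for the others. -/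
inductive Label where
  | original (k : ℤ)
  | child (S : Word)

/-- A state of the algorithm: the present triangulation, the leaves of the binary tree of
pieces, and, for the sequences in the tree, the node, the piece and the labels of the nodes on
the boundary of the piece. -/
structure State (V : Type*) where
  tets : Finset (Finset V)
  leaves : Finset Word
  node : Word → V
  piece : Word → Finset (Finset V)
  label : Word → V → Option Label

/-- The start: the only piece is the whole hemisphere, and the `p` nodes of its boundary are
labeled from `-1` to `-p`. -/
structure IsInitial (T : Finset (Finset V)) (n : V) (s : State V) : Prop where
  tets_eq : s.tets = T
  leaves_eq : s.leaves = {[]}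
  node_eq : s.node [] = n
  piece_eq : s.piece [] = hemisphere T n
  label_eq : ∃ f : V → ℤ,
    Set.BijOn f (bdNodes (hemisphere T n)) (Set.Icc (-((bdNodes (hemisphere T n)).card : ℤ)) (-1)) ∧
    ∀ v, s.label [] v =
      if v ∈ bdNodes (hemisphere T n) then some (Label.original (f v)) else none

/-- A shortest path in the piece `K` between two given nodes `a` and `b` of its boundary that
have different labels. -/
def IsCut (K : Finset (Finset V)) (lab : V → Option Label) (a b : V) (c : List V) : Prop :=
  IsSplittingPath K a b c ∧ lab a ≠ lab b ∧
    ∀ d, IsSplittingPath K a b d → c.length ≤ d.length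

/-- The nodes to be added at the end `u` of a path in the piece of `S`: none if `u` carries an
original label; if the label is a sequence `S'`, one node to which `u` is joined in the hemisphere
of the node of `S`, namely the node of `S'` or, if that node has been split meanwhile, one of the
nodes that have replaced it. -/
def Prolongs (s : State V) (S : Word) (u : V) (l : List V) : Prop :=
  (∃ k, s.label S u = some (Label.original k) ∧ l = []) ∨
    ∃ S' W, s.label S u = some (Label.child S') ∧ W ∈ s.leaves ∧ S' <:+ W ∧
      {u, s.node W} ∈ edges (hemisphere s.tets (s.node S)) ∧ l = [s.node W]

/-- `p` extends the path `c` from `a` to `b` in the piece of `S`. -/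
def Extends (s : State V) (S : Word) (a b : V) (c p : List V) : Prop :=
  ∃ l r, Prolongs s S a l ∧ Prolongs s S b r ∧ p = l ++ c ++ r

/-- The labels of a new piece `K`: old labels stay, and the nodes on the boundary that had no
label get the label `W`. -/
def relabel (lab : V → Option Label) (K : Finset (Finset V)) (W : Word) (v : V) : Option Label :=
  (lab v).or (if v ∈ bdNodes K then some (Label.child W) else none)

/-- The state after the split of the node of the leaf `S` along `p` into new nodes `nL`, `nR`,
where `p` divides the hemisphere into `A` and `B`. -/
def State.split (s : State V) (S : Word) (p : List V) (A B : Finset (Finset V)) (nL nR : V) :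
    State V where
  tets := splitNode s.tets (s.node S) p A B nL nR
  leaves := insert (Side.L :: S) (insert (Side.R :: S) (s.leaves.erase S))
  node := Function.update (Function.update s.node (Side.L :: S) nL) (Side.R :: S) nR
  piece := Function.update (Function.update s.piece (Side.L :: S) (s.piece S ∩ A))
    (Side.R :: S) (s.piece S ∩ B)
  label := Function.update
    (Function.update s.label (Side.L :: S)
      (relabel (s.label S) (s.piece S ∩ A) (Side.R :: S)))
    (Side.R :: S) (relabel (s.label S) (s.piece S ∩ B) (Side.L :: S))

/-- One step: a leaf `S` whose piece is not a triangle is chosen, its piece is cut along `c`,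
the path `c` is extended to a splitting path `p` of the hemisphere of the node of `S`, and this
node is split along `p`. -/
def Step (s : State V) (S : Word) (c p : List V) (s' : State V) : Prop :=
  S ∈ s.leaves ∧ 1 < (s.piece S).card ∧
  (∃ a b, IsCut (s.piece S) (s.label S) a b c ∧ Extends s S a b c p) ∧
  (∃ a b, IsSplittingPath (hemisphere s.tets (s.node S)) a b p) ∧
  ∃ A B nL nR, Divides (hemisphere s.tets (s.node S)) p A B ∧
    nL ∉ nodes s.tets ∧ nR ∉ nodes s.tets ∧ nL ≠ nR ∧ s' = s.split S p A B nL nR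

/-- A run of `m` steps of the algorithm on the node `n` of `T`. Step `i` leads from the state
`s i` to `s (i + 1)`, cutting the piece of `S i` along `c i` and splitting along `p i`. -/
structure IsRun (T : Finset (Finset V)) (n : V) (m : ℕ) (s : ℕ → State V) (S : ℕ → Word)
    (c p : ℕ → List V) : Prop where
  init : IsInitial T n (s 0)
  step : ∀ i < m, Step (s i) (S i) (c i) (p i) (s (i + 1))

/-- All pieces are single triangles. -/
def State.Finished (s : State V) : Prop := ∀ W ∈ s.leaves, (s.piece W).card = 1

end BallSplit

open BallSplit

namespace BallSplit

variable {V : Type*} [DecidableEq V]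

/-! The topological half of the proof is homology modulo 2 of surfaces. In a connected surface with
boundary no non-zero set of triangles is a cycle, and the node colourings that are constant along
edges form a line. Comparing ranks of incidence matrices then gives Euler characteristic at most 1
(`IsSurface.euler_le_one`). For a disk the same count relative to the boundary is sharp, so every
relative 1-cycle is a relative boundary (`IsDisk.exists_rel_boundary`). A splitting path is such a
cycle. It therefore bounds a set of triangles, and this set and its complement are the two sides.
Each side is again a connected surface with boundary, and the two Euler characteristics add up to
that of the whole plus 1. As neither exceeds 1, both are 1 when the whole is a disk
(`IsCutAlong.divides`, `IsDisk.exists_divides`).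

When a node is split along a path, the link of a new node is one side with a cone over the path
glued on, which is a disk (`IsDisk.cone`). Another node on the boundary of the hemisphere keeps its
link up to renaming, unless it is an end of the path. In that case a node of its link is split in
two, and the result is a disk again (`IsBdSplit.isDisk`). This applies to the nodes of all the other
leaves, because adjacent leaf nodes are always joined by an external edge.

The rest is an invariant (`Inv`, `LeafInv`). A word label at a leaf is the sibling of the leaf or of
one of its ancestors. Subtrees below different labels are therefore disjoint, and two ends with
different labels are extended to different nodes. Nodes of a piece with the same word label were
inner nodes of one shortest path. If two of them are adjacent, they are consecutive on that path and
their edge is on the boundary of the piece. Hence an inner edge between boundary nodes has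
differently labelled ends, and the labels are not constant around the boundary of a piece. This is
why a piece that is not a triangle can always be cut (`Inv.exists_isCut`).

Each step adds one leaf, and the pieces are disjoint and non-empty, which bounds the number of
steps. An edge used by a path becomes a boundary edge of both new pieces and is never an inner edge
of a piece again. A node that is not on the boundary of the initial hemisphere must reach the
boundary of a piece before all pieces are triangles, and it can do so only by lying on a path. The
first such path puts it into a face with the external edge that joins the two new nodes; before this
step it is in no face over an external edge, and afterwards it always is. -/

/-- The number of facets of `K` that contain `e`. -/
def cnt (K : Finset (Finset V)) (e : Finset V) : ℕ := (K.filter fun t => e ⊆ t).card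

/-! ### Incidence counts, links and connectedness -/

section Basic
variable {K L A B : Finset (Finset V)} {e t : Finset V} {u v w x y : V} {k : ℕ}

lemma mem_nodes : v ∈ nodes K ↔ ∃ t ∈ K, v ∈ t := by simp [nodes]

lemma mem_simplices : e ∈ simplices k K ↔ e.card = k ∧ ∃ t ∈ K, e ⊆ t := by
  simp only [simplices, Finset.mem_biUnion, Finset.mem_powersetCard]
  tauto

lemma mem_edges : e ∈ edges K ↔ e.card = 2 ∧ ∃ t ∈ K, e ⊆ t := mem_simplices

lemma cnt_pos : 0 < cnt K e ↔ ∃ t ∈ K, e ⊆ t := by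
  simp [cnt, Finset.card_pos, Finset.Nonempty]

lemma mem_bdry : e ∈ bdry k K ↔ e.card = k ∧ cnt K e = 1 := by
  simp only [bdry, Finset.mem_filter, mem_simplices, cnt]
  constructor
  · tauto
  · rintro ⟨h1, h2⟩
    exact ⟨⟨h1, cnt_pos.1 (by unfold cnt; omega)⟩, h2⟩

lemma mem_bdEdges : e ∈ bdEdges K ↔ e.card = 2 ∧ cnt K e = 1 := mem_bdry

lemma bdEdges_subset_edges : bdEdges K ⊆ edges K := Finset.filter_subset _ _

lemma mem_bdNodes : v ∈ bdNodes K ↔ ∃ e ∈ bdEdges K, v ∈ e := mem_nodes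

lemma bdNodes_subset_nodes : bdNodes K ⊆ nodes K := by
  intro v hv
  obtain ⟨e, he, hve⟩ := mem_bdNodes.1 hv
  obtain ⟨t, ht, het⟩ := (mem_edges.1 (bdEdges_subset_edges he)).2
  exact mem_nodes.2 ⟨t, ht, het hve⟩

lemma mem_link : e ∈ link K v ↔ v ∉ e ∧ insert v e ∈ K := by
  simp only [link, Finset.mem_image, Finset.mem_filter]
  constructor
  · rintro ⟨t, ⟨ht, hv⟩, rfl⟩
    exact ⟨Finset.notMem_erase v t, by rwa [Finset.insert_erase hv]⟩
  · rintro ⟨h1, h2⟩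
    exact ⟨_, ⟨h2, Finset.mem_insert_self _ _⟩, Finset.erase_insert h1⟩

lemma erase_mem_link (ht : t ∈ K) (hv : v ∈ t) : t.erase v ∈ link K v := by
  rw [mem_link, Finset.insert_erase hv]
  exact ⟨Finset.notMem_erase v t, ht⟩

lemma mem_nodes_link : x ∈ nodes (link K v) ↔ x ≠ v ∧ ∃ t ∈ K, v ∈ t ∧ x ∈ t := by
  rw [mem_nodes]
  constructor
  · rintro ⟨e, he, hx⟩
    rw [mem_link] at he
    refine ⟨fun h => he.1 (h ▸ hx), _, he.2, by simp, by simp [hx]⟩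
  · rintro ⟨hx, t, ht, hv, hxt⟩
    exact ⟨_, erase_mem_link ht hv, by simp [hx, hxt]⟩

lemma pair_subset_iff {s : Finset V} : ({u, v} : Finset V) ⊆ s ↔ u ∈ s ∧ v ∈ s := by
  simp [Finset.insert_subset_iff]

lemma pair_mem_edges : {u, v} ∈ edges K ↔ u ≠ v ∧ ∃ t ∈ K, u ∈ t ∧ v ∈ t := by
  rw [mem_edges]
  simp only [pair_subset_iff]
  refine and_congr_left' ⟨?_, Finset.card_pair⟩
  rintro h rfl
  simp at h

lemma edges_mono (h : K ⊆ L) : edges K ⊆ edges L := by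
  intro e
  simp only [mem_edges]
  rintro ⟨h1, t, ht, h2⟩
  exact ⟨h1, t, h ht, h2⟩

lemma nodes_mono (h : K ⊆ L) : nodes K ⊆ nodes L := by
  intro e
  simp only [mem_nodes]
  rintro ⟨t, ht, h2⟩
  exact ⟨t, h ht, h2⟩

lemma cnt_mono (h : K ⊆ L) : cnt K e ≤ cnt L e :=
  Finset.card_le_card (Finset.filter_subset_filter _ h)

lemma nodes_union : nodes (A ∪ B) = nodes A ∪ nodes B := by
  ext; simp only [mem_nodes, Finset.mem_union]; grind

lemma edges_union : edges (A ∪ B) = edges A ∪ edges B := by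
  ext; simp only [mem_edges, Finset.mem_union]; grind

lemma cnt_union (h : Disjoint A B) : cnt (A ∪ B) e = cnt A e + cnt B e := by
  unfold cnt
  rw [Finset.filter_union, Finset.card_union_of_disjoint]
  exact Finset.disjoint_filter_filter h

lemma exists_pair_of_mem (he : e.card = 2) (hv : v ∈ e) : ∃ w, w ≠ v ∧ e = {v, w} := by
  obtain ⟨a, b, hab, rfl⟩ := Finset.card_eq_two.1 he
  simp only [Finset.mem_insert, Finset.mem_singleton] at hv
  rcases hv with rfl | rfl
  · exact ⟨b, hab.symm, rfl⟩
  · exact ⟨a, hab, Finset.pair_comm _ _⟩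

lemma exists_triple_of_mem (ht : t.card = 3) (hv : v ∈ t) :
    ∃ x y, x ≠ v ∧ y ≠ v ∧ x ≠ y ∧ t = {v, x, y} := by
  have h : (t.erase v).card = 2 := by rw [Finset.card_erase_of_mem hv, ht]
  obtain ⟨x, y, hxy, h⟩ := Finset.card_eq_two.1 h
  have hx : x ∈ t.erase v := by simp [h]
  have hy : y ∈ t.erase v := by simp [h]
  refine ⟨x, y, (Finset.mem_erase.1 hx).1, (Finset.mem_erase.1 hy).1, hxy, ?_⟩
  rw [← h, Finset.insert_erase hv]

/-- A complex is connected iff every colouring of the nodes that is constant on facets is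
constant. -/
lemma connected_iff : Connected K ↔ ∀ P : V → Prop,
    (∀ t ∈ K, ∀ u ∈ t, ∀ w ∈ t, P u → P w) → ∀ u ∈ nodes K, ∀ w ∈ nodes K, P u → P w := by
  constructor
  · intro h P hP u hu w hw hPu
    have h1 := h u hu w hw
    induction h1 with
    | refl => exact hPu
    | tail _ hbc ih =>
      obtain ⟨-, t, ht, hb, hc⟩ := hbc
      exact hP t ht _ hb _ hc (ih (mem_nodes.2 ⟨t, ht, hb⟩))
  · intro h u hu w hw
    refine h (fun w => Relation.ReflTransGen (Adj K) u w) ?_ u hu w hw .refl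
    intro t ht a ha b hb hua
    by_cases hab : a = b
    · exact hab ▸ hua
    · exact hua.tail ⟨hab, t, ht, ha, hb⟩

/-- Phrased with the facets of `K` at `v` instead of those of the link. After a cut or a split the
facets are known explicitly, so a colouring can be transported without computing the link. -/
lemma link_connected_iff : Connected (link K v) ↔ ∀ P : V → Prop,
    (∀ t ∈ K, v ∈ t → ∀ x ∈ t, ∀ y ∈ t, x ≠ v → y ≠ v → P x → P y) →
    ∀ t ∈ K, v ∈ t → ∀ t' ∈ K, v ∈ t' → ∀ x ∈ t, ∀ y ∈ t', x ≠ v → y ≠ v → P x → P y := by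
  rw [connected_iff]
  refine forall_congr' fun P => ?_
  constructor
  · intro h h1 t ht hv t' ht' hv' x hx y hy hxv hyv
    refine h ?_ x (mem_nodes_link.2 ⟨hxv, t, ht, hv, hx⟩) y (mem_nodes_link.2 ⟨hyv, t', ht', hv', hy⟩)
    intro s hs a ha b hb
    obtain ⟨h2, h3⟩ := mem_link.1 hs
    exact h1 _ h3 (by simp) a (by simp [ha]) b (by simp [hb]) (fun h => h2 (h ▸ ha))
      (fun h => h2 (h ▸ hb))
  · intro h h1 u hu w hw
    obtain ⟨hu1, t, ht, hvt, hut⟩ := mem_nodes_link.1 hu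
    obtain ⟨hw1, t', ht', hvt', hwt'⟩ := mem_nodes_link.1 hw
    refine h ?_ t ht hvt t' ht' hvt' u hut w hwt' hu1 hw1
    intro s hs hvs x hx y hy hxv hyv
    exact h1 _ (erase_mem_link hs hvs) x (by simp [hx, hxv]) y (by simp [hy, hyv])

end Basic

/-! ### Paths as lists of nodes, and their edges -/

section Paths
variable {c : List V} {e : Finset V} {u v w x y a b : V}

@[simp] lemma pathEdges_nil : pathEdges ([] : List V) = [] := rfl
@[simp] lemma pathEdges_singleton : pathEdges [x] = [] := rfl
@[simp] lemma pathEdges_cons_cons {l : List V} :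
    pathEdges (x :: y :: l) = {x, y} :: pathEdges (y :: l) := rfl

lemma pathEdges_cons (hc : c.head? = some a) : pathEdges (x :: c) = {x, a} :: pathEdges c := by
  cases c with
  | nil => simp at hc
  | cons z l => simp at hc; subst hc; rfl

lemma pathEdges_append {l m : List V} (hl : l.getLast? = some x) (hm : m.head? = some y) :
    pathEdges (l ++ m) = pathEdges l ++ {x, y} :: pathEdges m := by
  induction l with
  | nil => simp at hl
  | cons z l ih =>
    cases l with
    | nil =>
      simp at hl; subst hl
      simpa using pathEdges_cons hm
    | cons z' l =>
      have := ih (by simpa using hl)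
      simpa using this

lemma length_pathEdges : (pathEdges c).length = c.length - 1 := by
  simp [pathEdges]

lemma subset_of_mem_pathEdges (h : e ∈ pathEdges c) (hv : v ∈ e) : v ∈ c := by
  induction c with
  | nil => simp at h
  | cons x l ih =>
    cases l with
    | nil => simp at h
    | cons y l =>
      simp only [pathEdges_cons_cons, List.mem_cons] at h
      rcases h with rfl | h
      · simp at hv; rcases hv with rfl | rfl <;> simp
      · exact List.mem_cons_of_mem _ (ih h)

lemma card_of_mem_pathEdges (hc : c.Nodup) (h : e ∈ pathEdges c) : e.card = 2 := by
  induction c with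
  | nil => simp at h
  | cons x l ih =>
    cases l with
    | nil => simp at h
    | cons y l =>
      simp only [pathEdges_cons_cons, List.mem_cons] at h
      rcases h with rfl | h
      · simp only [List.nodup_cons, List.mem_cons, not_or] at hc
        exact Finset.card_pair hc.1.1
      · exact ih hc.of_cons h

lemma nodup_pathEdges (hc : c.Nodup) : (pathEdges c).Nodup := by
  induction c with
  | nil => simp
  | cons x l ih =>
    cases l with
    | nil => simp
    | cons y l =>
      rw [pathEdges_cons_cons, List.nodup_cons]
      refine ⟨fun h => ?_, ih hc.of_cons⟩
      exact (List.nodup_cons.1 hc).1 (subset_of_mem_pathEdges h (by simp))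

/-- In a simple path every node is in two edges, the ends being in one edge less. -/
lemma countP_pathEdges (hc : c.Nodup) (ha : c.head? = some a) (hb : c.getLast? = some b) (v : V) :
    (pathEdges c).countP (fun e => v ∈ e) + (if v = a then 1 else 0) + (if v = b then 1 else 0) =
      if v ∈ c then 2 else 0 := by
  induction c generalizing a with
  | nil => simp at ha
  | cons x l ih =>
    simp at ha; subst ha
    cases l with
    | nil =>
      simp at hb; subst hb
      simp only [pathEdges_singleton, List.countP_nil, List.mem_singleton]
      split_ifs <;> simp
    | cons y l =>
      have := ih hc.of_cons rfl (by simpa using hb)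
      simp only [List.nodup_cons, List.mem_cons, not_or] at hc
      rw [pathEdges_cons_cons, List.countP_cons]
      simp only [List.mem_cons, Finset.mem_insert, Finset.mem_singleton] at this ⊢
      grind

lemma card_filter_pathEdges (hc : c.Nodup) (v : V) :
    ((pathEdges c).toFinset.filter fun e => v ∈ e).card =
      (pathEdges c).countP (fun e => v ∈ e) := by
  rw [List.countP_eq_length_filter, ← List.toFinset_card_of_nodup ((nodup_pathEdges hc).filter _),
    List.toFinset_filter]
  congr 1
  ext
  simp

lemma exists_pathEdge_of_mem (hc : 2 ≤ c.length) (hv : v ∈ c) : ∃ e ∈ pathEdges c, v ∈ e := by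
  induction c with
  | nil => simp at hv
  | cons x l ih =>
    cases l with
    | nil => simp at hc
    | cons y l =>
      simp only [pathEdges_cons_cons, List.mem_cons]
      by_cases h : v = x ∨ v = y
      · exact ⟨{x, y}, .inl rfl, by simpa using h⟩
      · push Not at h
        simp only [List.mem_cons, h.1, h.2, false_or] at hv
        cases l with
        | nil => simp at hv
        | cons z l =>
          obtain ⟨e, he, hve⟩ := ih (by simp) (by simp at hv ⊢; tauto)
          exact ⟨e, .inr he, hve⟩

omit [DecidableEq V] in
lemma two_le_length (ha : c.head? = some a) (hb : c.getLast? = some b) (hab : a ≠ b) :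
    2 ≤ c.length := by
  match c with
  | [] => simp at ha
  | [x] => simp at ha hb; subst ha hb; exact absurd rfl hab
  | x :: y :: l => simp

lemma mem_pathEdges_iff {d : List V} : e ∈ pathEdges d ↔
    ∃ (i : ℕ) (h : i + 1 < d.length), e = {d[i], d[i + 1]} := by
  induction d with
  | nil => simp
  | cons x l ih =>
    cases l with
    | nil => simp
    | cons y l =>
      rw [pathEdges_cons_cons, List.mem_cons, ih]
      constructor
      · rintro (rfl | ⟨i, h, rfl⟩)
        · exact ⟨0, by simp, by simp⟩
        · exact ⟨i + 1, by simpa using h, by simp⟩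
      · rintro ⟨i, h, rfl⟩
        cases i with
        | zero => left; simp
        | succ i => right; exact ⟨i, by simpa using h, by simp⟩

/-- A colouring that does not change along the edges of a path is constant on it. -/
lemma pathEdges_color (P : V → Prop) (h : ∀ u w, {u, w} ∈ pathEdges c → (P u ↔ P w))
    (hx : x ∈ c) (hy : y ∈ c) : P x → P y := by
  have key : ∀ (l : List V) (y : V), (∀ e ∈ pathEdges l, e ∈ pathEdges c) → ∀ x ∈ l,
      l.head? = some y → (P x ↔ P y) := by
    intro l
    induction l with
    | nil => simp
    | cons z l ih =>
      intro y hl x hx hy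
      simp at hy
      subst hy
      cases l with
      | nil => simp at hx; rw [hx]
      | cons z' l =>
        have h1 := h _ _ (hl {z, z'} (by simp))
        rcases List.mem_cons.1 hx with rfl | hx
        · rfl
        · rw [h1]
          exact ih z' (fun e he => hl e (List.mem_cons_of_mem _ he)) x hx rfl
  cases hh : c with
  | nil => simp [hh] at hx
  | cons z l =>
    have h1 := key c z (fun _ => id) x hx (by simp [hh])
    have h2 := key c z (fun _ => id) y hy (by simp [hh])
    exact (h1.trans h2.symm).1

end Paths

end BallSplit

namespace BallSplit

/-! ### Rank counts for two matrices with product zero -/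

section LinearAlgebra
variable {n e f F : Type*} [Fintype e] [Fintype f] [Field F]

lemma range_le_ker_of_mul_eq_zero (M : Matrix n e F) (N : Matrix e f F) (h : M * N = 0) :
    LinearMap.range N.mulVecLin ≤ LinearMap.ker M.mulVecLin := by
  rintro _ ⟨y, rfl⟩
  simp [h]

open Module in
-- A matrix and its transpose have equal rank, so their kernels differ in dimension by the number of
-- columns minus the number of rows.
lemma finrank_ker_add_card [Fintype n] (M : Matrix n e F) {b : ℕ}
    (hM : finrank F (LinearMap.ker M.transpose.mulVecLin) ≤ b) :
    finrank F (LinearMap.ker M.mulVecLin) + Fintype.card n ≤ Fintype.card e + b := by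
  have h1 := LinearMap.finrank_range_add_finrank_ker M.mulVecLin
  have h2 := LinearMap.finrank_range_add_finrank_ker M.transpose.mulVecLin
  have h3 := Matrix.rank_transpose M
  simp only [Matrix.rank, finrank_fintype_fun_eq_card] at h1 h2 h3
  omega

omit [Fintype e] in
open Module in
lemma card_le_finrank_range (N : Matrix e f F) {a : ℕ}
    (hN : finrank F (LinearMap.ker N.mulVecLin) ≤ a) :
    Fintype.card f ≤ finrank F (LinearMap.range N.mulVecLin) + a := by
  have h1 := LinearMap.finrank_range_add_finrank_ker N.mulVecLin
  simp only [finrank_fintype_fun_eq_card] at h1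
  omega

open Module in
-- The image of `N` has dimension at least `|f| - a` and lies in the kernel of `M`, which has
-- dimension at most `|e| - |n| + b`.
lemma card_add_card_le_of_mul_eq_zero [Fintype n] (M : Matrix n e F) (N : Matrix e f F) (h : M * N = 0)
    {a b : ℕ} (hN : finrank F (LinearMap.ker N.mulVecLin) ≤ a)
    (hM : finrank F (LinearMap.ker M.transpose.mulVecLin) ≤ b) :
    Fintype.card f + Fintype.card n ≤ Fintype.card e + a + b := by
  have h1 := Submodule.finrank_mono (range_le_ker_of_mul_eq_zero M N h)
  have h2 := finrank_ker_add_card M hM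
  have h3 := card_le_finrank_range N hN
  omega

open Module in
-- If the two bounds of the inequality above meet, image and kernel have the same dimension and
-- coincide: there is no homology in the middle.
lemma exists_mulVec_eq_of_card [Fintype n] (M : Matrix n e F) (N : Matrix e f F) (h : M * N = 0)
    {a b : ℕ} (hN : finrank F (LinearMap.ker N.mulVecLin) ≤ a)
    (hM : finrank F (LinearMap.ker M.transpose.mulVecLin) ≤ b)
    (hcard : Fintype.card e + a + b ≤ Fintype.card f + Fintype.card n) {z : e → F}
    (hz : M.mulVec z = 0) : ∃ y, N.mulVec y = z := by
  have h1 := Submodule.finrank_mono (range_le_ker_of_mul_eq_zero M N h)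
  have h2 := finrank_ker_add_card M hM
  have h3 := card_le_finrank_range N hN
  have h4 := Submodule.eq_of_le_of_finrank_le (range_le_ker_of_mul_eq_zero M N h) (by omega)
  have h5 : z ∈ LinearMap.ker M.mulVecLin := by simpa using hz
  rw [← h4] at h5
  obtain ⟨y, hy⟩ := h5
  exact ⟨y, by simpa using hy⟩

end LinearAlgebra

variable {V : Type*} [DecidableEq V]

/-! ### Incidence matrices modulo 2 -/

section Incidence
variable {K : Finset (Finset V)} {S : Finset V} {E : Finset (Finset V)} {t : Finset V} {v : V}

lemma powersetCard_two_filter (ht : t.card = 3) (hv : v ∈ t) :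
    ((t.powersetCard 2).filter fun e => v ∈ e).card = 2 := by
  obtain ⟨x, y, hx, hy, hxy, rfl⟩ := exists_triple_of_mem ht hv
  have : (((({v, x, y} : Finset V)).powersetCard 2).filter fun e => v ∈ e) =
      {{v, x}, {v, y}} := by
    ext e
    simp only [Finset.mem_filter, Finset.mem_powersetCard, Finset.mem_insert,
      Finset.mem_singleton]
    constructor
    · rintro ⟨⟨h1, h2⟩, h3⟩
      obtain ⟨w, hw, rfl⟩ := exists_pair_of_mem h2 h3
      have := h1 (show w ∈ ({v, w} : Finset V) by simp)
      simp only [Finset.mem_insert, Finset.mem_singleton] at this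
      rcases this with h | rfl | rfl
      · exact absurd h hw
      · simp
      · simp
    · rintro (rfl | rfl)
      · refine ⟨⟨by grind, Finset.card_pair hx.symm⟩, by simp⟩
      · refine ⟨⟨by grind, Finset.card_pair hy.symm⟩, by simp⟩
  rw [this, Finset.card_pair]
  intro h
  have : x ∈ ({v, y} : Finset V) := h ▸ (by simp)
  simp [hx, hxy] at this

/-- The incidence matrix of nodes and edges modulo 2. -/
def nodeEdge (S : Finset V) (E : Finset (Finset V)) : Matrix S E (ZMod 2) :=
  Matrix.of fun v e => if v.1 ∈ e.1 then 1 else 0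

/-- The incidence matrix of edges and triangles modulo 2. -/
def edgeFace (E K : Finset (Finset V)) : Matrix E K (ZMod 2) :=
  Matrix.of fun e t => if e.1 ⊆ t.1 then 1 else 0

/-- A triangle has exactly two edges at each of its nodes, and `2 = 0`. Only the edges of triangles
at nodes of `S` have to be in `E`, so this covers the whole complex as well as the interior nodes
with the interior edges. -/
lemma nodeEdge_mul_edgeFace (h3 : ∀ t ∈ K, t.card = 3) (h2 : ∀ e ∈ E, e.card = 2)
    (h : ∀ v ∈ S, ∀ t ∈ K, ∀ e, e.card = 2 → v ∈ e → e ⊆ t → e ∈ E) :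
    nodeEdge S E * edgeFace E K = 0 := by
  ext v t
  simp only [Matrix.mul_apply, nodeEdge, edgeFace, Matrix.of_apply, mul_ite, mul_one, mul_zero,
    Matrix.zero_apply]
  rw [Finset.sum_coe_sort E (fun e => if e ⊆ t.1 then (if v.1 ∈ e then (1 : ZMod 2) else 0) else 0)]
  simp only [← ite_and]
  rw [Finset.sum_boole]
  by_cases hv : v.1 ∈ t.1
  · have : (E.filter fun e => e ⊆ t.1 ∧ v.1 ∈ e) =
        ((t.1.powersetCard 2).filter fun e => v.1 ∈ e) := by
      ext e
      simp only [Finset.mem_filter, Finset.mem_powersetCard]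
      constructor
      · rintro ⟨ha, hb, hc⟩
        exact ⟨⟨hb, h2 e ha⟩, hc⟩
      · rintro ⟨⟨hb, ha⟩, hc⟩
        exact ⟨h _ v.2 _ t.2 e ha hc hb, hb, hc⟩
    rw [this, powersetCard_two_filter (h3 _ t.2) hv]
    rfl
  · rw [Finset.filter_false_of_mem]
    · simp
    · rintro e - ⟨ha, hb⟩
      exact hv (ha hb)

/-- The extension by zero. -/
def extendZero {α : Type*} [DecidableEq α] (S : Finset α) (f : S → ZMod 2) (v : α) : ZMod 2 :=
  if h : v ∈ S then f ⟨v, h⟩ else 0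

lemma extendZero_coe {α : Type*} [DecidableEq α] (S : Finset α) (f : S → ZMod 2) (v : S) :
    extendZero S f v = f v := by simp [extendZero]

lemma nodeEdge_transpose_mulVec (f : S → ZMod 2) {u w : V} (hE : {u, w} ∈ E) (huw : u ≠ w) :
    ((nodeEdge S E).transpose.mulVec f) ⟨{u, w}, hE⟩ =
      extendZero S f u + extendZero S f w := by
  simp only [Matrix.mulVec, dotProduct, Matrix.transpose_apply, nodeEdge, Matrix.of_apply,
    ite_mul, one_mul, zero_mul]
  simp_rw [← extendZero_coe S f]
  rw [Finset.sum_coe_sort S (fun v => if v ∈ ({u, w} : Finset V) then extendZero S f v else 0),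
    ← Finset.sum_filter, ← Finset.sum_pair (f := extendZero S f) huw]
  refine Finset.sum_subset_zero_on_sdiff ?_ ?_ (fun _ _ => rfl)
  · intro v hv
    exact (Finset.mem_filter.1 hv).2
  · intro v hv
    simp only [Finset.mem_sdiff, Finset.mem_filter, not_and] at hv
    have : v ∉ S := fun h => hv.2 h hv.1
    simp [extendZero, this]

lemma edgeFace_mulVec (y : K → ZMod 2) {e : Finset V} (hE : e ∈ E) :
    ((edgeFace E K).mulVec y) ⟨e, hE⟩ =
      ∑ t ∈ K.filter (fun t => e ⊆ t), extendZero K y t := by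
  simp only [Matrix.mulVec, dotProduct, edgeFace, Matrix.of_apply, ite_mul, one_mul, zero_mul]
  simp_rw [← extendZero_coe K y]
  rw [Finset.sum_coe_sort K (fun t => if e ⊆ t then extendZero K y t else 0),
    ← Finset.sum_filter]

lemma nodeEdge_mulVec (z : Finset V → ZMod 2) (v : S) :
    ((nodeEdge S E).mulVec fun e => z e) v = ∑ e ∈ E.filter (fun e => v.1 ∈ e), z e := by
  simp only [Matrix.mulVec, dotProduct, nodeEdge, Matrix.of_apply, ite_mul, one_mul, zero_mul]
  rw [Finset.sum_coe_sort E (fun e => if v.1 ∈ e then z e else 0), ← Finset.sum_filter]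

end Incidence

/-! ### Homology of surfaces and disks modulo 2 -/

section Surface
variable {K A B : Finset (Finset V)} {e t : Finset V} {u v w x y a b : V} {c : List V}

/-- A function on the triangles that does not change across edges is constant. -/
lemma IsSurface.eq_of_edges (hK : IsSurface K) {α : Type*} (y : Finset V → α)
    (h : ∀ e ∈ edges K, ∀ t ∈ K, ∀ t' ∈ K, e ⊆ t → e ⊆ t' → y t = y t') :
    ∀ t ∈ K, ∀ t' ∈ K, y t = y t' := by
  intro t₀ ht₀ t₁ ht₁
  -- The value spreads to all triangles at a node `v`: a node `x` of the link is coloured if all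
  -- triangles at the edge `vx` have the value of `t₀`, and the link is connected.
  have key : ∀ t ∈ K, y t = y t₀ → ∀ v ∈ t, ∀ t' ∈ K, v ∈ t' → y t' = y t₀ := by
    intro t ht hy v hv t' ht' hv'
    have hl := link_connected_iff.1 (hK.link_connected v (mem_nodes.2 ⟨t, ht, hv⟩))
      (fun x => ∀ s ∈ K, v ∈ s → x ∈ s → y s = y t₀) ?_ t ht hv t' ht' hv'
    · obtain ⟨x, x', hx, -, -, rfl⟩ := exists_triple_of_mem (hK.card_eq t ht) hv
      obtain ⟨z, z', hz, -, -, rfl⟩ := exists_triple_of_mem (hK.card_eq t' ht') hv'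
      refine hl x (by simp) z (by simp) hx hz ?_ _ ht' (by simp) (by simp)
      intro s hs hvs hxs
      rw [← hy]
      exact h {v, x} (pair_mem_edges.2 ⟨hx.symm, s, hs, hvs, hxs⟩) _ hs _ ht
        (pair_subset_iff.2 ⟨hvs, hxs⟩) (pair_subset_iff.2 ⟨by simp, by simp⟩)
    · intro s hs hvs x hx z hz hxv hzv hP s' hs' hvs' hzs'
      rw [← hP s hs hvs hx]
      exact h {v, z} (pair_mem_edges.2 ⟨hzv.symm, s, hs, hvs, hz⟩) _ hs' _ hs
        (pair_subset_iff.2 ⟨hvs', hzs'⟩) (pair_subset_iff.2 ⟨hvs, hz⟩)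
  have hne : ∀ t ∈ K, ∃ v, v ∈ t := fun t ht => by
    have := hK.card_eq t ht
    exact Finset.card_pos.1 (by omega)
  obtain ⟨v₀, hv₀⟩ := hne t₀ ht₀
  obtain ⟨v₁, hv₁⟩ := hne t₁ ht₁
  refine (connected_iff.1 hK.connected (fun v => ∀ s ∈ K, v ∈ s → y s = y t₀) ?_ v₀
    (mem_nodes.2 ⟨_, ht₀, hv₀⟩) v₁ (mem_nodes.2 ⟨_, ht₁, hv₁⟩) ?_ t₁ ht₁ hv₁).symm
  · intro t ht u hu w hw hP s hs hws
    exact key t ht (hP t ht hu) w hw s hs hws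
  · intro s hs hvs
    exact key t₀ ht₀ rfl v₀ hv₀ s hs hvs

lemma IsSurface.cnt_le (hK : IsSurface K) (he : e ∈ edges K) : cnt K e ≤ 2 := hK.edge_le e he

lemma cnt_pos_of_mem_edges (he : e ∈ edges K) : 0 < cnt K e := cnt_pos.2 (mem_edges.1 he).2

lemma IsSurface.cnt_eq_two (hK : IsSurface K) (he : e ∈ edges K) (hb : e ∉ bdEdges K) :
    cnt K e = 2 := by
  have h1 := hK.cnt_le he
  have h2 := cnt_pos_of_mem_edges he
  have h3 : cnt K e ≠ 1 := fun h => hb (mem_bdEdges.2 ⟨(mem_edges.1 he).1, h⟩)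
  omega

lemma ne_of_pair_mem_edges (h : {u, v} ∈ edges K) : u ≠ v := (pair_mem_edges.1 h).1

lemma zmod_two_add_eq_zero {a b : ZMod 2} (h : a + b = 0) : a = b := by
  rw [CharTwo.add_eq_zero] at h
  exact h

/-- The double counting of the edges of the triangles at a node. -/
lemma sum_cnt_eq (h3 : ∀ t ∈ K, t.card = 3) (v : V) :
    ∑ e ∈ (edges K).filter (fun e => v ∈ e), cnt K e = 2 * (K.filter fun t => v ∈ t).card := by
  have h := Finset.sum_card_bipartiteAbove_eq_sum_card_bipartiteBelow
    (s := (edges K).filter fun e => v ∈ e) (t := K) (fun e t => e ⊆ t)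
  simp only [Finset.bipartiteAbove, Finset.bipartiteBelow] at h
  unfold cnt
  rw [h, mul_comm, ← smul_eq_mul, ← Finset.sum_const, Finset.sum_filter]
  refine Finset.sum_congr rfl fun t ht => ?_
  split_ifs with hv
  · rw [← powersetCard_two_filter (h3 t ht) hv]
    congr 1
    ext e
    simp only [Finset.mem_filter, Finset.mem_powersetCard, mem_edges]
    constructor
    · tauto
    · rintro ⟨⟨h1, h2⟩, h3⟩
      exact ⟨⟨⟨h2, t, ht, h1⟩, h3⟩, h1⟩
  · rw [Finset.card_eq_zero, Finset.filter_false_of_mem]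
    intro e he hs
    exact hv (hs (Finset.mem_filter.1 he).2)

/-- In the double count `sum_cnt_eq` the edges in two triangles contribute an even number and the
total is even, so the boundary edges contribute an even number too. This needs no connected links,
so it also applies to arbitrary sets of triangles of a surface. -/
lemma even_card_bdEdges_at (h3 : ∀ t ∈ K, t.card = 3) (h2 : ∀ e ∈ edges K, cnt K e ≤ 2) (v : V) :
    Even ((bdEdges K).filter fun e => v ∈ e).card := by
  have h := sum_cnt_eq h3 v
  have h4 : (((edges K).filter fun e => v ∈ e).filter fun e => cnt K e = 1) =
      (bdEdges K).filter fun e => v ∈ e := by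
    ext e
    simp only [Finset.mem_filter, mem_bdEdges, mem_edges]
    constructor
    · tauto
    · rintro ⟨⟨h1, h2⟩, h3⟩
      exact ⟨⟨⟨h1, cnt_pos.1 (by omega)⟩, h3⟩, h2⟩
  rw [← Finset.sum_filter_add_sum_filter_not _ (fun e => cnt K e = 1), h4] at h
  have h5 : ∑ e ∈ (bdEdges K).filter (fun e => v ∈ e), cnt K e =
      ((bdEdges K).filter fun e => v ∈ e).card := by
    rw [Finset.card_eq_sum_ones]
    refine Finset.sum_congr rfl fun e he => ?_
    exact (mem_bdEdges.1 (Finset.mem_filter.1 he).1).2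
  have h6 : 2 ∣ ∑ e ∈ ((edges K).filter fun e => v ∈ e).filter fun e => ¬ cnt K e = 1, cnt K e := by
    refine Finset.dvd_sum fun e he => ?_
    simp only [Finset.mem_filter] at he
    have := h2 e he.1.1
    have := cnt_pos_of_mem_edges he.1.1
    have : cnt K e = 2 := by omega
    rw [this]
  rw [h5] at h
  rw [even_iff_two_dvd]
  omega

/-- By parity a boundary node is in at least two boundary edges, and an edge has two nodes. Only
this inequality is needed for the relative Euler count. -/
lemma card_bdNodes_le (h3 : ∀ t ∈ K, t.card = 3) (h2 : ∀ e ∈ edges K, cnt K e ≤ 2) :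
    (bdNodes K).card ≤ (bdEdges K).card := by
  have := Finset.card_mul_le_card_mul (s := bdNodes K) (t := bdEdges K) (fun v e => v ∈ e)
    (m := 2) (n := 2) ?_ ?_
  · omega
  · intro v hv
    obtain ⟨e, he, hve⟩ := mem_bdNodes.1 hv
    have h1 := even_card_bdEdges_at h3 h2 v
    have h4 : 0 < ((bdEdges K).filter fun e => v ∈ e).card :=
      Finset.card_pos.2 ⟨e, by simp [he, hve]⟩
    rw [even_iff_two_dvd] at h1
    simp only [Finset.bipartiteAbove]
    omega
  · intro e he
    rw [← (mem_bdEdges.1 he).1]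
    refine Finset.card_le_card fun v hv => ?_
    exact (Finset.mem_filter.1 hv).2

lemma extendZero_edge_eq (hK : IsSurface K) (y : K → ZMod 2) (he : e ∈ edges K)
    (hb : e ∉ bdEdges K) (hs : ∑ t ∈ K.filter (fun t => e ⊆ t), extendZero K y t = 0) {t t' : Finset V}
    (ht : t ∈ K) (ht' : t' ∈ K) (het : e ⊆ t) (het' : e ⊆ t') :
    extendZero K y t = extendZero K y t' := by
  by_cases htt : t = t'
  · rw [htt]
  · have h2 := hK.cnt_eq_two he hb
    have : K.filter (fun t => e ⊆ t) = {t, t'} := by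
      symm
      refine Finset.eq_of_subset_of_card_le ?_ ?_
      · intro s hs
        simp only [Finset.mem_insert, Finset.mem_singleton] at hs
        rcases hs with rfl | rfl <;> simp [*]
      · rw [Finset.card_pair htt]
        exact h2.le
    rw [this, Finset.sum_pair htt] at hs
    exact zmod_two_add_eq_zero hs

lemma eq_of_bdEdge {t t' : Finset V} (hb : e ∈ bdEdges K)
    (ht : t ∈ K) (ht' : t' ∈ K) (het : e ⊆ t) (het' : e ⊆ t') : t = t' := by
  have h := (mem_bdEdges.1 hb).2
  unfold cnt at h
  obtain ⟨s, hs⟩ := Finset.card_eq_one.1 h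
  have h1 : t ∈ K.filter (fun t => e ⊆ t) := by simp [ht, het]
  have h2 : t' ∈ K.filter (fun t => e ⊆ t) := by simp [ht', het']
  rw [hs] at h1 h2
  simp at h1 h2
  rw [h1, h2]

/-- A relative 2-cycle has equal values on the two triangles of each inner edge, hence is constant.
-/
lemma finrank_ker_edgeFace_le (hK : IsSurface K) :
    Module.finrank (ZMod 2)
      (LinearMap.ker (edgeFace (edges K \ bdEdges K) K).mulVecLin) ≤ 1 := by
  obtain ⟨t₀, ht₀⟩ := hK.nonempty
  by_cases hker : ∃ y : LinearMap.ker (edgeFace (edges K \ bdEdges K) K).mulVecLin, y ≠ 0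
  swap
  · push Not at hker
    exact finrank_le_one (0 : LinearMap.ker (edgeFace (edges K \ bdEdges K) K).mulVecLin)
      fun w => ⟨0, by rw [hker w, zero_smul]⟩
  have hconst : ∀ y : LinearMap.ker (edgeFace (edges K \ bdEdges K) K).mulVecLin,
      ∀ t : K, y.1 t = y.1 ⟨t₀, ht₀⟩ := by
    rintro ⟨y, hy⟩ t
    have := hK.eq_of_edges (extendZero K y) ?_ t.1 t.2 t₀ ht₀
    · simpa [extendZero, ht₀] using this
    · intro e he t ht t' ht' het het'
      by_cases hb : e ∈ bdEdges K
      · rw [eq_of_bdEdge hb ht ht' het het']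
      · refine extendZero_edge_eq hK y he hb ?_ ht ht' het het'
        have h1 := congrFun (show (edgeFace (edges K \ bdEdges K) K).mulVec y = 0 from hy)
          ⟨e, Finset.mem_sdiff.2 ⟨he, hb⟩⟩
        rwa [edgeFace_mulVec] at h1
  obtain ⟨y, hy⟩ := hker
  refine finrank_le_one y fun w => ?_
  have hy0 : y.1 ⟨t₀, ht₀⟩ ≠ 0 := by
    intro h
    apply hy
    ext t
    rw [hconst, h]
    rfl
  refine ⟨w.1 ⟨t₀, ht₀⟩ / y.1 ⟨t₀, ht₀⟩, ?_⟩
  ext t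
  simp only [Submodule.coe_smul, Pi.smul_apply, smul_eq_mul]
  rw [hconst y t, hconst w t]
  field_simp

/-- Now the condition at a boundary edge, which lies in a single triangle, forces the constant to be
0. -/
lemma finrank_ker_edgeFace_eq_zero (hK : IsSurface K) (hb : (bdEdges K).Nonempty) :
    Module.finrank (ZMod 2) (LinearMap.ker (edgeFace (edges K) K).mulVecLin) ≤ 0 := by
  obtain ⟨e₀, he₀⟩ := hb
  obtain ⟨t₀, ht₀, het₀⟩ := (mem_edges.1 (bdEdges_subset_edges he₀)).2
  rw [Nat.le_zero, Submodule.finrank_eq_zero, eq_bot_iff]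
  intro y hy
  have hy' : ∀ e ∈ edges K, ∑ t ∈ K.filter (fun t => e ⊆ t), extendZero K y t = 0 := by
    intro e he
    have h1 := congrFun (show (edgeFace (edges K) K).mulVec y = 0 from hy) ⟨e, he⟩
    rwa [edgeFace_mulVec] at h1
  have h0 : extendZero K y t₀ = 0 := by
    have h := hy' _ (bdEdges_subset_edges he₀)
    have h2 : K.filter (fun t => e₀ ⊆ t) = {t₀} := by
      ext t
      simp only [Finset.mem_filter, Finset.mem_singleton]
      constructor
      · rintro ⟨h3, h4⟩
        exact eq_of_bdEdge he₀ h3 ht₀ h4 het₀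
      · rintro rfl
        exact ⟨ht₀, het₀⟩
    rwa [h2, Finset.sum_singleton] at h
  rw [Submodule.mem_bot]
  ext t
  rw [← extendZero_coe K y, hK.eq_of_edges (extendZero K y) ?_ t.1 t.2 t₀ ht₀, h0]
  · rfl
  · intro e he t ht t' ht' het het'
    by_cases hb : e ∈ bdEdges K
    · rw [eq_of_bdEdge hb ht ht' het het']
    · exact extendZero_edge_eq hK y he hb (hy' e he) ht ht' het het'

lemma extendZero_connected (hK : IsSurface K) (f : V → ZMod 2)
    (h : ∀ u w, {u, w} ∈ edges K → f u + f w = 0) : ∀ u ∈ nodes K, ∀ w ∈ nodes K, f u = f w := by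
  intro u hu w hw
  refine (connected_iff.1 hK.connected (fun v => f v = f u) ?_ u hu w hw rfl).symm
  intro t ht a ha b hb hab
  by_cases hab' : a = b
  · rw [← hab', hab]
  · rw [← hab]
    exact (zmod_two_add_eq_zero (h a b (pair_mem_edges.2 ⟨hab', t, ht, ha, hb⟩))).symm

/-- The kernel of the transpose consists of the node functions with equal values at the ends of each
edge; by connectedness these are the constants. -/
lemma finrank_ker_nodeEdge_le (hK : IsSurface K) :
    Module.finrank (ZMod 2)
      (LinearMap.ker (nodeEdge (nodes K) (edges K)).transpose.mulVecLin) ≤ 1 := by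
  obtain ⟨t₀, ht₀⟩ := hK.nonempty
  obtain ⟨v₀, hv₀⟩ : ∃ v, v ∈ t₀ := Finset.card_pos.1 (by rw [hK.card_eq _ ht₀]; omega)
  have hv₀ : v₀ ∈ nodes K := mem_nodes.2 ⟨t₀, ht₀, hv₀⟩
  have hconst : ∀ y : LinearMap.ker (nodeEdge (nodes K) (edges K)).transpose.mulVecLin,
      ∀ v : nodes K, y.1 v = y.1 ⟨v₀, hv₀⟩ := by
    rintro ⟨y, hy⟩ v
    have := extendZero_connected hK (extendZero (nodes K) y) ?_ v.1 v.2 v₀ hv₀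
    · simpa [extendZero, hv₀] using this
    · intro u w huw
      rw [← nodeEdge_transpose_mulVec (E := edges K) y huw (ne_of_pair_mem_edges huw)]
      exact congrFun (show (nodeEdge (nodes K) (edges K)).transpose.mulVec y = 0 from hy) ⟨_, huw⟩
  by_cases hker : ∃ y : LinearMap.ker (nodeEdge (nodes K) (edges K)).transpose.mulVecLin, y ≠ 0
  swap
  · push Not at hker
    exact finrank_le_one (0 : LinearMap.ker (nodeEdge (nodes K) (edges K)).transpose.mulVecLin)
      fun w => ⟨0, by rw [hker w, zero_smul]⟩
  obtain ⟨y, hy⟩ := hker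
  refine finrank_le_one y fun w => ?_
  have hy0 : y.1 ⟨v₀, hv₀⟩ ≠ 0 := by
    intro h
    apply hy
    ext t
    rw [hconst, h]
    rfl
  refine ⟨w.1 ⟨v₀, hv₀⟩ / y.1 ⟨v₀, hv₀⟩, ?_⟩
  ext t
  simp only [Submodule.coe_smul, Pi.smul_apply, smul_eq_mul]
  rw [hconst y t, hconst w t]
  field_simp

/-- A connected surface with boundary has Euler characteristic at most 1. -/
lemma IsSurface.euler_le_one (hK : IsSurface K) (hb : (bdEdges K).Nonempty) : euler K ≤ 1 := by
  have h := card_add_card_le_of_mul_eq_zero (nodeEdge (nodes K) (edges K)) (edgeFace (edges K) K)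
    (nodeEdge_mul_edgeFace hK.card_eq (fun e he => (mem_edges.1 he).1)
      fun v _ t ht e h2 _ het => mem_edges.2 ⟨h2, t, ht, het⟩)
    (finrank_ker_edgeFace_eq_zero hK hb) (finrank_ker_nodeEdge_le hK)
  simp only [Fintype.card_coe] at h
  unfold euler
  omega

/-- Extended by zero, such a function is constant along all edges, also along those between two
boundary nodes, and it vanishes on the boundary. -/
lemma finrank_ker_nodeEdge_interior_eq_zero (hK : IsSurface K) (hb : (bdEdges K).Nonempty) :
    Module.finrank (ZMod 2)
      (LinearMap.ker (nodeEdge (nodes K \ bdNodes K)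
        (edges K \ bdEdges K)).transpose.mulVecLin) ≤ 0 := by
  obtain ⟨e₀, he₀⟩ := hb
  obtain ⟨v₀, hv₀⟩ : ∃ v, v ∈ e₀ := Finset.card_pos.1 (by rw [(mem_bdEdges.1 he₀).1]; omega)
  have hv₀ : v₀ ∈ bdNodes K := mem_bdNodes.2 ⟨e₀, he₀, hv₀⟩
  rw [Nat.le_zero, Submodule.finrank_eq_zero, eq_bot_iff]
  intro y hy
  rw [Submodule.mem_bot]
  ext v
  rw [← extendZero_coe _ y, extendZero_connected hK (extendZero (nodes K \ bdNodes K) y) ?_ v.1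
    (Finset.mem_sdiff.1 v.2).1 v₀ (bdNodes_subset_nodes hv₀)]
  · simp [extendZero, hv₀]
  · intro u w huw
    by_cases hu : u ∈ bdNodes K ∧ w ∈ bdNodes K
    · simp [extendZero, hu.1, hu.2]
    · have hE : {u, w} ∈ edges K \ bdEdges K := by
        refine Finset.mem_sdiff.2 ⟨huw, fun h => hu ⟨?_, ?_⟩⟩ <;>
          exact mem_bdNodes.2 ⟨_, h, by simp⟩
      rw [← nodeEdge_transpose_mulVec y hE (ne_of_pair_mem_edges huw)]
      exact congrFun (show (nodeEdge (nodes K \ bdNodes K)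
        (edges K \ bdEdges K)).transpose.mulVec y = 0 from hy) ⟨_, hE⟩

/-- In a disk, every cycle relative to the boundary is a boundary relative to the boundary. -/
lemma IsDisk.exists_rel_boundary (hK : IsDisk K) (z : Finset V → ZMod 2)
    (hz : ∀ v ∈ nodes K, v ∉ bdNodes K →
      ∑ e ∈ (edges K \ bdEdges K).filter (fun e => v ∈ e), z e = 0) :
    ∃ y : Finset V → ZMod 2, ∀ e ∈ edges K, e ∉ bdEdges K →
      ∑ t ∈ K.filter (fun t => e ⊆ t), y t = z e := by
  have hS := hK.toIsSurface
  have hbe := hK.bdry_nonempty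
  have hint : ∀ v ∈ nodes K \ bdNodes K, ∀ t ∈ K, ∀ e : Finset V, e.card = 2 → v ∈ e → e ⊆ t →
      e ∈ edges K \ bdEdges K := fun v hv t ht e h2 hve het =>
    Finset.mem_sdiff.2 ⟨mem_edges.2 ⟨h2, t, ht, het⟩, fun h =>
      (Finset.mem_sdiff.1 hv).2 (mem_bdNodes.2 ⟨e, h, hve⟩)⟩
  -- Removing the boundary from the Euler count takes away `|bdNodes K|` nodes and at least as many
  -- edges. The constants are those of the two kernel bounds: 1 for the constant relative 2-cycle, 0
  -- for the nodes.
  have hcard : Fintype.card ↥(edges K \ bdEdges K) + 1 + 0 ≤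
      Fintype.card ↥K + Fintype.card ↥(nodes K \ bdNodes K) := by
    have h1 := hK.euler_eq
    have h2 := card_bdNodes_le hS.card_eq fun e he => hS.cnt_le he
    have h3 := Finset.card_sdiff_add_card_eq_card (bdNodes_subset_nodes (K := K))
    have h4 := Finset.card_sdiff_add_card_eq_card (bdEdges_subset_edges (K := K))
    simp only [Fintype.card_coe]
    unfold euler at h1
    omega
  have hz' : (nodeEdge (nodes K \ bdNodes K) (edges K \ bdEdges K)).mulVec (fun e => z e) = 0 := by
    ext v
    rw [nodeEdge_mulVec, hz v.1 (Finset.mem_sdiff.1 v.2).1 (Finset.mem_sdiff.1 v.2).2]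
    rfl
  obtain ⟨y, hy⟩ := exists_mulVec_eq_of_card _ (edgeFace (edges K \ bdEdges K) K)
    (nodeEdge_mul_edgeFace hS.card_eq (fun e he => (mem_edges.1 (Finset.mem_sdiff.1 he).1).1) hint)
    (finrank_ker_edgeFace_le hS) (finrank_ker_nodeEdge_interior_eq_zero hS hbe) hcard hz'
  refine ⟨extendZero K y, fun e he hb => ?_⟩
  have := congrFun hy ⟨e, Finset.mem_sdiff.2 ⟨he, hb⟩⟩
  rwa [edgeFace_mulVec] at this

end Surface

end BallSplit

namespace BallSplit

variable {V : Type*} [DecidableEq V]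

/-! ### Cutting a disk along a splitting path -/

section Cut
variable {K A B : Finset (Finset V)} {e t : Finset V} {u v w x y a b : V} {c : List V}

lemma IsSplittingPath.two_le_length (hc : IsSplittingPath K a b c) : 2 ≤ c.length :=
  BallSplit.two_le_length hc.head_eq hc.last_eq hc.ends_ne

lemma IsSplittingPath.mem_nodes (hc : IsSplittingPath K a b c) (hv : v ∈ c) : v ∈ nodes K := by
  obtain ⟨e, he, hve⟩ := exists_pathEdge_of_mem hc.two_le_length hv
  obtain ⟨t, ht, het⟩ := (mem_edges.1 (hc.edge_mem e he).1).2
  exact BallSplit.mem_nodes.2 ⟨t, ht, het hve⟩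

lemma mem_edges_of_subset (h2 : e.card = 2) (ht : t ∈ K) (h : e ⊆ t) : e ∈ edges K :=
  mem_edges.2 ⟨h2, t, ht, h⟩

/-- `A` and `B` decompose the triangles of `K`, and their common edges are those of `c`. -/
structure IsCutAlong (K : Finset (Finset V)) (a b : V) (c : List V) (A B : Finset (Finset V)) :
    Prop where
  surface : IsSurface K
  path : IsSplittingPath K a b c
  union : A ∪ B = K
  disjoint : Disjoint A B
  edges_inter : ∀ e, e ∈ edges A ∧ e ∈ edges B ↔ e ∈ pathEdges c

namespace IsCutAlong

lemma symm (h : IsCutAlong K a b c A B) : IsCutAlong K a b c B A :=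
  ⟨h.surface, h.path, by rw [Finset.union_comm, h.union], h.disjoint.symm,
    fun e => by rw [and_comm, h.edges_inter]⟩

lemma left_subset (h : IsCutAlong K a b c A B) : A ⊆ K := by
  rw [← h.union]; exact Finset.subset_union_left

lemma mem_or_mem (h : IsCutAlong K a b c A B) (ht : t ∈ K) : t ∈ A ∨ t ∈ B := by
  rwa [← h.union, Finset.mem_union] at ht

lemma cnt_add_cnt (h : IsCutAlong K a b c A B) (e : Finset V) : cnt A e + cnt B e = cnt K e := by
  rw [← h.union, cnt_union h.disjoint]

lemma cnt_of_mem_path (h : IsCutAlong K a b c A B) (he : e ∈ pathEdges c) : cnt A e = 1 := by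
  have h1 := (h.edges_inter e).2 he
  have h2 := cnt_pos_of_mem_edges h1.1
  have h3 := cnt_pos_of_mem_edges h1.2
  have h4 := h.surface.cnt_eq_two (h.path.edge_mem e he).1 (h.path.edge_mem e he).2
  have h5 := h.cnt_add_cnt e
  omega

lemma cnt_of_notMem_path (h : IsCutAlong K a b c A B) (he : e ∈ edges A) (hc : e ∉ pathEdges c) :
    cnt A e = cnt K e := by
  have h5 := h.cnt_add_cnt e
  have h6 : ¬ 0 < cnt B e := fun hB =>
    hc ((h.edges_inter e).1 ⟨he, mem_edges.2 ⟨(mem_edges.1 he).1, cnt_pos.1 hB⟩⟩)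
  omega

lemma mem_bdEdges_left (h : IsCutAlong K a b c A B) :
    e ∈ bdEdges A ↔ e ∈ edges A ∧ (e ∈ bdEdges K ∨ e ∈ pathEdges c) := by
  rw [mem_bdEdges, mem_bdEdges]
  constructor
  · rintro ⟨h1, h2⟩
    have h3 : e ∈ edges A := mem_edges.2 ⟨h1, cnt_pos.1 (by omega)⟩
    refine ⟨h3, ?_⟩
    by_cases hc : e ∈ pathEdges c
    · exact .inr hc
    · exact .inl ⟨h1, by rw [← h.cnt_of_notMem_path h3 hc, h2]⟩
  · rintro ⟨h1, h2⟩
    refine ⟨(mem_edges.1 h1).1, ?_⟩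
    by_cases hc : e ∈ pathEdges c
    · exact h.cnt_of_mem_path hc
    · rw [h.cnt_of_notMem_path h1 hc]
      exact (h2.resolve_right hc).2

/-- Triangles of both sides at `v` can be joined through the link of `v`. Where the side changes
there is a common edge at `v`, and the common edges are those of `c`. -/
lemma nodes_inter (h : IsCutAlong K a b c A B) : v ∈ nodes A ∧ v ∈ nodes B ↔ v ∈ c := by
  constructor
  · rintro ⟨hA, hB⟩
    by_contra hv
    have hno : ∀ e, v ∈ e → e ∈ edges A → e ∈ edges B → False := fun e hve h1 h2 =>
      hv (subset_of_mem_pathEdges ((h.edges_inter e).1 ⟨h1, h2⟩) hve)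
    obtain ⟨t, ht, hvt⟩ := mem_nodes.1 hA
    obtain ⟨t', ht', hvt'⟩ := mem_nodes.1 hB
    obtain ⟨x, x', hx, -, -, rfl⟩ := exists_triple_of_mem (h.surface.card_eq t (h.left_subset ht)) hvt
    obtain ⟨z, z', hz, -, -, rfl⟩ :=
      exists_triple_of_mem (h.surface.card_eq t' (h.symm.left_subset ht')) hvt'
    refine hno {v, z} (by simp) ?_ (pair_mem_edges.2 ⟨hz.symm, _, ht', by simp, by simp⟩)
    refine link_connected_iff.1 (h.surface.link_connected v (nodes_mono h.left_subset hA))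
      (fun x => {v, x} ∈ edges A) ?_ _ (h.left_subset ht) (by simp) _ (h.symm.left_subset ht')
      (by simp) x (by simp) z (by simp) hx hz
      (pair_mem_edges.2 ⟨hx.symm, _, ht, by simp, by simp⟩)
    intro s hs hvs p hp q hq hpv hqv hP
    rcases h.mem_or_mem hs with hs | hs
    · exact pair_mem_edges.2 ⟨hqv.symm, _, hs, hvs, hq⟩
    · exact (hno _ (by simp) hP (pair_mem_edges.2 ⟨hpv.symm, _, hs, hvs, hp⟩)).elim
  · intro hv
    obtain ⟨e, he, hve⟩ := exists_pathEdge_of_mem h.path.two_le_length hv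
    have h1 := (h.edges_inter e).2 he
    obtain ⟨t, ht, het⟩ := (mem_edges.1 h1.1).2
    obtain ⟨t', ht', het'⟩ := (mem_edges.1 h1.2).2
    exact ⟨mem_nodes.2 ⟨t, ht, het hve⟩, mem_nodes.2 ⟨t', ht', het' hve⟩⟩

/-- A colouring of the link of `v` in `A` has the same value at the edges of `c`. -/
lemma color_path (h : IsCutAlong K a b c A B) (P : V → Prop)
    (hP : ∀ t ∈ A, v ∈ t → ∀ x ∈ t, ∀ y ∈ t, x ≠ v → y ≠ v → P x → P y)
    (hx : {v, x} ∈ pathEdges c) (hy : {v, y} ∈ pathEdges c) (hPx : P x) : P y := by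
  classical
  have hvc : v ∈ c := subset_of_mem_pathEdges hx (by simp)
  have hxv : x ≠ v := (ne_of_pair_mem_edges (h.path.edge_mem _ hx).1).symm
  have hyv : y ≠ v := (ne_of_pair_mem_edges (h.path.edge_mem _ hy).1).symm
  by_cases hxy : ({v, x} : Finset V) = {v, y}
  · have : y ∈ ({v, x} : Finset V) := hxy ▸ (by simp)
    simp only [Finset.mem_insert, Finset.mem_singleton, hyv, false_or] at this
    exact this ▸ hPx
  have h4 := countP_pathEdges h.path.nodup h.path.head_eq h.path.last_eq v
  rw [← card_filter_pathEdges h.path.nodup, if_pos hvc] at h4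
  have h5 : ({{v, x}, {v, y}} : Finset (Finset V)) ⊆
      (pathEdges c).toFinset.filter fun e => v ∈ e := by
    intro e he
    simp only [Finset.mem_insert, Finset.mem_singleton] at he
    rcases he with rfl | rfl <;> simp [hx, hy]
  have h6 := Finset.card_le_card h5
  rw [Finset.card_pair hxy] at h6
  -- Two different path edges at `v` exclude that `v` is an end of the path, so `v` is not on the
  -- boundary of `K`.
  have hva : v ≠ a := by rintro rfl; simp at h4; omega
  have hvb : v ≠ b := by rintro rfl; simp at h4; omega
  have h7 : ({{v, x}, {v, y}} : Finset (Finset V)) =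
      (pathEdges c).toFinset.filter fun e => v ∈ e := by
    refine Finset.eq_of_subset_of_card_le h5 ?_
    rw [Finset.card_pair hxy]
    omega
  have hvK : v ∉ bdNodes K := fun hb => by
    rcases h.path.interior v hvc hb with rfl | rfl
    · exact hva rfl
    · exact hvb rfl
  -- Parity argument: among the coloured triangles of `A` at `v` the number of boundary edges at `v`
  -- is even. One of them is `vx`, and any other one must be a path edge, hence `vy`.
  set A' := A.filter fun t => v ∈ t ∧ ∀ z ∈ t, z ≠ v → P z with hA'
  have hsub : A' ⊆ A := Finset.filter_subset _ _
  have hfull : ∀ z, z ≠ v → P z → cnt A' {v, z} = cnt A {v, z} := by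
    intro z hz hPz
    unfold cnt
    congr 1
    ext t
    simp only [hA', Finset.mem_filter, pair_subset_iff]
    constructor
    · tauto
    · rintro ⟨h1, h2, h3⟩
      exact ⟨⟨h1, h2, fun q hq hqv => hP t h1 h2 z h3 q hq hz hqv hPz⟩, h2, h3⟩
  have heven := even_card_bdEdges_at (K := A')
    (fun t ht => h.surface.card_eq t (h.left_subset (hsub ht)))
    (fun e he => (cnt_mono (hsub.trans h.left_subset)).trans
      (h.surface.cnt_le (edges_mono (hsub.trans h.left_subset) he))) v
  have hmem : {v, x} ∈ (bdEdges A').filter fun e => v ∈ e := by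
    simp only [Finset.mem_filter, Finset.mem_insert_self, and_true, mem_bdEdges]
    rw [hfull x hxv hPx, h.cnt_of_mem_path hx]
    exact ⟨Finset.card_pair hxv.symm, rfl⟩
  have hcard : 1 < ((bdEdges A').filter fun e => v ∈ e).card := by
    have := Finset.card_pos.2 ⟨_, hmem⟩
    rw [even_iff_two_dvd] at heven
    omega
  obtain ⟨e, he, hne⟩ := Finset.exists_mem_ne hcard {v, x}
  obtain ⟨he1, hve⟩ := Finset.mem_filter.1 he
  have he2 := mem_bdEdges.1 he1
  obtain ⟨z, hzv, rfl⟩ := exists_pair_of_mem he2.1 hve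
  obtain ⟨t, ht, het⟩ := (mem_edges.1 (bdEdges_subset_edges he1)).2
  have ht' := ht
  simp only [hA', Finset.mem_filter] at ht'
  have hPz : P z := ht'.2.2 z (het (by simp)) hzv
  have hzA : {v, z} ∈ edges A := edges_mono hsub (bdEdges_subset_edges he1)
  have hzc : {v, z} ∈ pathEdges c := by
    by_contra hzc
    have h8 := h.cnt_of_notMem_path hzA hzc
    rw [← hfull z hzv hPz, he2.2] at h8
    exact hvK (mem_bdNodes.2 ⟨{v, z}, mem_bdEdges.2 ⟨he2.1, h8.symm⟩, by simp⟩)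
  have h9 : {v, z} ∈ (pathEdges c).toFinset.filter fun e => v ∈ e := by simp [hzc]
  rw [← h7] at h9
  simp only [Finset.mem_insert, Finset.mem_singleton, hne, false_or] at h9
  have : y ∈ ({v, z} : Finset V) := h9 ▸ (by simp)
  simp only [Finset.mem_insert, Finset.mem_singleton, hyv, false_or] at this
  exact this ▸ hPz

lemma link_connected (h : IsCutAlong K a b c A B) (hv : v ∈ nodes A) : Connected (link A v) := by
  classical
  rw [link_connected_iff]
  intro P hP t ht hvt t' ht' hvt' x hx y hy hxv hyv hPx
  -- The colouring is extended to the link in `K`: what lies outside `A` receives the common colour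
  -- of the path edges at `v`, which is well defined by `color_path`.
  have hQ := link_connected_iff.1 (h.surface.link_connected v (nodes_mono h.left_subset hv))
    (fun z => if {v, z} ∈ edges A then P z else ∃ w, {v, w} ∈ pathEdges c ∧ P w) ?_ t
    (h.left_subset ht) hvt t' (h.left_subset ht') hvt' x hx y hy hxv hyv
  · rw [if_pos (pair_mem_edges.2 ⟨hxv.symm, t, ht, hvt, hx⟩),
      if_pos (pair_mem_edges.2 ⟨hyv.symm, t', ht', hvt', hy⟩)] at hQ
    exact hQ hPx
  · intro s hs hvs p hp q hq hpv hqv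
    rcases h.mem_or_mem hs with hs | hs
    · rw [if_pos (pair_mem_edges.2 ⟨hpv.symm, s, hs, hvs, hp⟩),
        if_pos (pair_mem_edges.2 ⟨hqv.symm, s, hs, hvs, hq⟩)]
      exact hP s hs hvs p hp q hq hpv hqv
    · have key : ∀ z ∈ s, z ≠ v → ((if {v, z} ∈ edges A then P z
          else ∃ w, {v, w} ∈ pathEdges c ∧ P w) ↔ ∃ w, {v, w} ∈ pathEdges c ∧ P w) := by
        intro z hz hzv
        split_ifs with hA
        · have hzc := (h.edges_inter {v, z}).1
            ⟨hA, pair_mem_edges.2 ⟨hzv.symm, s, hs, hvs, hz⟩⟩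
          constructor
          · exact fun hPz => ⟨z, hzc, hPz⟩
          · rintro ⟨w, hw, hPw⟩
            exact h.color_path P hP hw hzc hPw
        · rfl
      rw [key p hp hpv, key q hq hqv]
      exact id

lemma connected (h : IsCutAlong K a b c A B) : Connected A := by
  classical
  rw [connected_iff]
  intro P hP u hu w hw hPu
  have hcolor : ∀ x ∈ c, ∀ y ∈ c, P x → P y := by
    refine fun x hx y hy => pathEdges_color P (fun z z' hzz => ?_) hx hy
    obtain ⟨-, t, ht, hz, hz'⟩ := pair_mem_edges.1 ((h.edges_inter _).2 hzz).1
    exact ⟨hP t ht _ hz _ hz', hP t ht _ hz' _ hz⟩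
  -- The path is connected inside `A`, so its nodes have one colour, and this colour is given to all
  -- nodes outside `A`.
  have hQ := connected_iff.1 h.surface.connected (fun z => if z ∈ nodes A then P z else P a) ?_ u
    (nodes_mono h.left_subset hu) w (nodes_mono h.left_subset hw)
  · simp only [hu, hw, if_true] at hQ
    exact hQ hPu
  · intro t ht p hp q hq
    rcases h.mem_or_mem ht with ht | ht
    · rw [if_pos (mem_nodes.2 ⟨t, ht, hp⟩), if_pos (mem_nodes.2 ⟨t, ht, hq⟩)]
      exact hP t ht p hp q hq
    · have key : ∀ z ∈ t, ((if z ∈ nodes A then P z else P a) ↔ P a) := by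
        intro z hz
        split_ifs with hA
        · have hzc := h.nodes_inter.1 ⟨hA, mem_nodes.2 ⟨t, ht, hz⟩⟩
          have hac := List.mem_of_mem_head? h.path.head_eq
          exact ⟨hcolor z hzc a hac, hcolor a hac z hzc⟩
        · rfl
      rw [key p hp, key q hq]
      exact id

lemma pathEdges_ne_nil (h : IsCutAlong K a b c A B) : ∃ e, e ∈ pathEdges c := by
  refine List.exists_mem_of_length_pos ?_
  rw [length_pathEdges]
  have := h.path.two_le_length
  omega

lemma isSurface (h : IsCutAlong K a b c A B) : IsSurface A where
  nonempty := by
    obtain ⟨e, he⟩ := h.pathEdges_ne_nil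
    obtain ⟨t, ht, -⟩ := (mem_edges.1 ((h.edges_inter e).2 he).1).2
    exact ⟨t, ht⟩
  card_eq t ht := h.surface.card_eq t (h.left_subset ht)
  edge_le e he := (cnt_mono h.left_subset).trans (h.surface.cnt_le (edges_mono h.left_subset he))
  link_connected v hv := h.link_connected hv
  connected := h.connected

lemma bdEdges_nonempty (h : IsCutAlong K a b c A B) : (bdEdges A).Nonempty := by
  obtain ⟨e, he⟩ := h.pathEdges_ne_nil
  exact ⟨e, h.mem_bdEdges_left.2 ⟨((h.edges_inter e).2 he).1, .inr he⟩⟩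

/-- Inclusion and exclusion; the intersection is a simple path, with one node more than it has
edges. -/
lemma euler_add (h : IsCutAlong K a b c A B) : euler A + euler B = euler K + 1 := by
  have h1 : nodes A ∩ nodes B = c.toFinset := by
    ext; simp [h.nodes_inter]
  have h2 : edges A ∩ edges B = (pathEdges c).toFinset := by
    ext; simp [h.edges_inter]
  have h3 := Finset.card_union_add_card_inter (nodes A) (nodes B)
  have h4 := Finset.card_union_add_card_inter (edges A) (edges B)
  have h5 := Finset.card_union_of_disjoint h.disjoint
  rw [← nodes_union, h.union, h1, List.toFinset_card_of_nodup h.path.nodup] at h3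
  rw [← edges_union, h.union, h2, List.toFinset_card_of_nodup (nodup_pathEdges h.path.nodup),
    length_pathEdges] at h4
  rw [h.union] at h5
  have := h.path.two_le_length
  unfold euler
  omega

/-- The two Euler characteristics are at most 1 each and have sum 2. -/
lemma divides (h : IsCutAlong K a b c A B) (hK : euler K = 1) : Divides K c A B := by
  have h1 := h.isSurface.euler_le_one h.bdEdges_nonempty
  have h2 := h.symm.isSurface.euler_le_one h.symm.bdEdges_nonempty
  have h3 := h.euler_add
  refine ⟨⟨h.isSurface, h.bdEdges_nonempty, by omega⟩,
    ⟨h.symm.isSurface, h.symm.bdEdges_nonempty, by omega⟩, h.union, h.disjoint, ?_, ?_⟩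
  · ext; simp [h.nodes_inter]
  · ext; simp [h.edges_inter]

end IsCutAlong

lemma Divides.isCutAlong (hK : IsSurface K) (hc : IsSplittingPath K a b c)
    (h : Divides K c A B) : IsCutAlong K a b c A B :=
  ⟨hK, hc, h.union, h.disjoint, fun e => by
    rw [← List.mem_toFinset, ← h.edges_inter, Finset.mem_inter]⟩

/-- Every splitting path of a disk divides it. -/
lemma IsDisk.exists_divides (hK : IsDisk K) (hc : IsSplittingPath K a b c) :
    ∃ A B, Divides K c A B := by
  classical
  -- The path is a relative cycle: a node off the boundary is not an end, so it lies in no edge or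
  -- in two edges of the path. The values of `y` give the sides, which change exactly across the
  -- edges of the path.
  obtain ⟨y, hy⟩ := hK.exists_rel_boundary (fun e => if e ∈ pathEdges c then 1 else 0) (by
    intro v hv hvb
    rw [Finset.sum_boole]
    have h1 : (((edges K \ bdEdges K).filter fun e => v ∈ e).filter fun e => e ∈ pathEdges c) =
        (pathEdges c).toFinset.filter fun e => v ∈ e := by
      ext e
      simp only [Finset.mem_filter, Finset.mem_sdiff, List.mem_toFinset]
      constructor
      · tauto
      · rintro ⟨h1, h2⟩
        exact ⟨⟨hc.edge_mem e h1, h2⟩, h1⟩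
    have h2 := countP_pathEdges hc.nodup hc.head_eq hc.last_eq v
    rw [← card_filter_pathEdges hc.nodup, ← h1, if_neg, if_neg] at h2
    · simp only [add_zero] at h2
      rw [h2]
      split_ifs <;> rfl
    · rintro rfl; exact hvb hc.last_mem
    · rintro rfl; exact hvb hc.head_mem)
  have h01 : ∀ z : ZMod 2, z = 0 ∨ z = 1 := by decide
  have hdisj : Disjoint (K.filter fun t => y t = 0) (K.filter fun t => y t = 1) := by
    rw [Finset.disjoint_filter]
    intro t _ h1 h2
    rw [h1] at h2
    exact zero_ne_one h2
  have hpair : ∀ e t t', t ∈ K → t' ∈ K → e ⊆ t → e ⊆ t' → t ≠ t' → e.card = 2 →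
      (e ∈ pathEdges c ↔ y t ≠ y t') := by
    intro e t t' ht ht' het het' htt he2
    have he : e ∈ edges K := mem_edges_of_subset he2 ht het
    have heb : e ∉ bdEdges K := fun hb => htt (eq_of_bdEdge hb ht ht' het het')
    have h2 := hK.cnt_eq_two he heb
    have h3 : K.filter (fun t => e ⊆ t) = {t, t'} := by
      symm
      refine Finset.eq_of_subset_of_card_le ?_ ?_
      · intro s hs
        simp only [Finset.mem_insert, Finset.mem_singleton] at hs
        rcases hs with rfl | rfl <;> simp [*]
      · rw [Finset.card_pair htt]
        exact h2.le
    have h4 := hy e he heb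
    rw [h3, Finset.sum_pair htt] at h4
    split_ifs at h4 with h5
    · simp only [h5, true_iff]
      intro h6
      rw [h6, CharTwo.add_self_eq_zero] at h4
      exact zero_ne_one h4
    · simp only [h5, false_iff, not_not]
      exact zmod_two_add_eq_zero h4
  refine ⟨_, _, IsCutAlong.divides (a := a) (b := b) (c := c) (A := K.filter fun t => y t = 0)
    (B := K.filter fun t => y t = 1) ⟨hK.toIsSurface, hc, ?_, hdisj, ?_⟩ hK.euler_eq⟩
  · ext t
    simp only [Finset.mem_union, Finset.mem_filter]
    have := h01 (y t)
    tauto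
  · intro e
    constructor
    · rintro ⟨h1, h2⟩
      obtain ⟨he2, t, ht, het⟩ := mem_edges.1 h1
      obtain ⟨-, t', ht', het'⟩ := mem_edges.1 h2
      simp only [Finset.mem_filter] at ht ht'
      have hne : y t ≠ y t' := by rw [ht.2, ht'.2]; exact zero_ne_one
      exact (hpair e t t' ht.1 ht'.1 het het' (fun h => hne (h ▸ rfl)) he2).2 hne
    · intro he
      obtain ⟨h1, h2⟩ := hc.edge_mem e he
      have h3 := hK.cnt_eq_two h1 h2
      unfold cnt at h3
      obtain ⟨t, t', htt, h4⟩ := Finset.card_eq_two.1 h3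
      have ht : t ∈ K.filter fun t => e ⊆ t := by simp [h4]
      have ht' : t' ∈ K.filter fun t => e ⊆ t := by simp [h4]
      rw [Finset.mem_filter] at ht ht'
      have he2 := (mem_edges.1 h1).1
      have hne := (hpair e t t' ht.1 ht'.1 ht.2 ht'.2 htt he2).1 he
      rcases h01 (y t) with h5 | h5 <;> rcases h01 (y t') with h6 | h6
      · exact absurd (h5.trans h6.symm) hne
      · exact ⟨mem_edges_of_subset he2 (Finset.mem_filter.2 ⟨ht.1, h5⟩) ht.2,
          mem_edges_of_subset he2 (Finset.mem_filter.2 ⟨ht'.1, h6⟩) ht'.2⟩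
      · exact ⟨mem_edges_of_subset he2 (Finset.mem_filter.2 ⟨ht'.1, h6⟩) ht'.2,
          mem_edges_of_subset he2 (Finset.mem_filter.2 ⟨ht.1, h5⟩) ht.2⟩
      · exact absurd (h5.trans h6.symm) hne

end Cut

end BallSplit

namespace BallSplit

variable {V : Type*} [DecidableEq V]

/-! ### Gluing a cone to a disk -/

section Cone
variable {K A : Finset (Finset V)} {e t : Finset V} {u v w x y z a b : V} {c : List V}

/-- Coning with a new apex is injective on facets, and whether the apex belongs to `e` makes no
difference for containment in a facet of the cone. -/
lemma cnt_image_insert (hz : ∀ f ∈ K, z ∉ f) (e : Finset V) :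
    cnt (K.image (insert z)) e = cnt K (e.erase z) := by
  unfold cnt
  rw [Finset.filter_image, Finset.card_image_of_injOn]
  · congr 1
    ext f
    simp only [Finset.mem_filter, Finset.subset_insert_iff]
  · intro f hf g hg hfg
    simp only [Finset.coe_filter, Set.mem_ofPred_eq] at hf hg
    rw [← Finset.erase_insert (hz f hf.1), hfg, Finset.erase_insert (hz g hg.1)]

lemma card_image_insert (hz : ∀ f ∈ K, z ∉ f) : (K.image (insert z)).card = K.card := by
  refine Finset.card_image_of_injOn ?_
  intro f hf g hg hfg
  rw [← Finset.erase_insert (hz f hf), hfg, Finset.erase_insert (hz g hg)]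

lemma cnt_singleton (v : V) : cnt K {v} = (K.filter fun t => v ∈ t).card := by
  simp [cnt]

lemma cnt_eq_zero_of_notMem (hv : v ∈ e) (h : v ∉ nodes K) : cnt K e = 0 := by
  by_contra h0
  obtain ⟨t, ht, het⟩ := cnt_pos.1 (Nat.pos_of_ne_zero h0)
  exact h (mem_nodes.2 ⟨t, ht, het hv⟩)

lemma cnt_pathEdges_singleton (hc : c.Nodup) (v : V) :
    cnt (pathEdges c).toFinset {v} = (pathEdges c).countP (fun e => v ∈ e) := by
  rw [cnt_singleton, card_filter_pathEdges hc]

lemma cnt_pathEdges_singleton_le (hc : c.Nodup) (v : V) : cnt (pathEdges c).toFinset {v} ≤ 2 := by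
  rw [cnt_pathEdges_singleton hc]
  cases hh : c with
  | nil => simp
  | cons x l =>
    subst hh
    obtain ⟨b, hb⟩ : ∃ b, (x :: l).getLast? = some b := ⟨_, List.getLast?_eq_getLast_of_ne_nil (by simp)⟩
    have := countP_pathEdges hc rfl hb v
    split_ifs at this <;> omega

lemma cnt_pathEdges_head (hc : c.Nodup) (ha : c.head? = some a) (hb : c.getLast? = some b)
    (hab : a ≠ b) : cnt (pathEdges c).toFinset {a} = 1 := by
  rw [cnt_pathEdges_singleton hc]
  have := countP_pathEdges hc ha hb a
  rw [if_pos rfl, if_neg hab, if_pos (List.mem_of_mem_head? ha)] at this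
  omega

lemma cnt_of_card_eq (hK : ∀ f ∈ K, f.card = 2) (he : e.card = 2) :
    cnt K e = if e ∈ K then 1 else 0 := by
  have : (K.filter fun t => e ⊆ t) = if e ∈ K then {e} else ∅ := by
    ext f
    simp only [Finset.mem_filter]
    constructor
    · rintro ⟨h1, h2⟩
      have := Finset.eq_of_subset_of_card_le h2 (by rw [hK f h1, he])
      subst this
      simp [h1]
    · split_ifs with h
      · intro h1
        rw [Finset.mem_singleton] at h1
        subst h1
        exact ⟨h, le_refl _⟩
      · simp
  unfold cnt
  rw [this]
  split_ifs <;> simp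

/-- Gluing to a disk the cone over a path in its boundary gives a disk. -/
lemma IsDisk.cone (hA : IsDisk A) (hc : c.Nodup) (ha : c.head? = some a)
    (hb : c.getLast? = some b) (hab : a ≠ b) (hcnt : ∀ e ∈ pathEdges c, cnt A e = 1)
    (hz : z ∉ nodes A) : IsDisk (A ∪ (pathEdges c).toFinset.image (insert z)) := by
  have h2 := two_le_length ha hb hab
  have hcA : ∀ v ∈ c, v ∈ nodes A := fun v hv => by
    obtain ⟨e, he, hve⟩ := exists_pathEdge_of_mem h2 hv
    obtain ⟨t, ht, het⟩ := cnt_pos.1 (by rw [hcnt e he]; omega : 0 < cnt A e)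
    exact mem_nodes.2 ⟨t, ht, het hve⟩
  have hze : ∀ e ∈ (pathEdges c).toFinset, z ∉ e := fun e he hze =>
    hz (hcA z (subset_of_mem_pathEdges (List.mem_toFinset.1 he) hze))
  have hce : ∀ e ∈ (pathEdges c).toFinset, e.card = 2 := fun e he =>
    card_of_mem_pathEdges hc (List.mem_toFinset.1 he)
  have hmem : ∀ t, t ∈ A ∪ (pathEdges c).toFinset.image (insert z) ↔
      t ∈ A ∨ ∃ e ∈ pathEdges c, insert z e = t := fun t => by simp
  have hdisj : Disjoint A ((pathEdges c).toFinset.image (insert z)) := by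
    rw [Finset.disjoint_left]
    intro t ht ht'
    obtain ⟨e, -, rfl⟩ := Finset.mem_image.1 ht'
    exact hz (mem_nodes.2 ⟨_, ht, by simp⟩)
  have hcntD : ∀ e, cnt (A ∪ (pathEdges c).toFinset.image (insert z)) e =
      cnt A e + cnt (pathEdges c).toFinset (e.erase z) := fun e => by
    rw [cnt_union hdisj, cnt_image_insert hze]
  have hzpair : ∀ v, v ≠ z → ({z, v} : Finset V).erase z = {v} := fun v hv => by
    rw [Finset.erase_insert]
    simpa using hv.symm
  have hneigh : ∀ u w, {u, w} ∈ pathEdges c → u ≠ w ∧ ∃ t ∈ A, u ∈ t ∧ w ∈ t := by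
    intro u w he
    obtain ⟨t, ht, het⟩ := cnt_pos.1 (by rw [hcnt _ he]; omega : 0 < cnt A {u, w})
    refine ⟨?_, t, ht, pair_subset_iff.1 het⟩
    rintro rfl
    have := card_of_mem_pathEdges hc he
    simp at this
  have hac : a ∈ c := List.mem_of_mem_head? ha
  refine ⟨⟨?_, ?_, ?_, ?_, ?_⟩, ?_, ?_⟩
  · exact hA.nonempty.mono Finset.subset_union_left
  · intro t ht
    rcases (hmem t).1 ht with ht | ⟨e, he, rfl⟩
    · exact hA.card_eq t ht
    · rw [Finset.card_insert_of_notMem (hze e (by simpa using he)), hce e (by simpa using he)]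
  · intro e he
    change cnt _ e ≤ 2
    rw [hcntD]
    have he2 := (mem_edges.1 he).1
    by_cases hzm : z ∈ e
    · obtain ⟨v, hv, rfl⟩ := exists_pair_of_mem he2 hzm
      rw [cnt_eq_zero_of_notMem hzm hz, hzpair v hv]
      simpa using cnt_pathEdges_singleton_le hc v
    · rw [Finset.erase_eq_of_notMem hzm, cnt_of_card_eq hce he2]
      split_ifs with hec
      · rw [hcnt e (by simpa using hec)]
      · rcases Nat.eq_zero_or_pos (cnt A e) with h0 | h0
        · omega
        · exact hA.cnt_le (mem_edges.2 ⟨he2, cnt_pos.1 h0⟩)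
  · intro v hv
    rw [link_connected_iff]
    intro P hP
    by_cases hvz : v = z
    · subst hvz
      have hin : ∀ t ∈ A ∪ (pathEdges c).toFinset.image (insert v), v ∈ t → ∀ x ∈ t, x ≠ v →
          x ∈ c := by
        intro t ht hvt x hx hxv
        rcases (hmem t).1 ht with ht | ⟨e, he, rfl⟩
        · exact (hz (mem_nodes.2 ⟨t, ht, hvt⟩)).elim
        · exact subset_of_mem_pathEdges he (Finset.mem_of_mem_insert_of_ne hx hxv)
      intro t ht hvt t' ht' hvt' x hx y hy hxv hyv
      refine pathEdges_color P ?_ (hin t ht hvt x hx hxv) (hin t' ht' hvt' y hy hyv)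
      intro u w huw
      have h1 : insert v {u, w} ∈ A ∪ (pathEdges c).toFinset.image (insert v) :=
        (hmem _).2 (.inr ⟨_, huw, rfl⟩)
      have hu : u ≠ v := fun h => hz (h ▸ hcA u (subset_of_mem_pathEdges huw (by simp)))
      have hw : w ≠ v := fun h => hz (h ▸ hcA w (subset_of_mem_pathEdges huw (by simp)))
      exact ⟨hP _ h1 (by simp) u (by simp) w (by simp) hu hw,
        hP _ h1 (by simp) w (by simp) u (by simp) hw hu⟩
    · have hvA : v ∈ nodes A := by
        obtain ⟨t, ht, hvt⟩ := mem_nodes.1 hv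
        rcases (hmem t).1 ht with ht | ⟨e, he, rfl⟩
        · exact mem_nodes.2 ⟨t, ht, hvt⟩
        · exact hcA v (subset_of_mem_pathEdges he (Finset.mem_of_mem_insert_of_ne hvt hvz))
      -- A new triangle at an old node `v` contains a path edge `vw`, which also lies in a triangle
      -- of `A`. Every colour in the new link therefore occurs in the link in `A`.
      have key : ∀ t ∈ A ∪ (pathEdges c).toFinset.image (insert z), v ∈ t → ∀ x ∈ t, x ≠ v →
          ∃ s ∈ A, v ∈ s ∧ ∃ x' ∈ s, x' ≠ v ∧ (P x ↔ P x') := by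
        intro t ht hvt x hx hxv
        have ht₀ := ht
        rcases (hmem t).1 ht with ht | ⟨e, he, rfl⟩
        · exact ⟨t, ht, hvt, x, hx, hxv, Iff.rfl⟩
        · have hve := Finset.mem_of_mem_insert_of_ne hvt hvz
          obtain ⟨w, hw, rfl⟩ := exists_pair_of_mem (hce e (by simpa using he)) hve
          obtain ⟨-, s, hs, hvs, hws⟩ := hneigh v w he
          refine ⟨s, hs, hvs, w, hws, hw, ?_⟩
          exact ⟨hP _ ht₀ hvt x hx w (by simp) hxv hw, hP _ ht₀ hvt w (by simp) x hx hw hxv⟩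
      intro t ht hvt t' ht' hvt' x hx y hy hxv hyv
      obtain ⟨s, hs, hvs, x', hx', hxv', hxx⟩ := key t ht hvt x hx hxv
      obtain ⟨s', hs', hvs', y', hy', hyv', hyy⟩ := key t' ht' hvt' y hy hyv
      rw [hxx, hyy]
      exact link_connected_iff.1 (hA.link_connected v hvA) P
        (fun s hs => hP s ((hmem s).2 (.inl hs))) s hs hvs s' hs' hvs' x' hx' y' hy' hxv' hyv'
  · rw [connected_iff]
    intro P hP
    have key : ∀ t ∈ A ∪ (pathEdges c).toFinset.image (insert z), ∀ x ∈ t,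
        ∃ x' ∈ nodes A, (P x ↔ P x') := by
      intro t ht x hx
      have ht₀ := ht
      rcases (hmem t).1 ht with ht | ⟨e, he, rfl⟩
      · exact ⟨x, mem_nodes.2 ⟨t, ht, hx⟩, Iff.rfl⟩
      · obtain ⟨v, w, -, rfl⟩ := Finset.card_eq_two.1 (hce e (by simpa using he))
        exact ⟨v, hcA v (subset_of_mem_pathEdges he (by simp)), hP _ ht₀ x hx v (by simp),
          hP _ ht₀ v (by simp) x hx⟩
    intro u hu w hw
    obtain ⟨t, ht, hut⟩ := mem_nodes.1 hu
    obtain ⟨t', ht', hwt⟩ := mem_nodes.1 hw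
    obtain ⟨u', hu', huu⟩ := key t ht u hut
    obtain ⟨w', hw', hww⟩ := key t' ht' w hwt
    rw [huu, hww]
    exact connected_iff.1 hA.connected P (fun s hs => hP s ((hmem s).2 (.inl hs))) u' hu' w' hw'
  · have hza : z ≠ a := fun h => hz (h ▸ hcA a hac)
    refine ⟨{z, a}, mem_bdEdges.2 ⟨Finset.card_pair hza, ?_⟩⟩
    rw [hcntD, cnt_eq_zero_of_notMem (v := z) (by simp) hz, hzpair a hza.symm,
      cnt_pathEdges_head hc ha hb hab]
  · have h1 : nodes (A ∪ (pathEdges c).toFinset.image (insert z)) = insert z (nodes A) := by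
      ext x
      rw [mem_nodes, Finset.mem_insert]
      constructor
      · rintro ⟨t, ht, hx⟩
        rcases (hmem t).1 ht with ht | ⟨e, he, rfl⟩
        · exact .inr (mem_nodes.2 ⟨t, ht, hx⟩)
        · rcases Finset.mem_insert.1 hx with hx | hx
          · exact .inl hx
          · exact .inr (hcA x (subset_of_mem_pathEdges he hx))
      · rintro (rfl | hx)
        · obtain ⟨e, he, -⟩ := exists_pathEdge_of_mem h2 hac
          exact ⟨insert x e, (hmem _).2 (.inr ⟨e, he, rfl⟩), by simp⟩
        · obtain ⟨t, ht, hx⟩ := mem_nodes.1 hx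
          exact ⟨t, (hmem _).2 (.inl ht), hx⟩
    have h3 : edges (A ∪ (pathEdges c).toFinset.image (insert z)) =
        edges A ∪ (c.toFinset.image fun v => {v}).image (insert z) := by
      ext e
      simp only [mem_edges, Finset.mem_union, Finset.mem_image, List.mem_toFinset,
        exists_exists_and_eq_and]
      constructor
      · rintro ⟨he2, t, ht | ⟨f, hf, rfl⟩, het⟩
        · exact .inl ⟨he2, t, ht, het⟩
        · by_cases hzm : z ∈ e
          · obtain ⟨v, hv, rfl⟩ := exists_pair_of_mem he2 hzm
            refine .inr ⟨v, subset_of_mem_pathEdges hf ?_, rfl⟩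
            exact Finset.mem_of_mem_insert_of_ne (het (by simp)) hv
          · rw [Finset.subset_insert_iff_of_notMem hzm] at het
            obtain ⟨t, ht, hft⟩ := cnt_pos.1 (by rw [hcnt _ hf]; omega : 0 < cnt A f)
            exact .inl ⟨he2, t, ht, het.trans hft⟩
      · rintro (⟨he2, t, ht, het⟩ | ⟨v, hv, rfl⟩)
        · exact ⟨he2, t, .inl ht, het⟩
        · obtain ⟨f, hf, hvf⟩ := exists_pathEdge_of_mem h2 hv
          refine ⟨Finset.card_pair fun h => hz (h ▸ hcA v hv), _, .inr ⟨f, hf, rfl⟩, ?_⟩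
          exact Finset.insert_subset_insert _ (by simpa using hvf)
    have h4 : Disjoint (edges A) ((c.toFinset.image fun v => {v}).image (insert z)) := by
      rw [Finset.disjoint_left]
      intro e he he'
      obtain ⟨f, -, rfl⟩ := Finset.mem_image.1 he'
      obtain ⟨-, t, ht, het⟩ := mem_edges.1 he
      exact hz (mem_nodes.2 ⟨t, ht, het (by simp)⟩)
    have h5 := hA.euler_eq
    -- There is one new node, an edge from the apex to each node of the path, and a triangle for
    -- each edge of the path, that is one fewer: the alternating sum is unchanged.
    unfold euler at h5 ⊢
    rw [h1, h3, Finset.card_insert_of_notMem hz, Finset.card_union_of_disjoint h4,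
      Finset.card_union_of_disjoint hdisj, card_image_insert, card_image_insert hze,
      Finset.card_image_of_injective _ Finset.singleton_injective,
      List.toFinset_card_of_nodup hc, List.toFinset_card_of_nodup (nodup_pathEdges hc),
      length_pathEdges]
    · omega
    · intro f hf hzf
      obtain ⟨v, hv, rfl⟩ := Finset.mem_image.1 hf
      rw [Finset.mem_singleton] at hzf
      subst hzf
      exact hz (hcA _ (by simpa using hv))

end Cone

/-! ### Renaming the nodes by a permutation -/

section Rename
variable {K : Finset (Finset V)} {e t : Finset V} {v : V}

/-- The complex in which the nodes are renamed by a permutation. -/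
def rename (σ : Equiv.Perm V) (K : Finset (Finset V)) : Finset (Finset V) :=
  K.image (Finset.image σ)

lemma image_symm_image (σ : Equiv.Perm V) (t : Finset V) : (t.image σ).image σ.symm = t := by
  simp [Finset.image_image]

lemma mem_image_perm (σ : Equiv.Perm V) : v ∈ t.image σ ↔ σ.symm v ∈ t := by
  simp only [Finset.mem_image]
  constructor
  · rintro ⟨w, hw, rfl⟩; simpa
  · exact fun h => ⟨_, h, by simp⟩

lemma subset_image_perm (σ : Equiv.Perm V) : e ⊆ t.image σ ↔ e.image σ.symm ⊆ t := by
  rw [Finset.image_subset_iff]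
  exact forall₂_congr fun x _ => mem_image_perm σ

lemma image_perm_injective (σ : Equiv.Perm V) : Function.Injective (Finset.image σ) :=
  Finset.image_injective σ.injective

lemma nodes_rename (σ : Equiv.Perm V) : nodes (rename σ K) = (nodes K).image σ := by
  ext v
  rw [mem_image_perm, mem_nodes, mem_nodes]
  simp only [rename, Finset.exists_mem_image, mem_image_perm]

lemma edges_rename (σ : Equiv.Perm V) : edges (rename σ K) = (edges K).image (Finset.image σ) := by
  ext e
  simp only [mem_edges, rename, Finset.mem_image, exists_exists_and_eq_and]
  constructor
  · rintro ⟨h1, t, ht, h2⟩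
    refine ⟨e.image σ.symm, ⟨?_, t, ht, (subset_image_perm σ).1 h2⟩, ?_⟩
    · rw [Finset.card_image_of_injective _ σ.symm.injective, h1]
    · simpa using image_symm_image σ.symm e
  · rintro ⟨f, ⟨h1, t, ht, h2⟩, rfl⟩
    exact ⟨by rw [Finset.card_image_of_injective _ σ.injective, h1], t, ht,
      Finset.image_subset_image h2⟩

lemma cnt_rename (σ : Equiv.Perm V) (e : Finset V) : cnt (rename σ K) (e.image σ) = cnt K e := by
  unfold cnt rename
  rw [Finset.filter_image, Finset.card_image_of_injective _ (image_perm_injective σ)]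
  congr 1
  ext t
  simp only [Finset.mem_filter, subset_image_perm, image_symm_image]

lemma IsDisk.rename (h : IsDisk K) (σ : Equiv.Perm V) : IsDisk (rename σ K) := by
  have hmem : ∀ t, t ∈ BallSplit.rename σ K ↔ ∃ s ∈ K, s.image σ = t := fun t => by
    simp [BallSplit.rename]
  have hmem' : ∀ t ∈ K, t.image σ ∈ BallSplit.rename σ K := fun t ht => (hmem _).2 ⟨t, ht, rfl⟩
  refine ⟨⟨?_, ?_, ?_, ?_, ?_⟩, ?_, ?_⟩
  · exact h.nonempty.image _
  · intro t ht
    obtain ⟨s, hs, rfl⟩ := (hmem t).1 ht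
    rw [Finset.card_image_of_injective _ σ.injective, h.card_eq s hs]
  · intro e he
    rw [edges_rename] at he
    obtain ⟨f, hf, rfl⟩ := Finset.mem_image.1 he
    change cnt _ _ ≤ 2
    rw [cnt_rename]
    exact h.cnt_le hf
  · intro v hv
    rw [nodes_rename] at hv
    obtain ⟨v, hv', rfl⟩ := Finset.mem_image.1 hv
    have hl := link_connected_iff.1 (h.link_connected v hv')
    rw [link_connected_iff]
    intro P hP t ht hvt t' ht' hvt' x hx y hy hxv hyv
    obtain ⟨s, hs, rfl⟩ := (hmem t).1 ht
    obtain ⟨s', hs', rfl⟩ := (hmem t').1 ht'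
    obtain ⟨x, hx', rfl⟩ := Finset.mem_image.1 hx
    obtain ⟨y, hy', rfl⟩ := Finset.mem_image.1 hy
    simp only [mem_image_perm, Equiv.symm_apply_apply] at hvt hvt'
    refine hl (fun z => P (σ z)) ?_ s hs hvt s' hs' hvt' x hx' y hy' (fun h => hxv (h ▸ rfl))
      (fun h => hyv (h ▸ rfl))
    intro r hr hvr p hp q hq hpv hqv
    exact hP _ (hmem' r hr) (by simpa [mem_image_perm]) _ (by simpa [mem_image_perm]) _
      (by simpa [mem_image_perm]) (fun h => hpv (σ.injective h)) (fun h => hqv (σ.injective h))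
  · have hl := connected_iff.1 h.connected
    rw [connected_iff]
    intro P hP u hu w hw
    rw [nodes_rename] at hu hw
    obtain ⟨u, hu', rfl⟩ := Finset.mem_image.1 hu
    obtain ⟨w, hw', rfl⟩ := Finset.mem_image.1 hw
    refine hl (fun z => P (σ z)) ?_ u hu' w hw'
    intro r hr p hp q hq
    exact hP _ (hmem' r hr) _ (by simpa [mem_image_perm]) _ (by simpa [mem_image_perm])
  · obtain ⟨e, he⟩ := h.bdry_nonempty
    rw [mem_bdEdges] at he
    exact ⟨e.image σ, mem_bdEdges.2 ⟨by rw [Finset.card_image_of_injective _ σ.injective, he.1],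
      by rw [cnt_rename, he.2]⟩⟩
  · have := h.euler_eq
    unfold euler at this ⊢
    rwa [nodes_rename, edges_rename, Finset.card_image_of_injective _ σ.injective,
      Finset.card_image_of_injective _ (image_perm_injective σ), BallSplit.rename,
      Finset.card_image_of_injective _ (image_perm_injective σ)]

end Rename

end BallSplit

/-! ### Splitting a node of a disk in two -/

namespace BallSplit

variable {V : Type*} [DecidableEq V]

/-- The 2-dimensional complex obtained from `L` by splitting the node `v`, whose link is made of
`P` and `Q`, into `p` and `q`, where `P` and `Q` have the node `a` in common. -/
def splitBd (L : Finset (Finset V)) (v : V) (P Q : Finset (Finset V)) (a p q : V) :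
    Finset (Finset V) :=
  L.filter (fun t => v ∉ t) ∪ P.image (insert p) ∪ Q.image (insert q) ∪ {{p, q, a}}

/-- The data for splitting the node `v` of a disk. -/
structure IsBdSplit (L : Finset (Finset V)) (v : V) (P Q : Finset (Finset V)) (a p q : V) :
    Prop where
  disk : IsDisk L
  link_eq : link L v = P ∪ Q
  disjoint : Disjoint P Q
  inter : ∀ x, x ∈ nodes P ∧ x ∈ nodes Q ↔ x = a
  connected_left : Connected P
  connected_right : Connected Q
  left_notMem : p ∉ nodes L
  right_notMem : q ∉ nodes L
  ne : p ≠ q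
  mem : v ∈ nodes L

lemma splitBd_symm {L P Q : Finset (Finset V)} {v a p q : V} :
    splitBd L v P Q a p q = splitBd L v Q P a q p := by
  unfold splitBd
  rw [Finset.insert_comm p q, Finset.union_right_comm (L.filter _)]

lemma mem_splitBd {L P Q : Finset (Finset V)} {v a p q : V} {t : Finset V} :
    t ∈ splitBd L v P Q a p q ↔ (t ∈ L ∧ v ∉ t) ∨ (∃ f ∈ P, insert p f = t) ∨
      (∃ f ∈ Q, insert q f = t) ∨ t = {p, q, a} := by
  simp only [splitBd, Finset.mem_union, Finset.mem_filter, Finset.mem_image, Finset.mem_singleton,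
    or_assoc]

namespace IsBdSplit

variable {L P Q : Finset (Finset V)} {v a p q x y z : V} {e t f : Finset V}

lemma symm (h : IsBdSplit L v P Q a p q) : IsBdSplit L v Q P a q p :=
  ⟨h.disk, by rw [h.link_eq, Finset.union_comm], h.disjoint.symm,
    fun x => by rw [and_comm, h.inter], h.connected_right, h.connected_left, h.right_notMem,
    h.left_notMem, h.ne.symm, h.mem⟩

lemma of_mem_left (h : IsBdSplit L v P Q a p q) (hf : f ∈ P) : v ∉ f ∧ insert v f ∈ L :=
  mem_link.1 (by rw [h.link_eq]; exact Finset.mem_union_left _ hf)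

lemma card_left (h : IsBdSplit L v P Q a p q) (hf : f ∈ P) : f.card = 2 := by
  have h1 := h.of_mem_left hf
  have := h.disk.card_eq _ h1.2
  rw [Finset.card_insert_of_notMem h1.1] at this
  omega

lemma nodes_left_subset (h : IsBdSplit L v P Q a p q) : nodes P ⊆ nodes L := by
  intro x hx
  obtain ⟨f, hf, hxf⟩ := mem_nodes.1 hx
  exact mem_nodes.2 ⟨_, (h.of_mem_left hf).2, by simp [hxf]⟩

lemma notMem_left (h : IsBdSplit L v P Q a p q) (hf : f ∈ P) : p ∉ f ∧ q ∉ f :=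
  ⟨fun hp => h.left_notMem (h.nodes_left_subset (mem_nodes.2 ⟨f, hf, hp⟩)),
    fun hp => h.right_notMem (h.nodes_left_subset (mem_nodes.2 ⟨f, hf, hp⟩))⟩

lemma mem_nodes_left (h : IsBdSplit L v P Q a p q) : a ∈ nodes P := ((h.inter a).2 rfl).1

lemma apex_mem (h : IsBdSplit L v P Q a p q) : a ∈ nodes L := h.nodes_left_subset h.mem_nodes_left

lemma apex_ne (h : IsBdSplit L v P Q a p q) : a ≠ v ∧ a ≠ p ∧ a ≠ q := by
  refine ⟨?_, ?_, ?_⟩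
  · rintro rfl
    obtain ⟨f, hf, ha⟩ := mem_nodes.1 h.mem_nodes_left
    exact (h.of_mem_left hf).1 ha
  · rintro rfl; exact h.left_notMem h.apex_mem
  · rintro rfl; exact h.right_notMem h.apex_mem

lemma erase_mem (h : IsBdSplit L v P Q a p q) (ht : t ∈ L) (hv : v ∈ t) :
    t.erase v ∈ P ∨ t.erase v ∈ Q := by
  rw [← Finset.mem_union, ← h.link_eq]
  exact erase_mem_link ht hv

lemma cnt_link_add (h : IsBdSplit L v P Q a p q) (e : Finset V) :
    cnt L e = cnt (L.filter fun t => v ∉ t) e + (cnt P (e.erase v) + cnt Q (e.erase v)) := by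
  have h1 : L = L.filter (fun t => v ∉ t) ∪ (link L v).image (insert v) := by
    ext t
    simp only [Finset.mem_union, Finset.mem_filter, Finset.mem_image, mem_link]
    constructor
    · intro ht
      by_cases hv : v ∈ t
      · exact .inr ⟨t.erase v, ⟨by simp, by rwa [Finset.insert_erase hv]⟩, Finset.insert_erase hv⟩
      · exact .inl ⟨ht, hv⟩
    · rintro (h | ⟨f, h, rfl⟩)
      · exact h.1
      · exact h.2
  have h2 : Disjoint (L.filter fun t => v ∉ t) ((link L v).image (insert v)) := by
    rw [Finset.disjoint_left]
    intro t ht ht'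
    obtain ⟨f, -, rfl⟩ := Finset.mem_image.1 ht'
    simp at ht
  conv_lhs => rw [h1]
  rw [cnt_union h2, cnt_image_insert (fun f hf => (mem_link.1 hf).1), h.link_eq,
    cnt_union h.disjoint]

lemma disjoint₁ (h : IsBdSplit L v P Q a p q) :
    Disjoint (L.filter fun t => v ∉ t) (P.image (insert p)) := by
  rw [Finset.disjoint_left]
  intro t ht ht'
  obtain ⟨f, -, rfl⟩ := Finset.mem_image.1 ht'
  exact h.left_notMem (mem_nodes.2 ⟨_, (Finset.mem_filter.1 ht).1, by simp⟩)

lemma disjoint₂ (h : IsBdSplit L v P Q a p q) :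
    Disjoint (L.filter (fun t => v ∉ t) ∪ P.image (insert p)) (Q.image (insert q)) := by
  rw [Finset.disjoint_union_left]
  refine ⟨h.symm.disjoint₁, ?_⟩
  rw [Finset.disjoint_left]
  intro t ht ht'
  obtain ⟨f, hf, rfl⟩ := Finset.mem_image.1 ht
  obtain ⟨g, hg, hgf⟩ := Finset.mem_image.1 ht'
  have : q ∈ insert p f := hgf ▸ (by simp)
  rcases Finset.mem_insert.1 this with h1 | h1
  · exact h.ne h1.symm
  · exact (h.notMem_left hf).2 h1

lemma disjoint₃ (h : IsBdSplit L v P Q a p q) :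
    Disjoint (L.filter (fun t => v ∉ t) ∪ P.image (insert p) ∪ Q.image (insert q))
      {{p, q, a}} := by
  rw [Finset.disjoint_singleton_right]
  simp only [Finset.mem_union, Finset.mem_filter, Finset.mem_image]
  rintro ((⟨h1, -⟩ | ⟨f, hf, h1⟩) | ⟨f, hf, h1⟩)
  · exact h.left_notMem (mem_nodes.2 ⟨_, h1, by simp⟩)
  · have : q ∈ insert p f := h1 ▸ (by simp)
    rcases Finset.mem_insert.1 this with h1 | h1
    · exact h.ne h1.symm
    · exact (h.notMem_left hf).2 h1
  · have : p ∈ insert q f := h1 ▸ (by simp)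
    rcases Finset.mem_insert.1 this with h1 | h1
    · exact h.ne h1
    · exact (h.symm.notMem_left hf).2 h1

lemma cnt_splitBd (h : IsBdSplit L v P Q a p q) (e : Finset V) :
    cnt (splitBd L v P Q a p q) e = cnt (L.filter fun t => v ∉ t) e + cnt P (e.erase p) +
      cnt Q (e.erase q) + cnt {{p, q, a}} e := by
  unfold splitBd
  rw [cnt_union h.disjoint₃, cnt_union h.disjoint₂, cnt_union h.disjoint₁,
    cnt_image_insert (fun f hf => (h.notMem_left hf).1),
    cnt_image_insert (fun f hf => (h.symm.notMem_left hf).1)]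

lemma cnt_pair_new (h : IsBdSplit L v P Q a p q) : cnt (splitBd L v P Q a p q) {p, q} = 1 := by
  have hp : p ∉ nodes (L.filter fun t => v ∉ t) := fun hp =>
    h.left_notMem (nodes_mono (Finset.filter_subset _ _) hp)
  rw [h.cnt_splitBd, cnt_eq_zero_of_notMem (v := p) (by simp) hp,
    cnt_eq_zero_of_notMem (v := q) (K := P) (by simp [h.ne.symm])
      (fun hq => h.right_notMem (h.nodes_left_subset hq)),
    cnt_eq_zero_of_notMem (v := p) (K := Q) (by simp [h.ne])
      (fun hq => h.left_notMem (h.symm.nodes_left_subset hq))]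
  simp [cnt, Finset.filter_singleton, pair_subset_iff]

/-- The old edge `vx` was in at most two triangles, those from `P` and those from `Q` together. At
`x = a` the new triangle adds one, but there `Q` accounts for at least one of the two. -/
lemma cnt_pair_le (h : IsBdSplit L v P Q a p q) (hx : x ≠ p)
    (he : 0 < cnt (splitBd L v P Q a p q) {p, x}) :
    cnt (splitBd L v P Q a p q) {p, x} ≤ 2 := by
  have hp : p ∉ nodes (L.filter fun t => v ∉ t) := fun hp =>
    h.left_notMem (nodes_mono (Finset.filter_subset _ _) hp)
  by_cases hxq : x = q
  · rw [hxq, h.cnt_pair_new]; omega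
  have h1 : ({p, x} : Finset V).erase p = {x} := by
    rw [Finset.erase_insert]; simpa using hx.symm
  have h2 := h.cnt_splitBd {p, x}
  rw [cnt_eq_zero_of_notMem (v := p) (by simp) hp, h1,
    cnt_eq_zero_of_notMem (v := p) (K := Q) (by simp [h.ne])
      (fun hq => h.left_notMem (h.symm.nodes_left_subset hq))] at h2
  have hbound : ∀ x, x ∈ nodes P → cnt P {x} + cnt Q {x} ≤ 2 := by
    intro x hx
    obtain ⟨f, hf, hxf⟩ := mem_nodes.1 hx
    have h3 := h.of_mem_left hf
    have hvx : v ≠ x := fun hh => h3.1 (hh ▸ hxf)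
    have h4 := h.cnt_link_add {v, x}
    rw [Finset.erase_insert (by simpa using hvx)] at h4
    have h5 := h.disk.cnt_le (e := {v, x}) (pair_mem_edges.2 ⟨hvx, _, h3.2, by simp, by simp [hxf]⟩)
    omega
  by_cases hxa : x = a
  · subst hxa
    have h6 := hbound x h.mem_nodes_left
    have h7 : 0 < cnt Q {x} := by
      obtain ⟨f, hf, hxf⟩ := mem_nodes.1 h.symm.mem_nodes_left
      exact cnt_pos.2 ⟨f, hf, by simpa using hxf⟩
    have h8 : cnt {({p, q, x} : Finset V)} {p, x} ≤ 1 := by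
      unfold cnt
      exact (Finset.card_filter_le _ _).trans (by simp)
    omega
  · have h8 : cnt {({p, q, a} : Finset V)} {p, x} = 0 :=
      cnt_eq_zero_of_notMem (v := x) (by simp) (by simp [nodes, hx, hxq, hxa])
    have h9 : x ∈ nodes P := by
      obtain ⟨f, hf, hxf⟩ := cnt_pos.1 (by omega : 0 < cnt P {x})
      exact mem_nodes.2 ⟨f, hf, by simpa using hxf⟩
    have := hbound x h9
    omega

lemma edge_le (h : IsBdSplit L v P Q a p q) (he : e ∈ edges (splitBd L v P Q a p q)) :
    cnt (splitBd L v P Q a p q) e ≤ 2 := by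
  have hpos := cnt_pos_of_mem_edges he
  obtain ⟨he2, t, ht, het⟩ := mem_edges.1 he
  by_cases hp : p ∈ e
  · obtain ⟨x, hx, rfl⟩ := exists_pair_of_mem he2 hp
    exact h.cnt_pair_le hx hpos
  by_cases hq : q ∈ e
  · obtain ⟨x, hx, rfl⟩ := exists_pair_of_mem he2 hq
    rw [splitBd_symm] at hpos ⊢
    exact h.symm.cnt_pair_le hx hpos
  have h1 := h.cnt_splitBd e
  rw [Finset.erase_eq_of_notMem hp, Finset.erase_eq_of_notMem hq] at h1
  have h2 : cnt {({p, q, a} : Finset V)} e = 0 := by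
    by_contra h0
    obtain ⟨s, hs, hes⟩ := cnt_pos.1 (Nat.pos_of_ne_zero h0)
    rw [Finset.mem_singleton] at hs
    subst hs
    rw [Finset.subset_insert_iff_of_notMem hp, Finset.subset_insert_iff_of_notMem hq] at hes
    have := Finset.card_le_card hes
    rw [he2] at this
    simp at this
  have h3 := h.cnt_link_add e
  have hv : v ∉ e := by
    intro hv
    rw [h2, cnt_eq_zero_of_notMem (K := L.filter fun t => v ∉ t) hv,
      cnt_eq_zero_of_notMem (K := P) hv, cnt_eq_zero_of_notMem (K := Q) hv] at h1
    · omega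
    · intro hh
      obtain ⟨f, hf, hvf⟩ := mem_nodes.1 hh
      exact (h.symm.of_mem_left hf).1 hvf
    · intro hh
      obtain ⟨f, hf, hvf⟩ := mem_nodes.1 hh
      exact (h.of_mem_left hf).1 hvf
    · intro hh
      obtain ⟨f, hf, hvf⟩ := mem_nodes.1 hh
      exact (Finset.mem_filter.1 hf).2 hvf
  rw [Finset.erase_eq_of_notMem hv] at h3
  have h4 : e ∈ edges L := mem_edges.2 ⟨he2, cnt_pos.1 (by omega)⟩
  have := h.disk.cnt_le h4
  omega

lemma mem₁ (ht : t ∈ L) (hv : v ∉ t) : t ∈ splitBd L v P Q a p q :=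
  mem_splitBd.2 (.inl ⟨ht, hv⟩)
lemma mem₂ (hf : f ∈ P) : insert p f ∈ splitBd L v P Q a p q :=
  mem_splitBd.2 (.inr (.inl ⟨f, hf, rfl⟩))
lemma mem₃ (hf : f ∈ Q) : insert q f ∈ splitBd L v P Q a p q :=
  mem_splitBd.2 (.inr (.inr (.inl ⟨f, hf, rfl⟩)))
lemma mem₄ : {p, q, a} ∈ splitBd L v P Q a p q :=
  mem_splitBd.2 (.inr (.inr (.inr rfl)))

/-- The link of `p` is `P` with the edge `qa` of the new triangle attached at `a`. -/
lemma link_connected_new (h : IsBdSplit L v P Q a p q) :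
    Connected (link (splitBd L v P Q a p q) p) := by
  rw [link_connected_iff]
  intro C hC
  have key : ∀ t ∈ splitBd L v P Q a p q, p ∈ t → ∀ x ∈ t, x ≠ p →
      ∃ x' ∈ nodes P, (C x ↔ C x') := by
    intro t ht hpt x hx hxp
    have ht₀ := ht
    rcases mem_splitBd.1 ht with ht | ⟨f, hf, rfl⟩ | ⟨f, hf, rfl⟩ | rfl
    · exact (h.left_notMem (mem_nodes.2 ⟨t, ht.1, hpt⟩)).elim
    · exact ⟨x, mem_nodes.2 ⟨f, hf, Finset.mem_of_mem_insert_of_ne hx hxp⟩, Iff.rfl⟩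
    · exact ((h.symm.notMem_left hf).2 (Finset.mem_of_mem_insert_of_ne hpt h.ne)).elim
    · exact ⟨a, h.mem_nodes_left, hC _ ht₀ hpt x hx a (by simp) hxp h.apex_ne.2.1,
        hC _ ht₀ hpt a (by simp) x hx h.apex_ne.2.1 hxp⟩
  intro t ht hvt t' ht' hvt' x hx y hy hxv hyv
  obtain ⟨x', hx', hxx⟩ := key t ht hvt x hx hxv
  obtain ⟨y', hy', hyy⟩ := key t' ht' hvt' y hy hyv
  rw [hxx, hyy]
  refine connected_iff.1 h.connected_left C ?_ x' hx' y' hy'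
  intro f hf u hu w hw
  have h1 := (h.notMem_left hf).1
  exact hC _ (mem₂ hf) (by simp) u (by simp [hu]) w (by simp [hw]) (fun h => h1 (h ▸ hu))
    (fun h => h1 (h ▸ hw))

lemma link_connected_old (h : IsBdSplit L v P Q a p q) (hxL : x ∈ nodes L) (hxv : x ≠ v) :
    Connected (link (splitBd L v P Q a p q) x) := by
  classical
  have hxp : x ≠ p := fun hh => h.left_notMem (hh ▸ hxL)
  have hxq : x ≠ q := fun hh => h.right_notMem (hh ▸ hxL)
  rw [link_connected_iff]
  intro C hC
  -- A colouring of the new link of `x` is pulled back to the old link by giving `v` the colour of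
  -- the node that replaces it on the side of `x`. If `x` is on both sides then `x = a`, and the new
  -- triangle makes the colours of `p` and `q` agree.
  set D : V → Prop := fun z => if z = v then (if x ∈ nodes P then C p else C q) else C z with hD
  have hDv : D v ↔ if x ∈ nodes P then C p else C q := by simp [hD]
  have hDz : ∀ z, z ≠ v → (D z ↔ C z) := fun z hz => by simp [hD, hz]
  have hpq : x = a → (C p ↔ C q) := by
    rintro rfl
    exact ⟨hC _ mem₄ (by simp) p (by simp) q (by simp) hxp.symm hxq.symm,
      hC _ mem₄ (by simp) q (by simp) p (by simp) hxq.symm hxp.symm⟩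
  have hDP : x ∈ nodes P → (D v ↔ C p) := fun hx => by rw [hDv, if_pos hx]
  have hDQ : x ∈ nodes Q → (D v ↔ C q) := fun hx => by
    rw [hDv]
    split_ifs with hP
    · exact hpq ((h.inter x).1 ⟨hP, hx⟩)
    · rfl
  have hconst := link_connected_iff.1 (h.disk.link_connected x hxL) D ?_
  · have key : ∀ t ∈ splitBd L v P Q a p q, x ∈ t → ∀ z ∈ t, z ≠ x →
        ∃ s ∈ L, x ∈ s ∧ ∃ z' ∈ s, z' ≠ x ∧ (C z ↔ D z') := by
      intro t ht hxt z hz hzx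
      rcases mem_splitBd.1 ht with ht | ⟨f, hf, rfl⟩ | ⟨f, hf, rfl⟩ | rfl
      · exact ⟨t, ht.1, hxt, z, hz, hzx, (hDz z (fun hh => ht.2 (hh ▸ hz))).symm⟩
      · have hxf := Finset.mem_of_mem_insert_of_ne hxt hxp
        obtain ⟨h1, h2⟩ := h.of_mem_left hf
        refine ⟨_, h2, by simp [hxf], ?_⟩
        rcases Finset.mem_insert.1 hz with rfl | hz
        · exact ⟨v, by simp, hxv.symm, (hDP (mem_nodes.2 ⟨f, hf, hxf⟩)).symm⟩
        · exact ⟨z, by simp [hz], hzx, (hDz z (fun hh => h1 (hh ▸ hz))).symm⟩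
      · have hxf := Finset.mem_of_mem_insert_of_ne hxt hxq
        obtain ⟨h1, h2⟩ := h.symm.of_mem_left hf
        refine ⟨_, h2, by simp [hxf], ?_⟩
        rcases Finset.mem_insert.1 hz with rfl | hz
        · exact ⟨v, by simp, hxv.symm, (hDQ (mem_nodes.2 ⟨f, hf, hxf⟩)).symm⟩
        · exact ⟨z, by simp [hz], hzx, (hDz z (fun hh => h1 (hh ▸ hz))).symm⟩
      · have hxa : x = a := by simpa [hxp, hxq] using hxt
        subst hxa
        obtain ⟨f, hf, hxf⟩ := mem_nodes.1 h.mem_nodes_left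
        refine ⟨_, (h.of_mem_left hf).2, by simp [hxf], v, by simp, hxv.symm, ?_⟩
        rw [hDP h.mem_nodes_left]
        simp only [Finset.mem_insert, Finset.mem_singleton, hzx, or_false] at hz
        rcases hz with rfl | rfl
        · rfl
        · exact (hpq rfl).symm
    intro t ht hvt t' ht' hvt' z hz y hy hzv hyv
    obtain ⟨s, hs, hxs, z', hz', hzx', hzz⟩ := key t ht hvt z hz hzv
    obtain ⟨s', hs', hxs', y', hy', hyx', hyy⟩ := key t' ht' hvt' y hy hyv
    rw [hzz, hyy]
    exact hconst s hs hxs s' hs' hxs' z' hz' y' hy' hzx' hyx'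
  · intro t ht hxt y hy z hz hyx hzx
    by_cases hvt : v ∈ t
    · have hxe : x ∈ t.erase v := by simp [hxv, hxt]
      have aux : ∀ r, (D v ↔ C r) → insert r (t.erase v) ∈ splitBd L v P Q a p q → r ≠ x →
          D y → D z := by
        intro r hr hmem hrx
        have key : ∀ z ∈ t, z ≠ x → ∃ z' ∈ insert r (t.erase v), z' ≠ x ∧ (D z ↔ C z') := by
          intro z hz hzx
          by_cases hzv : z = v
          · subst hzv
            exact ⟨r, by simp, hrx, hr⟩
          · exact ⟨z, by simp [hzv, hz], hzx, hDz z hzv⟩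
        obtain ⟨y', hy', hyx', hyy⟩ := key y hy hyx
        obtain ⟨z', hz', hzx', hzz⟩ := key z hz hzx
        rw [hyy, hzz]
        exact hC _ hmem (Finset.mem_insert_of_mem hxe) y' hy' z' hz' hyx' hzx'
      rcases h.erase_mem ht hvt with h1 | h1
      · exact aux p (hDP (mem_nodes.2 ⟨_, h1, hxe⟩)) (mem₂ h1) hxp.symm
      · exact aux q (hDQ (mem_nodes.2 ⟨_, h1, hxe⟩)) (mem₃ h1) hxq.symm
    · rw [hDz y (fun hh => hvt (hh ▸ hy)), hDz z (fun hh => hvt (hh ▸ hz))]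
      exact hC t (mem₁ ht hvt) hxt y hy z hz hyx hzx

lemma connected (h : IsBdSplit L v P Q a p q) : Connected (splitBd L v P Q a p q) := by
  classical
  rw [connected_iff]
  intro C hC
  have hpq : C p ↔ C q := ⟨hC _ mem₄ p (by simp) q (by simp), hC _ mem₄ q (by simp) p (by simp)⟩
  set D : V → Prop := fun z => if z = v then C p else C z with hD
  have hDv : D v ↔ C p := by simp [hD]
  have hDz : ∀ z, z ≠ v → (D z ↔ C z) := fun z hz => by simp [hD, hz]
  have hconst := connected_iff.1 h.disk.connected D ?_
  · have key : ∀ z ∈ nodes (splitBd L v P Q a p q), ∃ z' ∈ nodes L, (C z ↔ D z') := by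
      intro z hz
      obtain ⟨t, ht, hzt⟩ := mem_nodes.1 hz
      rcases mem_splitBd.1 ht with ht | ⟨f, hf, rfl⟩ | ⟨f, hf, rfl⟩ | rfl
      · exact ⟨z, mem_nodes.2 ⟨t, ht.1, hzt⟩, (hDz z (fun hh => ht.2 (hh ▸ hzt))).symm⟩
      · rcases Finset.mem_insert.1 hzt with rfl | hzt
        · exact ⟨v, h.mem, hDv.symm⟩
        · exact ⟨z, h.nodes_left_subset (mem_nodes.2 ⟨f, hf, hzt⟩),
            (hDz z (fun hh => (h.of_mem_left hf).1 (hh ▸ hzt))).symm⟩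
      · rcases Finset.mem_insert.1 hzt with rfl | hzt
        · exact ⟨v, h.mem, (hDv.trans hpq).symm⟩
        · exact ⟨z, h.symm.nodes_left_subset (mem_nodes.2 ⟨f, hf, hzt⟩),
            (hDz z (fun hh => (h.symm.of_mem_left hf).1 (hh ▸ hzt))).symm⟩
      · refine ⟨a, h.apex_mem, ?_⟩
        rw [hDz a h.apex_ne.1]
        exact ⟨hC _ ht z hzt a (by simp), hC _ ht a (by simp) z hzt⟩
    intro u hu w hw
    obtain ⟨u', hu', huu⟩ := key u hu
    obtain ⟨w', hw', hww⟩ := key w hw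
    rw [huu, hww]
    exact hconst u' hu' w' hw'
  · intro t ht y hy z hz
    by_cases hvt : v ∈ t
    · have aux : ∀ r, (D v ↔ C r) → insert r (t.erase v) ∈ splitBd L v P Q a p q →
          D y → D z := by
        intro r hr hmem
        have key : ∀ z ∈ t, ∃ z' ∈ insert r (t.erase v), (D z ↔ C z') := by
          intro z hz
          by_cases hzv : z = v
          · subst hzv
            exact ⟨r, by simp, hr⟩
          · exact ⟨z, by simp [hzv, hz], hDz z hzv⟩
        obtain ⟨y', hy', hyy⟩ := key y hy
        obtain ⟨z', hz', hzz⟩ := key z hz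
        rw [hyy, hzz]
        exact hC _ hmem y' hy' z' hz'
      rcases h.erase_mem ht hvt with h1 | h1
      · exact aux p hDv (mem₂ h1)
      · exact aux q (hDv.trans hpq) (mem₃ h1)
    · rw [hDz y (fun hh => hvt (hh ▸ hy)), hDz z (fun hh => hvt (hh ▸ hz))]
      exact hC t (mem₁ ht hvt) y hy z hz

lemma nodes_eq (h : IsBdSplit L v P Q a p q) :
    nodes (splitBd L v P Q a p q) = insert p (insert q ((nodes L).erase v)) := by
  ext z
  simp only [Finset.mem_insert, Finset.mem_erase]
  constructor
  · intro hz
    obtain ⟨t, ht, hzt⟩ := mem_nodes.1 hz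
    rcases mem_splitBd.1 ht with ht | ⟨f, hf, rfl⟩ | ⟨f, hf, rfl⟩ | rfl
    · exact .inr (.inr ⟨fun hh => ht.2 (hh ▸ hzt), mem_nodes.2 ⟨t, ht.1, hzt⟩⟩)
    · rcases Finset.mem_insert.1 hzt with rfl | hzt
      · exact .inl rfl
      · exact .inr (.inr ⟨fun hh => (h.of_mem_left hf).1 (hh ▸ hzt),
          h.nodes_left_subset (mem_nodes.2 ⟨f, hf, hzt⟩)⟩)
    · rcases Finset.mem_insert.1 hzt with rfl | hzt
      · exact .inr (.inl rfl)
      · exact .inr (.inr ⟨fun hh => (h.symm.of_mem_left hf).1 (hh ▸ hzt),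
          h.symm.nodes_left_subset (mem_nodes.2 ⟨f, hf, hzt⟩)⟩)
    · simp only [Finset.mem_insert, Finset.mem_singleton] at hzt
      rcases hzt with rfl | rfl | rfl
      · exact .inl rfl
      · exact .inr (.inl rfl)
      · exact .inr (.inr ⟨h.apex_ne.1, h.apex_mem⟩)
  · rintro (rfl | rfl | ⟨hzv, hz⟩)
    · exact mem_nodes.2 ⟨_, mem₄, by simp⟩
    · exact mem_nodes.2 ⟨_, mem₄, by simp⟩
    · obtain ⟨t, ht, hzt⟩ := mem_nodes.1 hz
      by_cases hvt : v ∈ t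
      · have hze : z ∈ t.erase v := by simp [hzv, hzt]
        rcases h.erase_mem ht hvt with h1 | h1
        · exact mem_nodes.2 ⟨_, mem₂ h1, by simp [hze]⟩
        · exact mem_nodes.2 ⟨_, mem₃ h1, by simp [hze]⟩
      · exact mem_nodes.2 ⟨t, mem₁ ht hvt, hzt⟩

lemma pair_left_mem_edges (h : IsBdSplit L v P Q a p q) (hxp : x ≠ p) (hxq : x ≠ q) :
    {p, x} ∈ edges (splitBd L v P Q a p q) ↔ x ∈ nodes P := by
  rw [pair_mem_edges]
  constructor
  · rintro ⟨-, t, ht, hpt, hxt⟩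
    rcases mem_splitBd.1 ht with ht | ⟨f, hf, rfl⟩ | ⟨f, hf, rfl⟩ | rfl
    · exact (h.left_notMem (mem_nodes.2 ⟨t, ht.1, hpt⟩)).elim
    · exact mem_nodes.2 ⟨f, hf, Finset.mem_of_mem_insert_of_ne hxt hxp⟩
    · exact ((h.symm.notMem_left hf).2 (Finset.mem_of_mem_insert_of_ne hpt h.ne)).elim
    · have : x = a := by simpa [hxp, hxq] using hxt
      exact this ▸ h.mem_nodes_left
  · intro hx
    obtain ⟨f, hf, hxf⟩ := mem_nodes.1 hx
    exact ⟨hxp.symm, _, mem₂ hf, by simp, by simp [hxf]⟩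

lemma edge_iff_of_notMem (h : IsBdSplit L v P Q a p q) (hp : p ∉ e) (hq : q ∉ e) :
    e ∈ edges (splitBd L v P Q a p q) ↔ e ∈ edges L ∧ v ∉ e := by
  rw [mem_edges, mem_edges, and_assoc]
  refine and_congr_right fun he2 => ?_
  constructor
  · rintro ⟨t, ht, het⟩
    rcases mem_splitBd.1 ht with ht | ⟨f, hf, rfl⟩ | ⟨f, hf, rfl⟩ | rfl
    · exact ⟨⟨t, ht.1, het⟩, fun hv => ht.2 (het hv)⟩
    · rw [Finset.subset_insert_iff_of_notMem hp] at het
      obtain ⟨h1, h2⟩ := h.of_mem_left hf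
      exact ⟨⟨_, h2, het.trans (Finset.subset_insert _ _)⟩, fun hv => h1 (het hv)⟩
    · rw [Finset.subset_insert_iff_of_notMem hq] at het
      obtain ⟨h1, h2⟩ := h.symm.of_mem_left hf
      exact ⟨⟨_, h2, het.trans (Finset.subset_insert _ _)⟩, fun hv => h1 (het hv)⟩
    · rw [Finset.subset_insert_iff_of_notMem hp, Finset.subset_insert_iff_of_notMem hq] at het
      have := Finset.card_le_card het
      rw [he2] at this
      simp at this
  · rintro ⟨⟨t, ht, het⟩, hv⟩
    by_cases hvt : v ∈ t
    · have hee : e ⊆ t.erase v := Finset.subset_erase.2 ⟨het, hv⟩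
      rcases h.erase_mem ht hvt with h1 | h1
      · exact ⟨_, mem₂ h1, hee.trans (Finset.subset_insert _ _)⟩
      · exact ⟨_, mem₃ h1, hee.trans (Finset.subset_insert _ _)⟩
    · exact ⟨t, mem₁ ht hvt, het⟩

lemma edges_eq (h : IsBdSplit L v P Q a p q) : edges (splitBd L v P Q a p q) =
    insert {p, q} (((edges L).filter fun e => v ∉ e) ∪
      (((nodes P).image fun x => {p, x}) ∪ (nodes Q).image fun x => {q, x})) := by
  ext e
  simp only [Finset.mem_insert, Finset.mem_union, Finset.mem_filter, Finset.mem_image]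
  have hPp : p ∉ nodes P := fun hh => h.left_notMem (h.nodes_left_subset hh)
  have hPq : q ∉ nodes P := fun hh => h.right_notMem (h.nodes_left_subset hh)
  have hQp : p ∉ nodes Q := fun hh => h.left_notMem (h.symm.nodes_left_subset hh)
  have hQq : q ∉ nodes Q := fun hh => h.right_notMem (h.symm.nodes_left_subset hh)
  constructor
  · intro he
    have he2 := (mem_edges.1 he).1
    by_cases hp : p ∈ e
    · obtain ⟨x, hx, rfl⟩ := exists_pair_of_mem he2 hp
      by_cases hxq : x = q
      · exact .inl (hxq ▸ rfl)
      · exact .inr (.inr (.inl ⟨x, (h.pair_left_mem_edges hx hxq).1 he, rfl⟩))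
    by_cases hq : q ∈ e
    · obtain ⟨x, hx, rfl⟩ := exists_pair_of_mem he2 hq
      rw [splitBd_symm, h.symm.pair_left_mem_edges hx (fun hh => hp (by simp [hh]))] at he
      exact .inr (.inr (.inr ⟨x, he, rfl⟩))
    exact .inr (.inl ((h.edge_iff_of_notMem hp hq).1 he))
  · rintro (rfl | ⟨h1, h2⟩ | ⟨x, hx, rfl⟩ | ⟨x, hx, rfl⟩)
    · exact pair_mem_edges.2 ⟨h.ne, _, mem₄, by simp, by simp⟩
    · have hL : ∀ z, z ∉ nodes L → z ∉ e := fun z hz hze => by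
        obtain ⟨-, t, ht, het⟩ := mem_edges.1 h1
        exact hz (mem_nodes.2 ⟨t, ht, het hze⟩)
      exact (h.edge_iff_of_notMem (hL p h.left_notMem) (hL q h.right_notMem)).2 ⟨h1, h2⟩
    · exact (h.pair_left_mem_edges (fun hh => hPp (hh ▸ hx)) (fun hh => hPq (hh ▸ hx))).2 hx
    · rw [splitBd_symm]
      exact (h.symm.pair_left_mem_edges (fun hh => hQq (hh ▸ hx)) (fun hh => hQp (hh ▸ hx))).2 hx

lemma card_image_pair {S : Finset V} (hp : p ∉ S) :
    (S.image fun x => ({p, x} : Finset V)).card = S.card := by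
  refine Finset.card_image_of_injOn ?_
  intro x hx y hy hxy
  have : x ∈ ({p, y} : Finset V) := by
    simp only at hxy
    rw [← hxy]; simp
  simp only [Finset.mem_insert, Finset.mem_singleton] at this
  rcases this with rfl | rfl
  · exact (hp hx).elim
  · rfl

/-- The edges at `v` correspond to the nodes of `P ∪ Q`, where `a` is counted once. The new edges
correspond to the nodes of `P` and of `Q` separately, plus the edge `pq`. -/
lemma card_edges (h : IsBdSplit L v P Q a p q) :
    (edges (splitBd L v P Q a p q)).card = (edges L).card + 2 := by
  have hPp : p ∉ nodes P := fun hh => h.left_notMem (h.nodes_left_subset hh)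
  have hPq : q ∉ nodes P := fun hh => h.right_notMem (h.nodes_left_subset hh)
  have hQp : p ∉ nodes Q := fun hh => h.left_notMem (h.symm.nodes_left_subset hh)
  have hQq : q ∉ nodes Q := fun hh => h.right_notMem (h.symm.nodes_left_subset hh)
  have hL : ∀ z e, z ∉ nodes L → e ∈ edges L → z ∉ e := fun z e hz he hze => by
    obtain ⟨-, t, ht, het⟩ := mem_edges.1 he
    exact hz (mem_nodes.2 ⟨t, ht, het hze⟩)
  have hv : v ∉ nodes P ∪ nodes Q := by
    rw [Finset.mem_union, mem_nodes, mem_nodes]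
    rintro (⟨f, hf, hvf⟩ | ⟨f, hf, hvf⟩)
    · exact (h.of_mem_left hf).1 hvf
    · exact (h.symm.of_mem_left hf).1 hvf
  have h1 : (edges L).filter (fun e => v ∈ e) =
      (nodes P ∪ nodes Q).image fun x => {v, x} := by
    rw [← nodes_union, ← h.link_eq]
    ext e
    simp only [Finset.mem_filter, Finset.mem_image, mem_nodes_link]
    constructor
    · rintro ⟨he, hve⟩
      obtain ⟨x, hx, rfl⟩ := exists_pair_of_mem (mem_edges.1 he).1 hve
      obtain ⟨-, t, ht, h1, h2⟩ := pair_mem_edges.1 he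
      exact ⟨x, ⟨hx, t, ht, h1, h2⟩, rfl⟩
    · rintro ⟨x, ⟨hx, t, ht, h1, h2⟩, rfl⟩
      exact ⟨pair_mem_edges.2 ⟨hx.symm, t, ht, h1, h2⟩, by simp⟩
  have h2 := Finset.card_filter_add_card_filter_not (s := edges L) (fun e => v ∈ e)
  rw [h1, card_image_pair hv] at h2
  have h3 := Finset.card_union_add_card_inter (nodes P) (nodes Q)
  have h4 : nodes P ∩ nodes Q = {a} := by ext x; simp [h.inter]
  rw [h4, Finset.card_singleton] at h3
  rw [h.edges_eq, Finset.card_insert_of_notMem, Finset.card_union_of_disjoint,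
    Finset.card_union_of_disjoint, card_image_pair hPp, card_image_pair hQq]
  · omega
  · rw [Finset.disjoint_left]
    intro e he he'
    obtain ⟨x, hx, rfl⟩ := Finset.mem_image.1 he
    obtain ⟨y, hy, hxy⟩ := Finset.mem_image.1 he'
    have : q ∈ ({p, x} : Finset V) := hxy ▸ (by simp)
    simp only [Finset.mem_insert, Finset.mem_singleton, h.ne.symm, false_or] at this
    exact hPq (this ▸ hx)
  · rw [Finset.disjoint_left]
    intro e he he'
    have he := (Finset.mem_filter.1 he).1
    rcases Finset.mem_union.1 he' with he' | he'
    · obtain ⟨x, hx, rfl⟩ := Finset.mem_image.1 he'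
      exact hL p _ h.left_notMem he (by simp)
    · obtain ⟨x, hx, rfl⟩ := Finset.mem_image.1 he'
      exact hL q _ h.right_notMem he (by simp)
  · simp only [Finset.mem_union, Finset.mem_filter, Finset.mem_image, not_or]
    refine ⟨fun hh => hL p _ h.left_notMem hh.1 (by simp), ?_, ?_⟩
    · rintro ⟨x, hx, hxy⟩
      have : q ∈ ({p, x} : Finset V) := hxy ▸ (by simp)
      simp only [Finset.mem_insert, Finset.mem_singleton, h.ne.symm, false_or] at this
      exact hPq (this ▸ hx)
    · rintro ⟨x, hx, hxy⟩
      have : p ∈ ({q, x} : Finset V) := hxy ▸ (by simp)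
      simp only [Finset.mem_insert, Finset.mem_singleton, h.ne, false_or] at this
      exact hQp (this ▸ hx)

lemma card_splitBd (h : IsBdSplit L v P Q a p q) :
    (splitBd L v P Q a p q).card = L.card + 1 := by
  -- The facets that contain the empty set are all the facets.
  have h0 := h.cnt_splitBd ∅
  have h1 := h.cnt_link_add ∅
  simp only [cnt, Finset.erase_empty, Finset.empty_subset, Finset.filter_true,
    Finset.card_singleton] at h0 h1
  omega

/-- Splitting a node of a disk gives a disk. -/
lemma isDisk (h : IsBdSplit L v P Q a p q) : IsDisk (splitBd L v P Q a p q) := by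
  refine ⟨⟨⟨_, mem₄⟩, ?_, fun e he => h.edge_le he, ?_, h.connected⟩, ?_, ?_⟩
  · intro t ht
    rcases mem_splitBd.1 ht with ht | ⟨f, hf, rfl⟩ | ⟨f, hf, rfl⟩ | rfl
    · exact h.disk.card_eq t ht.1
    · rw [Finset.card_insert_of_notMem (h.notMem_left hf).1, h.card_left hf]
    · rw [Finset.card_insert_of_notMem (h.symm.notMem_left hf).1, h.symm.card_left hf]
    · exact Finset.card_eq_three.2 ⟨p, q, a, h.ne, h.apex_ne.2.1.symm, h.apex_ne.2.2.symm, rfl⟩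
  · intro x hx
    rw [h.nodes_eq, Finset.mem_insert, Finset.mem_insert, Finset.mem_erase] at hx
    rcases hx with rfl | rfl | ⟨hxv, hx⟩
    · exact h.link_connected_new
    · rw [splitBd_symm]
      exact h.symm.link_connected_new
    · exact h.link_connected_old hx hxv
  · exact ⟨{p, q}, mem_bdEdges.2 ⟨Finset.card_pair h.ne, h.cnt_pair_new⟩⟩
  · have h1 := h.disk.euler_eq
    have h2 : 0 < (nodes L).card := Finset.card_pos.2 ⟨v, h.mem⟩
    unfold euler at h1 ⊢
    rw [h.card_edges, h.card_splitBd, h.nodes_eq, Finset.card_insert_of_notMem,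
      Finset.card_insert_of_notMem, Finset.card_erase_of_mem h.mem]
    · push_cast [Nat.cast_sub h2]
      omega
    · simp [h.right_notMem]
    · simp [h.ne, h.left_notMem]

end IsBdSplit

end BallSplit

namespace BallSplit

variable {V : Type*} [DecidableEq V]

/-! ### External faces and edges seen in links -/

section Links
variable {T A B K : Finset (Finset V)} {n p q a b u v w x y : V} {c : List V} {e f g t : Finset V}

lemma cnt_link (hv : v ∉ e) : cnt (link K v) e = cnt K (insert v e) := by
  have h : (K.filter fun t => insert v e ⊆ t) =
      ((link K v).filter fun t => e ⊆ t).image (insert v) := by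
    ext t
    simp only [Finset.mem_filter, Finset.mem_image, mem_link]
    constructor
    · rintro ⟨ht, hs⟩
      have hvt := hs (Finset.mem_insert_self v e)
      refine ⟨t.erase v, ⟨⟨by simp, by rwa [Finset.insert_erase hvt]⟩, ?_⟩, Finset.insert_erase hvt⟩
      exact Finset.subset_erase.2 ⟨(Finset.subset_insert _ _).trans hs, hv⟩
    · rintro ⟨s, ⟨⟨-, h1⟩, h2⟩, rfl⟩
      exact ⟨h1, Finset.insert_subset_insert _ h2⟩
  unfold cnt
  rw [h, card_image_insert]
  intro s hs
  exact (mem_link.1 (Finset.mem_filter.1 hs).1).1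

/-- Adding `v` is a bijection from the facets of the link to the facets at `v`. So the external
faces at `v` are read off from the boundary of its link. -/
lemma insert_mem_extFaces (hv : v ∉ e) : insert v e ∈ extFaces T ↔ e ∈ bdEdges (link T v) := by
  unfold extFaces
  rw [mem_bdry, mem_bdEdges, cnt_link hv, Finset.card_insert_of_notMem hv]
  constructor <;> rintro ⟨h1, h2⟩ <;> exact ⟨by omega, h2⟩

lemma pair_mem_extEdges : {u, v} ∈ extEdges T ↔ u ≠ v ∧ ∃ f ∈ extFaces T, u ∈ f ∧ v ∈ f :=
  pair_mem_edges

lemma pair_mem_extEdges_iff_bdNodes : {v, u} ∈ extEdges T ↔ u ∈ bdNodes (link T v) := by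
  rw [pair_mem_extEdges, mem_bdNodes]
  constructor
  · rintro ⟨hvu, f, hf, hvf, huf⟩
    refine ⟨f.erase v, ?_, by simp [hvu.symm, huf]⟩
    rw [← insert_mem_extFaces (by simp), Finset.insert_erase hvf]
    exact hf
  · rintro ⟨e, he, hue⟩
    obtain ⟨-, s, hs, hes⟩ := mem_edges.1 (bdEdges_subset_edges he)
    have hve : v ∉ e := fun h => (mem_link.1 hs).1 (hes h)
    exact ⟨fun h => hve (h ▸ hue), _, (insert_mem_extFaces hve).2 he, by simp, by simp [hue]⟩

lemma cnt_link_filter (h : link T n = A ∪ B)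
    (hd : Disjoint A B) (e : Finset V) :
    cnt T e = cnt (T.filter fun t => n ∉ t) e + cnt A (e.erase n) + cnt B (e.erase n) := by
  have h1 : T = T.filter (fun t => n ∉ t) ∪ (link T n).image (insert n) := by
    ext t
    simp only [Finset.mem_union, Finset.mem_filter, Finset.mem_image, mem_link]
    constructor
    · intro ht
      by_cases hv : n ∈ t
      · exact .inr ⟨t.erase n, ⟨by simp, by rwa [Finset.insert_erase hv]⟩, Finset.insert_erase hv⟩
      · exact .inl ⟨ht, hv⟩
    · rintro (h | ⟨f, h, rfl⟩)
      · exact h.1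
      · exact h.2
  have h2 : Disjoint (T.filter fun t => n ∉ t) ((link T n).image (insert n)) := by
    rw [Finset.disjoint_left]
    intro t ht ht'
    obtain ⟨f, -, rfl⟩ := Finset.mem_image.1 ht'
    simp at ht
  conv_lhs => rw [h1]
  rw [cnt_union h2, cnt_image_insert (fun f hf => (mem_link.1 hf).1), h, cnt_union hd, add_assoc]

lemma link_congr (h : ∀ t, w ∈ t → (t ∈ T ↔ t ∈ K)) : link T w = link K w := by
  ext e
  rw [mem_link, mem_link, h _ (Finset.mem_insert_self _ _)]

lemma link_rename (σ : Equiv.Perm V) (hw : σ w = w) : link (rename σ T) w = rename σ (link T w) := by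
  have hw' : σ.symm w = w := by rw [Equiv.symm_apply_eq, hw]
  ext e
  rw [mem_link]
  simp only [rename, Finset.mem_image, mem_link]
  constructor
  · rintro ⟨h1, t, ht, h2⟩
    refine ⟨e.image σ.symm, ⟨?_, ?_⟩, by simpa using image_symm_image σ.symm e⟩
    · rw [mem_image_perm]
      rwa [Equiv.symm_symm, hw]
    · have : insert w (e.image σ.symm) = t := by
        have h3 := congrArg (Finset.image σ.symm) h2
        rw [image_symm_image, Finset.image_insert, hw'] at h3
        exact h3.symm
      rwa [this]
  · rintro ⟨s, ⟨h1, h2⟩, rfl⟩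
    refine ⟨?_, _, h2, ?_⟩
    · rwa [mem_image_perm, hw']
    · rw [Finset.image_insert, hw]

lemma image_swap_of_notMem (hn : n ∉ t) (hp : p ∉ t) : t.image (Equiv.swap n p) = t := by
  ext x
  rw [mem_image_perm, Equiv.symm_swap]
  by_cases h1 : x = n
  · subst h1; simp [hn, hp]
  by_cases h2 : x = p
  · subst h2; simp [hn, hp]
  rw [Equiv.swap_apply_of_ne_of_ne h1 h2]

lemma image_swap_insert (hn : n ∉ t) (hp : p ∉ t) :
    (insert n t).image (Equiv.swap n p) = insert p t := by
  rw [Finset.image_insert, Equiv.swap_apply_left, image_swap_of_notMem hn hp]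

lemma exists_unique_pathEdge (hc : c.Nodup) (ha : c.head? = some a) (hb : c.getLast? = some b)
    (hab : a ≠ b) (hw : w = a ∨ w = b) : ∃ x, ∀ y, {w, y} ∈ pathEdges c ↔ y = x := by
  have h1 := countP_pathEdges hc ha hb w
  have hwc : w ∈ c := by
    rcases hw with rfl | rfl
    · exact List.mem_of_mem_head? ha
    · exact List.mem_of_mem_getLast? hb
  rw [if_pos hwc, ← card_filter_pathEdges hc] at h1
  have h2 : ((pathEdges c).toFinset.filter fun e => w ∈ e).card = 1 := by
    rcases hw with rfl | rfl
    · rw [if_pos rfl, if_neg hab] at h1; omega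
    · rw [if_pos rfl, if_neg hab.symm] at h1; omega
  obtain ⟨e, he⟩ := Finset.card_eq_one.1 h2
  have he' : e ∈ (pathEdges c).toFinset.filter fun e => w ∈ e := by simp [he]
  simp only [Finset.mem_filter, List.mem_toFinset] at he'
  obtain ⟨x, hx, rfl⟩ := exists_pair_of_mem (card_of_mem_pathEdges hc he'.1) he'.2
  refine ⟨x, fun y => ⟨fun hy => ?_, fun hy => hy ▸ he'.1⟩⟩
  have h3 : {w, y} ∈ (pathEdges c).toFinset.filter fun e => w ∈ e := by simp [hy]
  rw [he, Finset.mem_singleton] at h3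
  have h4 : y ∈ ({w, x} : Finset V) := h3 ▸ (by simp)
  have h5 : y ≠ w := by
    rintro rfl
    have := card_of_mem_pathEdges hc hy
    simp at this
  simpa [h5] using h4

end Links

/-! ### Links, external faces and adjacency after splitting a node of a 3-dimensional complex -/

/-- The data for splitting the node `n` of `T` along `c` into `p` and `q`. -/
structure IsSplit (T : Finset (Finset V)) (n a b : V) (c : List V) (A B : Finset (Finset V))
    (p q : V) : Prop where
  card_eq : ∀ t ∈ T, t.card = 4
  disk : IsDisk (link T n)
  path : IsSplittingPath (link T n) a b c
  div : Divides (link T n) c A B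
  left_notMem : p ∉ nodes T
  right_notMem : q ∉ nodes T
  ne : p ≠ q

section
variable {T A B : Finset (Finset V)} {n p q a b u v w x y : V} {c : List V} {e f g t : Finset V}

lemma mem_splitNode : t ∈ splitNode T n c A B p q ↔ (t ∈ T ∧ n ∉ t) ∨ (∃ f ∈ A, insert p f = t) ∨
    (∃ f ∈ B, insert q f = t) ∨ ∃ e ∈ pathEdges c, insert p (insert q e) = t := by
  simp only [splitNode, Finset.mem_union, Finset.mem_filter, Finset.mem_image, List.mem_toFinset,
    or_assoc]

lemma splitNode_symm : splitNode T n c A B p q = splitNode T n c B A q p := by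
  ext t
  rw [mem_splitNode, mem_splitNode]
  simp only [Finset.insert_comm p q]
  exact or_congr_right or_left_comm

namespace IsSplit

lemma symm (h : IsSplit T n a b c A B p q) : IsSplit T n a b c B A q p :=
  ⟨h.card_eq, h.disk, h.path, ⟨h.div.right, h.div.left, by rw [Finset.union_comm, h.div.union],
    h.div.disjoint.symm, by rw [Finset.inter_comm, h.div.nodes_inter],
    by rw [Finset.inter_comm, h.div.edges_inter]⟩, h.right_notMem, h.left_notMem, h.ne.symm⟩

lemma cut (h : IsSplit T n a b c A B p q) : IsCutAlong (link T n) a b c A B :=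
  h.div.isCutAlong h.disk.toIsSurface h.path

lemma of_mem_left (h : IsSplit T n a b c A B p q) (hf : f ∈ A) : n ∉ f ∧ insert n f ∈ T :=
  mem_link.1 (h.cut.left_subset hf)

lemma node_mem (h : IsSplit T n a b c A B p q) : n ∈ nodes T := by
  obtain ⟨f, hf⟩ := h.div.left.nonempty
  exact mem_nodes.2 ⟨_, (h.of_mem_left hf).2, by simp⟩

lemma left_ne (h : IsSplit T n a b c A B p q) : p ≠ n := fun hh => h.left_notMem (hh ▸ h.node_mem)

lemma nodes_left_subset (h : IsSplit T n a b c A B p q) : nodes A ⊆ nodes T := by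
  intro x hx
  obtain ⟨f, hf, hxf⟩ := mem_nodes.1 hx
  exact mem_nodes.2 ⟨_, (h.of_mem_left hf).2, by simp [hxf]⟩

lemma node_notMem_left (h : IsSplit T n a b c A B p q) : n ∉ nodes A := by
  intro hh
  obtain ⟨f, hf, hxf⟩ := mem_nodes.1 hh
  exact (h.of_mem_left hf).1 hxf

lemma left_notMem_left (h : IsSplit T n a b c A B p q) : p ∉ nodes A :=
  fun hh => h.left_notMem (h.nodes_left_subset hh)

lemma right_notMem_left (h : IsSplit T n a b c A B p q) : q ∉ nodes A :=
  fun hh => h.right_notMem (h.nodes_left_subset hh)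

lemma mem_left_of_mem_path (h : IsSplit T n a b c A B p q) (hx : x ∈ c) : x ∈ nodes A :=
  (h.cut.nodes_inter.2 hx).1

lemma mem_left_of_mem_edge (h : IsSplit T n a b c A B p q) (he : e ∈ pathEdges c) (hx : x ∈ e) :
    x ∈ nodes A :=
  h.mem_left_of_mem_path (subset_of_mem_pathEdges he hx)

lemma notMem_edge (h : IsSplit T n a b c A B p q) (he : e ∈ pathEdges c) :
    n ∉ e ∧ p ∉ e ∧ q ∉ e :=
  ⟨fun hh => h.node_notMem_left (h.mem_left_of_mem_edge he hh),
    fun hh => h.left_notMem_left (h.mem_left_of_mem_edge he hh),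
    fun hh => h.right_notMem_left (h.mem_left_of_mem_edge he hh)⟩

lemma notMem_left (h : IsSplit T n a b c A B p q) (hf : f ∈ A) : n ∉ f ∧ p ∉ f ∧ q ∉ f :=
  ⟨fun hh => h.node_notMem_left (mem_nodes.2 ⟨f, hf, hh⟩),
    fun hh => h.left_notMem_left (mem_nodes.2 ⟨f, hf, hh⟩),
    fun hh => h.right_notMem_left (mem_nodes.2 ⟨f, hf, hh⟩)⟩

lemma notMem_old (h : IsSplit T n a b c A B p q) (ht : t ∈ T) : p ∉ t ∧ q ∉ t :=
  ⟨fun hh => h.left_notMem (mem_nodes.2 ⟨t, ht, hh⟩),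
    fun hh => h.right_notMem (mem_nodes.2 ⟨t, ht, hh⟩)⟩

lemma erase_mem (h : IsSplit T n a b c A B p q) (ht : t ∈ T) (hn : n ∈ t) :
    t.erase n ∈ A ∨ t.erase n ∈ B := h.cut.mem_or_mem (erase_mem_link ht hn)

lemma mem₁ (ht : t ∈ T) (hn : n ∉ t) : t ∈ splitNode T n c A B p q :=
  mem_splitNode.2 (.inl ⟨ht, hn⟩)
lemma mem₂ (hf : f ∈ A) : insert p f ∈ splitNode T n c A B p q :=
  mem_splitNode.2 (.inr (.inl ⟨f, hf, rfl⟩))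
lemma mem₃ (hf : f ∈ B) : insert q f ∈ splitNode T n c A B p q :=
  mem_splitNode.2 (.inr (.inr (.inl ⟨f, hf, rfl⟩)))
lemma mem₄ (he : e ∈ pathEdges c) : insert p (insert q e) ∈ splitNode T n c A B p q :=
  mem_splitNode.2 (.inr (.inr (.inr ⟨e, he, rfl⟩)))

lemma card_split (h : IsSplit T n a b c A B p q) :
    ∀ t ∈ splitNode T n c A B p q, t.card = 4 := by
  intro t ht
  rcases mem_splitNode.1 ht with ht | ⟨f, hf, rfl⟩ | ⟨f, hf, rfl⟩ | ⟨e, he, rfl⟩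
  · exact h.card_eq t ht.1
  · rw [Finset.card_insert_of_notMem (h.notMem_left hf).2.1, h.div.left.card_eq f hf]
  · rw [Finset.card_insert_of_notMem (h.symm.notMem_left hf).2.1, h.div.right.card_eq f hf]
  · have h1 := h.notMem_edge he
    rw [Finset.card_insert_of_notMem, Finset.card_insert_of_notMem h1.2.2,
      card_of_mem_pathEdges h.path.nodup he]
    simp [h.ne, h1.2.1]

lemma node_notMem_split (h : IsSplit T n a b c A B p q) : n ∉ nodes (splitNode T n c A B p q) := by
  intro hn
  obtain ⟨t, ht, hnt⟩ := mem_nodes.1 hn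
  rcases mem_splitNode.1 ht with ht | ⟨f, hf, rfl⟩ | ⟨f, hf, rfl⟩ | ⟨e, he, rfl⟩
  · exact ht.2 hnt
  · simp [h.left_ne.symm, (h.notMem_left hf).1] at hnt
  · simp [h.symm.left_ne.symm, (h.symm.notMem_left hf).1] at hnt
  · simp [h.left_ne.symm, h.symm.left_ne.symm, (h.notMem_edge he).1] at hnt

lemma nodes_subset (h : IsSplit T n a b c A B p q) (hx : x ∈ nodes T) (hxn : x ≠ n) :
    x ∈ nodes (splitNode T n c A B p q) := by
  obtain ⟨t, ht, hxt⟩ := mem_nodes.1 hx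
  by_cases hn : n ∈ t
  · have hxe : x ∈ t.erase n := by simp [hxn, hxt]
    rcases h.erase_mem ht hn with h1 | h1
    · exact mem_nodes.2 ⟨_, mem₂ h1, by simp [hxe]⟩
    · exact mem_nodes.2 ⟨_, mem₃ h1, by simp [hxe]⟩
  · exact mem_nodes.2 ⟨t, mem₁ ht hn, hxt⟩

/-- The tetrahedra at both new nodes appear in the link of `p` as the cone with apex `q` over the
path, where it is glued to `A`. -/
lemma link_left (h : IsSplit T n a b c A B p q) : link (splitNode T n c A B p q) p =
    A ∪ (pathEdges c).toFinset.image (insert q) := by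
  ext e
  simp only [mem_link, Finset.mem_union, Finset.mem_image, List.mem_toFinset]
  constructor
  · rintro ⟨hp, he⟩
    rcases mem_splitNode.1 he with ht | ⟨f, hf, h1⟩ | ⟨f, hf, h1⟩ | ⟨f, hf, h1⟩
    · exact (h.left_notMem (mem_nodes.2 ⟨_, ht.1, by simp⟩)).elim
    · rw [← Finset.erase_insert hp, ← h1, Finset.erase_insert (h.notMem_left hf).2.1]
      exact .inl hf
    · have : p ∈ insert q f := h1 ▸ (by simp)
      simp [h.ne, (h.symm.notMem_left hf).2.2] at this
    · right
      refine ⟨f, hf, ?_⟩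
      rw [← Finset.erase_insert hp, ← h1, Finset.erase_insert]
      simp [h.ne, (h.notMem_edge hf).2.1]
  · rintro (he | ⟨f, hf, rfl⟩)
    · exact ⟨(h.notMem_left he).2.1, mem₂ he⟩
    · exact ⟨by simp [h.ne, (h.notMem_edge hf).2.1], mem₄ hf⟩

lemma isDisk_left (h : IsSplit T n a b c A B p q) :
    IsDisk (link (splitNode T n c A B p q) p) := by
  rw [h.link_left]
  exact h.div.left.cone h.path.nodup h.path.head_eq h.path.last_eq h.path.ends_ne
    (fun e he => h.cut.cnt_of_mem_path he) h.right_notMem_left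

/-- All tetrahedra that contain `w` and `n` come from `A`, and in them `n` is replaced by `p`. As
`p` is new, the replacement is a transposition. -/
lemma link_of_notMem_right (h : IsSplit T n a b c A B p q) (hw : w ∈ nodes T) (hwn : w ≠ n)
    (hwB : w ∉ nodes B) :
    link (splitNode T n c A B p q) w = rename (Equiv.swap n p) (link T w) := by
  have hwp : w ≠ p := fun hh => h.left_notMem (hh ▸ hw)
  have hwq : w ≠ q := fun hh => h.right_notMem (hh ▸ hw)
  rw [← link_rename _ (Equiv.swap_apply_of_ne_of_ne hwn hwp)]
  refine link_congr fun t hwt => ?_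
  simp only [rename, Finset.mem_image]
  constructor
  · intro ht
    rcases mem_splitNode.1 ht with ht | ⟨f, hf, rfl⟩ | ⟨f, hf, rfl⟩ | ⟨f, hf, rfl⟩
    · exact ⟨t, ht.1, image_swap_of_notMem ht.2 (h.notMem_old ht.1).1⟩
    · exact ⟨_, (h.of_mem_left hf).2,
        image_swap_insert (h.notMem_left hf).1 (h.notMem_left hf).2.1⟩
    · exact (hwB (mem_nodes.2 ⟨f, hf, Finset.mem_of_mem_insert_of_ne hwt hwq⟩)).elim
    · exact (hwB (h.symm.mem_left_of_mem_edge hf (Finset.mem_of_mem_insert_of_ne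
        (Finset.mem_of_mem_insert_of_ne hwt hwp) hwq))).elim
  · rintro ⟨s, hs, rfl⟩
    have hws : w ∈ s := by
      rw [mem_image_perm, Equiv.symm_swap, Equiv.swap_apply_of_ne_of_ne hwn hwp] at hwt
      exact hwt
    by_cases hn : n ∈ s
    · have h1 : s.erase n ∈ A := by
        refine (h.erase_mem hs hn).resolve_right fun h2 => hwB (mem_nodes.2 ⟨_, h2, ?_⟩)
        simp [hwn, hws]
      rw [← Finset.insert_erase hn, image_swap_insert (by simp) (h.notMem_left h1).2.1]
      exact mem₂ h1
    · rw [image_swap_of_notMem hn (h.notMem_old hs).1]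
      exact mem₁ hs hn

/-- A path node with a single path edge `wx` lies in just one tetrahedron at both new nodes. It
yields the triangle `pqx` that is inserted when `n` is split in the link of `w`. -/
lemma link_of_mem_path (h : IsSplit T n a b c A B p q) (hwp : w ≠ p) (hwq : w ≠ q)
    (hwn : w ≠ n) (hx : ∀ y, {w, y} ∈ pathEdges c ↔ y = x) :
    link (splitNode T n c A B p q) w = splitBd (link T w) n (link A w) (link B w) x p q := by
  have hxw : w ≠ x := ne_of_pair_mem_edges (h.path.edge_mem _ ((hx x).2 rfl)).1
  ext s
  rw [mem_splitBd]
  simp only [mem_link]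
  constructor
  · rintro ⟨hws, hs⟩
    rw [← Finset.erase_insert hws]
    have hw : w ∈ insert w s := by simp
    rcases mem_splitNode.1 hs with ht | ⟨f, hf, h1⟩ | ⟨f, hf, h1⟩ | ⟨f, hf, h1⟩
    · left
      rw [Finset.erase_insert hws]
      exact ⟨⟨hws, ht.1⟩, fun hh => ht.2 (by simp [hh])⟩
    · right; left
      rw [← h1] at hw ⊢
      have hwf := Finset.mem_of_mem_insert_of_ne hw hwp
      exact ⟨f.erase w, ⟨by simp, by rwa [Finset.insert_erase hwf]⟩,
        (Finset.erase_insert_of_ne hwp.symm).symm⟩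
    · right; right; left
      rw [← h1] at hw ⊢
      have hwf := Finset.mem_of_mem_insert_of_ne hw hwq
      exact ⟨f.erase w, ⟨by simp, by rwa [Finset.insert_erase hwf]⟩,
        (Finset.erase_insert_of_ne hwq.symm).symm⟩
    · right; right; right
      rw [← h1] at hw ⊢
      have hwf := Finset.mem_of_mem_insert_of_ne (Finset.mem_of_mem_insert_of_ne hw hwp) hwq
      obtain ⟨y, hy, rfl⟩ := exists_pair_of_mem (card_of_mem_pathEdges h.path.nodup hf) hwf
      rw [(hx y).1 hf, Finset.erase_insert_of_ne hwp.symm, Finset.erase_insert_of_ne hwq.symm,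
        Finset.erase_insert (by simpa using hxw)]
  · rintro (⟨⟨h1, h2⟩, h3⟩ | ⟨f, ⟨h1, h2⟩, rfl⟩ | ⟨f, ⟨h1, h2⟩, rfl⟩ | rfl)
    · exact ⟨h1, mem₁ h2 (by simp [h3, hwn.symm])⟩
    · exact ⟨by simp [h1, hwp], by rw [Finset.insert_comm]; exact mem₂ h2⟩
    · exact ⟨by simp [h1, hwq], by rw [Finset.insert_comm]; exact mem₃ h2⟩
    · refine ⟨by simp [hwp, hwq, hxw], ?_⟩
      rw [Finset.insert_comm w p, Finset.insert_comm w q]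
      exact mem₄ ((hx x).2 rfl)

/-- A node common to the links of `w` in `A` and in `B` gives an edge at `w` common to `A` and `B`,
that is a path edge at `w`, and `x` is the end of the only one. -/
lemma isBdSplit_of_mem_path (h : IsSplit T n a b c A B p q) (hd : IsDisk (link T w))
    (hw : w ∈ c) (hx : ∀ y, {w, y} ∈ pathEdges c ↔ y = x) :
    IsBdSplit (link T w) n (link A w) (link B w) x p q where
  disk := hd
  link_eq := by
    ext f
    have hwn : w ≠ n := fun hh => h.node_notMem_left (hh ▸ h.mem_left_of_mem_path hw)
    have hmem : insert w f ∈ A ∪ B ↔ insert w f ∈ link T n := by rw [h.div.union]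
    simp only [Finset.mem_union, mem_link] at hmem ⊢
    rw [← and_or_left, hmem, Finset.insert_comm n w]
    simp only [Finset.mem_insert, not_or, hwn, hwn.symm, not_false_eq_true, true_and]
    tauto
  disjoint := by
    rw [Finset.disjoint_left]
    intro f hf hf'
    exact Finset.disjoint_left.1 h.div.disjoint (mem_link.1 hf).2 (mem_link.1 hf').2
  inter y := by
    rw [← hx, ← h.cut.edges_inter, pair_mem_edges, pair_mem_edges, mem_nodes_link, mem_nodes_link,
      ne_comm]
  connected_left := h.div.left.link_connected w (h.mem_left_of_mem_path hw)
  connected_right := h.div.right.link_connected w (h.symm.mem_left_of_mem_path hw)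
  left_notMem hh := by
    obtain ⟨-, t, ht, -, hp⟩ := mem_nodes_link.1 hh
    exact h.left_notMem (mem_nodes.2 ⟨t, ht, hp⟩)
  right_notMem hh := by
    obtain ⟨-, t, ht, -, hp⟩ := mem_nodes_link.1 hh
    exact h.right_notMem (mem_nodes.2 ⟨t, ht, hp⟩)
  ne := h.ne
  mem := by
    have hwA := h.mem_left_of_mem_path hw
    obtain ⟨f, hf, hwf⟩ := mem_nodes.1 hwA
    exact mem_nodes_link.2 ⟨fun hh => h.node_notMem_left (hh ▸ hwA), _, (h.of_mem_left hf).2,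
      by simp [hwf], by simp⟩

/-- The hemisphere of another node remains a disk, provided that the node is on the boundary of
the hemisphere of the node that is split if it is in that hemisphere at all. -/
lemma isDisk_other (h : IsSplit T n a b c A B p q) (hw : w ∈ nodes T) (hwn : w ≠ n)
    (hd : IsDisk (link T w)) (hbd : w ∈ nodes (link T n) → w ∈ bdNodes (link T n)) :
    IsDisk (link (splitNode T n c A B p q) w) := by
  by_cases hB : w ∈ nodes B
  · by_cases hA : w ∈ nodes A
    · have hwc := h.cut.nodes_inter.1 ⟨hA, hB⟩
      -- A node of the path that is on the boundary of the hemisphere is an end of the path, hence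
      -- in only one path edge.
      have hend := h.path.interior w hwc (hbd (nodes_mono h.cut.left_subset hA))
      obtain ⟨x, hx⟩ := exists_unique_pathEdge h.path.nodup h.path.head_eq h.path.last_eq
        h.path.ends_ne hend
      rw [h.link_of_mem_path (fun hh => h.left_notMem (hh ▸ hw))
        (fun hh => h.right_notMem (hh ▸ hw)) hwn hx]
      exact (h.isBdSplit_of_mem_path hd hwc hx).isDisk
    · rw [splitNode_symm, h.symm.link_of_notMem_right hw hwn hA]
      exact hd.rename _
  · rw [h.link_of_notMem_right hw hwn hB]
    exact hd.rename _

lemma disjoint₁ (h : IsSplit T n a b c A B p q) :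
    Disjoint (T.filter fun t => n ∉ t) (A.image (insert p)) := by
  rw [Finset.disjoint_left]
  intro t ht ht'
  obtain ⟨f, -, rfl⟩ := Finset.mem_image.1 ht'
  exact (h.notMem_old (Finset.mem_filter.1 ht).1).1 (by simp)

lemma disjoint₂ (h : IsSplit T n a b c A B p q) :
    Disjoint (T.filter (fun t => n ∉ t) ∪ A.image (insert p)) (B.image (insert q)) := by
  rw [Finset.disjoint_union_left]
  refine ⟨h.symm.disjoint₁, ?_⟩
  rw [Finset.disjoint_left]
  intro t ht ht'
  obtain ⟨f, hf, rfl⟩ := Finset.mem_image.1 ht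
  obtain ⟨g, hg, hgf⟩ := Finset.mem_image.1 ht'
  have : q ∈ insert p f := hgf ▸ (by simp)
  simp [h.ne.symm, (h.notMem_left hf).2.2] at this

lemma disjoint₃ (h : IsSplit T n a b c A B p q) :
    Disjoint (T.filter (fun t => n ∉ t) ∪ A.image (insert p) ∪ B.image (insert q))
      (((pathEdges c).toFinset.image (insert q)).image (insert p)) := by
  rw [Finset.disjoint_left]
  intro t ht ht'
  obtain ⟨s, hs, rfl⟩ := Finset.mem_image.1 ht'
  obtain ⟨e, he, rfl⟩ := Finset.mem_image.1 hs
  simp only [Finset.mem_union, Finset.mem_filter, Finset.mem_image] at ht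
  rcases ht with (⟨h1, -⟩ | ⟨f, hf, h1⟩) | ⟨f, hf, h1⟩
  · exact (h.notMem_old h1).1 (by simp)
  · have : q ∈ insert p f := h1 ▸ (by simp)
    simp [h.ne.symm, (h.notMem_left hf).2.2] at this
  · have : p ∈ insert q f := h1 ▸ (by simp)
    simp [h.ne, (h.symm.notMem_left hf).2.2] at this

/-- The path is treated as a complex whose facets are its edges, so that the tetrahedra at both new
nodes are an iterated cone over it and are counted like the other parts. -/
lemma cnt_split (h : IsSplit T n a b c A B p q) (f : Finset V) :
    cnt (splitNode T n c A B p q) f = cnt (T.filter fun t => n ∉ t) f + cnt A (f.erase p) +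
      cnt B (f.erase q) + cnt (pathEdges c).toFinset ((f.erase p).erase q) := by
  have h1 : splitNode T n c A B p q = T.filter (fun t => n ∉ t) ∪ A.image (insert p) ∪
      B.image (insert q) ∪ ((pathEdges c).toFinset.image (insert q)).image (insert p) := by
    rw [Finset.image_image]
    rfl
  rw [h1, cnt_union h.disjoint₃, cnt_union h.disjoint₂, cnt_union h.disjoint₁,
    cnt_image_insert (fun f hf => (h.notMem_left hf).2.1),
    cnt_image_insert (fun f hf => (h.symm.notMem_left hf).2.1), cnt_image_insert,
    cnt_image_insert (fun f hf => (h.notMem_edge (List.mem_toFinset.1 hf)).2.2)]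
  intro f hf
  obtain ⟨e, he, rfl⟩ := Finset.mem_image.1 hf
  simp [h.ne, (h.notMem_edge (List.mem_toFinset.1 he)).2.1]

lemma extFaces_old (h : IsSplit T n a b c A B p q) (hp : p ∉ f) (hq : q ∉ f) (hn : n ∉ f) :
    f ∈ extFaces (splitNode T n c A B p q) ↔ f ∈ extFaces T := by
  unfold extFaces
  rw [mem_bdry, mem_bdry]
  refine and_congr_right fun hf3 => ?_
  have h1 := h.cnt_split f
  have h2 := cnt_link_filter (A := A) (B := B) (T := T) (n := n)
    h.div.union.symm h.div.disjoint f
  rw [Finset.erase_eq_of_notMem hp, Finset.erase_eq_of_notMem hq] at h1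
  rw [Finset.erase_eq_of_notMem hn] at h2
  have h3 : cnt (pathEdges c).toFinset f = 0 := by
    by_contra h0
    obtain ⟨e, he, hfe⟩ := cnt_pos.1 (Nat.pos_of_ne_zero h0)
    have := Finset.card_le_card hfe
    rw [card_of_mem_pathEdges h.path.nodup (List.mem_toFinset.1 he)] at this
    omega
  rw [h1, h2, h3, add_zero]

lemma notMem_filter (h : IsSplit T n a b c A B p q) : p ∉ nodes (T.filter fun t => n ∉ t) :=
  fun hp => h.left_notMem (nodes_mono (Finset.filter_subset _ _) hp)

/-- A path edge belongs to one triangle of `A` and to one tetrahedron at both new nodes, so together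
with `p` it is not external. Any other edge of `A` is in as many triangles of `A` as of the old
hemisphere. -/
lemma extFaces_left (h : IsSplit T n a b c A B p q) (hp : p ∉ g) (hq : q ∉ g) :
    insert p g ∈ extFaces (splitNode T n c A B p q) ↔ g ∈ bdEdges (link T n) ∧ g ∈ edges A := by
  unfold extFaces
  rw [mem_bdry, h.cnt_split, Finset.erase_insert hp, Finset.erase_eq_of_notMem hq,
    Finset.card_insert_of_notMem hp, cnt_eq_zero_of_notMem (v := p) (by simp) h.notMem_filter,
    Finset.erase_eq_of_notMem (a := q) (by simp [hq, h.ne.symm]),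
    cnt_eq_zero_of_notMem (v := p) (K := B) (by simp) h.symm.right_notMem_left]
  constructor
  · rintro ⟨h1, h2⟩
    have hg2 : g.card = 2 := by omega
    rw [cnt_of_card_eq (fun f hf => card_of_mem_pathEdges h.path.nodup (List.mem_toFinset.1 hf))
      hg2] at h2
    split_ifs at h2 with hgc
    · have := h.cut.cnt_of_mem_path (List.mem_toFinset.1 hgc)
      omega
    · rw [List.mem_toFinset] at hgc
      have hgA : g ∈ edges A := mem_edges.2 ⟨hg2, cnt_pos.1 (by omega)⟩
      refine ⟨mem_bdEdges.2 ⟨hg2, ?_⟩, hgA⟩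
      rw [← h.cut.cnt_of_notMem_path hgA hgc]
      omega
  · rintro ⟨h1, h2⟩
    obtain ⟨hg2, h3⟩ := mem_bdEdges.1 h1
    have hgc : g ∉ pathEdges c := fun hh => (h.path.edge_mem g hh).2 h1
    rw [cnt_of_card_eq (fun f hf => card_of_mem_pathEdges h.path.nodup (List.mem_toFinset.1 hf))
      hg2, if_neg (by simpa using hgc), h.cut.cnt_of_notMem_path h2 hgc, h3]
    omega

/-- This face lies in one tetrahedron for each path edge at `x`, and only the ends are in exactly
one. -/
lemma extFaces_both (h : IsSplit T n a b c A B p q) (hp : x ≠ p) (hq : x ≠ q) :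
    {p, q, x} ∈ extFaces (splitNode T n c A B p q) ↔ x = a ∨ x = b := by
  have h1 : ({p, q, x} : Finset V).erase p = {q, x} :=
    Finset.erase_insert (by simp [h.ne, hp.symm])
  have h2 : ({q, x} : Finset V).erase q = {x} :=
    Finset.erase_insert (by simp [hq.symm])
  unfold extFaces
  rw [mem_bdry, h.cnt_split, h1, h2, cnt_eq_zero_of_notMem (v := p) (by simp) h.notMem_filter,
    cnt_eq_zero_of_notMem (v := q) (K := A) (by simp) h.right_notMem_left,
    cnt_eq_zero_of_notMem (v := p) (K := B) (by simp [h.ne]) h.symm.right_notMem_left,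
    cnt_pathEdges_singleton h.path.nodup]
  have h3 := countP_pathEdges h.path.nodup h.path.head_eq h.path.last_eq x
  have h4 : ({p, q, x} : Finset V).card = 3 :=
    Finset.card_eq_three.2 ⟨p, q, x, h.ne, hp.symm, hq.symm, rfl⟩
  have hac : a ∈ c := List.mem_of_mem_head? h.path.head_eq
  have hbc : b ∈ c := List.mem_of_mem_getLast? h.path.last_eq
  have hab := h.path.ends_ne
  simp only [h4, true_and, zero_add]
  constructor
  · intro h5
    rw [h5] at h3
    by_contra h6
    push Not at h6
    rw [if_neg h6.1, if_neg h6.2] at h3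
    split_ifs at h3 <;> omega
  · rintro (rfl | rfl)
    · rw [if_pos rfl, if_neg hab, if_pos hac] at h3; omega
    · rw [if_pos rfl, if_neg hab.symm, if_pos hbc] at h3; omega

/-- The external faces after a split. -/
lemma mem_extFaces (h : IsSplit T n a b c A B p q) (hf : f ∈ extFaces (splitNode T n c A B p q)) :
    (f ∈ extFaces T ∧ n ∉ f ∧ p ∉ f ∧ q ∉ f) ∨
    (∃ g ∈ bdEdges (link T n), g ∈ edges A ∧ p ∉ g ∧ q ∉ g ∧ f = insert p g) ∨
    (∃ g ∈ bdEdges (link T n), g ∈ edges B ∧ p ∉ g ∧ q ∉ g ∧ f = insert q g) ∨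
    ∃ x, (x = a ∨ x = b) ∧ f = {p, q, x} := by
  have hn : n ∉ f := fun hn => by
    obtain ⟨t, ht, hft⟩ := cnt_pos.1 (by rw [(mem_bdry.1 hf).2]; omega)
    exact h.node_notMem_split (mem_nodes.2 ⟨t, ht, hft hn⟩)
  by_cases hp : p ∈ f
  · by_cases hq : q ∈ f
    · obtain ⟨y, x, hy, hx, hyx, rfl⟩ := exists_triple_of_mem (mem_bdry.1 hf).1 hp
      simp only [Finset.mem_insert, Finset.mem_singleton, h.ne.symm, false_or] at hq
      rcases hq with rfl | rfl
      · exact .inr (.inr (.inr ⟨x, (h.extFaces_both hx hyx.symm).1 hf, rfl⟩))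
      · rw [Finset.pair_comm] at hf ⊢
        exact .inr (.inr (.inr ⟨y, (h.extFaces_both hy hyx).1 hf, rfl⟩))
    · rw [← Finset.insert_erase hp] at hf
      have h1 := (h.extFaces_left (by simp) (by simp [hq])).1 hf
      exact .inr (.inl ⟨_, h1.1, h1.2, by simp, by simp [hq], (Finset.insert_erase hp).symm⟩)
  · by_cases hq : q ∈ f
    · rw [← Finset.insert_erase hq, splitNode_symm] at hf
      have h1 := (h.symm.extFaces_left (by simp) (by simp [hp])).1 hf
      exact .inr (.inr (.inl ⟨_, h1.1, h1.2, by simp [hp], by simp, (Finset.insert_erase hq).symm⟩))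
    · exact .inl ⟨(h.extFaces_old hp hq hn).1 hf, hn, hp, hq⟩

lemma extEdges_both (h : IsSplit T n a b c A B p q) :
    {p, q} ∈ extEdges (splitNode T n c A B p q) := by
  have ha := h.mem_left_of_mem_path (List.mem_of_mem_head? h.path.head_eq)
  refine pair_mem_extEdges.2 ⟨h.ne, {p, q, a}, ?_, by simp, by simp⟩
  exact (h.extFaces_both (fun hh => h.left_notMem_left (hh ▸ ha))
    (fun hh => h.right_notMem_left (hh ▸ ha))).2 (.inl rfl)

/-- A boundary node on the path is an end, where the external face `pqu` supplies the edge. Off the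
path, all triangles at `u` are in `A`, and a boundary edge at `u` supplies the face. -/
lemma extEdges_left (h : IsSplit T n a b c A B p q) (hp : u ≠ p) (hq : u ≠ q) :
    {p, u} ∈ extEdges (splitNode T n c A B p q) ↔ u ∈ bdNodes (link T n) ∧ u ∈ nodes A := by
  rw [pair_mem_extEdges]
  constructor
  · rintro ⟨-, f, hf, hpf, huf⟩
    rcases h.mem_extFaces hf with h1 | ⟨g, h1, h2, h3, h4, rfl⟩ | ⟨g, h1, h2, h3, h4, rfl⟩ |
      ⟨x, hx, rfl⟩
    · exact (h1.2.2.1 hpf).elim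
    · have hug := Finset.mem_of_mem_insert_of_ne huf hp
      obtain ⟨-, t, ht, hgt⟩ := mem_edges.1 h2
      exact ⟨mem_bdNodes.2 ⟨g, h1, hug⟩, mem_nodes.2 ⟨t, ht, hgt hug⟩⟩
    · exact (h3 (Finset.mem_of_mem_insert_of_ne hpf h.ne)).elim
    · have hux : u = x := by simpa [hp, hq] using huf
      subst hux
      rcases hx with rfl | rfl
      · exact ⟨h.path.head_mem, h.mem_left_of_mem_path (List.mem_of_mem_head? h.path.head_eq)⟩
      · exact ⟨h.path.last_mem, h.mem_left_of_mem_path (List.mem_of_mem_getLast? h.path.last_eq)⟩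
  · rintro ⟨hb, hA⟩
    refine ⟨hp.symm, ?_⟩
    by_cases huc : u ∈ c
    · exact ⟨{p, q, u}, (h.extFaces_both hp hq).2 (h.path.interior u huc hb), by simp, by simp⟩
    · obtain ⟨g, hg, hug⟩ := mem_bdNodes.1 hb
      obtain ⟨hg2, t, ht, hgt⟩ := mem_edges.1 (bdEdges_subset_edges hg)
      have htA : t ∈ A := by
        refine (h.cut.mem_or_mem ht).resolve_right fun hB => huc ?_
        exact h.cut.nodes_inter.1 ⟨hA, mem_nodes.2 ⟨t, hB, hgt hug⟩⟩
      refine ⟨insert p g, (h.extFaces_left ?_ ?_).2 ⟨hg, mem_edges.2 ⟨hg2, t, htA, hgt⟩⟩,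
        by simp, by simp [hug]⟩
      · exact fun hh => (h.notMem_left htA).2.1 (hgt hh)
      · exact fun hh => (h.notMem_left htA).2.2 (hgt hh)

lemma extEdges_old (h : IsSplit T n a b c A B p q) (hup : u ≠ p) (huq : u ≠ q) (hun : u ≠ n)
    (hvp : v ≠ p) (hvq : v ≠ q) (hvn : v ≠ n) :
    {u, v} ∈ extEdges (splitNode T n c A B p q) ↔ {u, v} ∈ extEdges T := by
  rw [pair_mem_extEdges, pair_mem_extEdges]
  refine and_congr_right fun huv => ?_
  constructor
  · rintro ⟨f, hf, huf, hvf⟩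
    rcases h.mem_extFaces hf with h1 | ⟨g, h1, h2, h3, h4, rfl⟩ | ⟨g, h1, h2, h3, h4, rfl⟩ |
      ⟨x, hx, rfl⟩
    · exact ⟨f, h1.1, huf, hvf⟩
    · obtain ⟨-, t, ht, hgt⟩ := mem_edges.1 h2
      have hn : n ∉ g := fun hh => (h.notMem_left ht).1 (hgt hh)
      exact ⟨insert n g, (insert_mem_extFaces hn).2 h1,
        by simp [Finset.mem_of_mem_insert_of_ne huf hup],
        by simp [Finset.mem_of_mem_insert_of_ne hvf hvp]⟩
    · obtain ⟨-, t, ht, hgt⟩ := mem_edges.1 h2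
      have hn : n ∉ g := fun hh => (h.symm.notMem_left ht).1 (hgt hh)
      exact ⟨insert n g, (insert_mem_extFaces hn).2 h1,
        by simp [Finset.mem_of_mem_insert_of_ne huf huq],
        by simp [Finset.mem_of_mem_insert_of_ne hvf hvq]⟩
    · simp only [Finset.mem_insert, Finset.mem_singleton, hup, huq, false_or, hvp, hvq] at huf hvf
      exact (huv (huf.trans hvf.symm)).elim
  · rintro ⟨f, hf, huf, hvf⟩
    obtain ⟨t, ht, hft⟩ := cnt_pos.1 (by rw [(mem_bdry.1 hf).2]; omega : 0 < cnt T f)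
    have hpf : p ∉ f := fun hh => (h.notMem_old ht).1 (hft hh)
    have hqf : q ∉ f := fun hh => (h.notMem_old ht).2 (hft hh)
    by_cases hn : n ∈ f
    · have hg : f.erase n ∈ bdEdges (link T n) := by
        rw [← insert_mem_extFaces (by simp), Finset.insert_erase hn]
        exact hf
      obtain ⟨hg2, s, hs, hgs⟩ := mem_edges.1 (bdEdges_subset_edges hg)
      have h1 : p ∉ f.erase n := fun hh => hpf (Finset.mem_of_mem_erase hh)
      have h2 : q ∉ f.erase n := fun hh => hqf (Finset.mem_of_mem_erase hh)
      rcases h.cut.mem_or_mem hs with hs | hs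
      · exact ⟨_, (h.extFaces_left h1 h2).2 ⟨hg, mem_edges.2 ⟨hg2, s, hs, hgs⟩⟩,
          by simp [huf, hun], by simp [hvf, hvn]⟩
      · rw [splitNode_symm]
        exact ⟨_, (h.symm.extFaces_left h2 h1).2 ⟨hg, mem_edges.2 ⟨hg2, s, hs, hgs⟩⟩,
          by simp [huf, hun], by simp [hvf, hvn]⟩
    · exact ⟨f, (h.extFaces_old hpf hqf hn).2 hf, huf, hvf⟩

lemma adj_old (h : IsSplit T n a b c A B p q) (hup : u ≠ p) (huq : u ≠ q) (hun : u ≠ n)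
    (hvp : v ≠ p) (hvq : v ≠ q) (hvn : v ≠ n) :
    Adj (splitNode T n c A B p q) u v ↔ Adj T u v := by
  unfold Adj
  refine and_congr_right fun huv => ?_
  constructor
  · rintro ⟨t, ht, hut, hvt⟩
    rcases mem_splitNode.1 ht with ht | ⟨f, hf, rfl⟩ | ⟨f, hf, rfl⟩ | ⟨e, he, rfl⟩
    · exact ⟨t, ht.1, hut, hvt⟩
    · exact ⟨_, (h.of_mem_left hf).2, by simp [Finset.mem_of_mem_insert_of_ne hut hup],
        by simp [Finset.mem_of_mem_insert_of_ne hvt hvp]⟩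
    · exact ⟨_, (h.symm.of_mem_left hf).2, by simp [Finset.mem_of_mem_insert_of_ne hut huq],
        by simp [Finset.mem_of_mem_insert_of_ne hvt hvq]⟩
    · have h1 := Finset.mem_of_mem_insert_of_ne (Finset.mem_of_mem_insert_of_ne hut hup) huq
      have h2 := Finset.mem_of_mem_insert_of_ne (Finset.mem_of_mem_insert_of_ne hvt hvp) hvq
      obtain ⟨-, f, hf, hef⟩ := mem_edges.1 ((h.cut.edges_inter e).2 he).1
      exact ⟨_, (h.of_mem_left hf).2, by simp [hef h1], by simp [hef h2]⟩
  · rintro ⟨t, ht, hut, hvt⟩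
    by_cases hn : n ∈ t
    · rcases h.erase_mem ht hn with h1 | h1
      · exact ⟨_, mem₂ h1, by simp [hut, hun], by simp [hvt, hvn]⟩
      · exact ⟨_, mem₃ h1, by simp [hut, hun], by simp [hvt, hvn]⟩
    · exact ⟨t, mem₁ ht hn, hut, hvt⟩

lemma adj_left (h : IsSplit T n a b c A B p q) (hup : u ≠ p) (huq : u ≠ q) :
    Adj (splitNode T n c A B p q) p u ↔ u ∈ nodes A := by
  unfold Adj
  constructor
  · rintro ⟨-, t, ht, hpt, hut⟩
    rcases mem_splitNode.1 ht with ht | ⟨f, hf, rfl⟩ | ⟨f, hf, rfl⟩ | ⟨e, he, rfl⟩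
    · exact ((h.notMem_old ht.1).1 hpt).elim
    · exact mem_nodes.2 ⟨f, hf, Finset.mem_of_mem_insert_of_ne hut hup⟩
    · exact ((h.symm.notMem_left hf).2.2 (Finset.mem_of_mem_insert_of_ne hpt h.ne)).elim
    · exact h.mem_left_of_mem_edge he
        (Finset.mem_of_mem_insert_of_ne (Finset.mem_of_mem_insert_of_ne hut hup) huq)
  · intro hu
    obtain ⟨f, hf, huf⟩ := mem_nodes.1 hu
    exact ⟨hup.symm, _, mem₂ hf, by simp, by simp [huf]⟩

end IsSplit

end

end BallSplit

namespace BallSplit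

variable {V : Type*} [DecidableEq V]

/-! ### Types of internal nodes under a split -/

section
variable {T A B : Finset (Finset V)} {n p q a b u v w x y : V} {c : List V} {e f g t : Finset V}

/-- The node `x` lies in a face the other two nodes of which form an external edge. -/
def HasExtFace (T : Finset (Finset V)) (x : V) : Prop :=
  ∃ u w, {u, w} ∈ extEdges T ∧ x ≠ u ∧ x ≠ w ∧ ∃ t ∈ T, x ∈ t ∧ u ∈ t ∧ w ∈ t

lemma hasExtFace_iff :
    (∃ e ∈ extEdges T, insert x e ∈ simplices 3 T) ↔ HasExtFace T x := by
  constructor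
  · rintro ⟨e, he, hx⟩
    obtain ⟨u, w, huw, rfl⟩ := Finset.card_eq_two.1 (mem_simplices.1 he).1
    obtain ⟨h3, t, ht, h⟩ := mem_simplices.1 hx
    have hxe : x ∉ ({u, w} : Finset V) := fun hh => by
      rw [Finset.insert_eq_of_mem hh, Finset.card_pair huw] at h3
      omega
    simp only [Finset.mem_insert, Finset.mem_singleton, not_or] at hxe
    exact ⟨u, w, he, hxe.1, hxe.2, t, ht, h (by simp), h (by simp), h (by simp)⟩
  · rintro ⟨u, w, he, hu, hw, t, ht, hxt, hut, hwt⟩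
    refine ⟨_, he, mem_simplices.2 ⟨?_, t, ht, ?_⟩⟩
    · exact Finset.card_eq_three.2 ⟨x, u, w, hu, hw, (pair_mem_extEdges.1 he).1, rfl⟩
    · simp [Finset.insert_subset_iff, hxt, hut, hwt]

lemma mem_extNodes : x ∈ extNodes T ↔ ∃ f ∈ extFaces T, x ∈ f := mem_nodes

lemma mem_intNodes : x ∈ intNodes T ↔ x ∈ nodes T ∧ ∀ f ∈ extFaces T, x ∉ f := by
  simp [intNodes, mem_extNodes]

/-- An external face does not contain the internal node `x`, so the one in the removable tetrahedron
is the face opposite to `x`. -/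
lemma IsC0.exists_face (h4 : ∀ t ∈ T, t.card = 4) (h : IsC0 T x) :
    ∃ f ∈ extFaces T, x ∉ f ∧ insert x f ∈ T := by
  obtain ⟨⟨hx, -⟩, t, ⟨ht, -, h2⟩, hxt⟩ := h
  obtain ⟨f, hf⟩ := Finset.card_pos.1 (by rw [h2]; omega)
  simp only [Finset.mem_inter, Finset.mem_powersetCard] at hf
  have hxf := (mem_intNodes.1 hx).2 f hf.2
  refine ⟨f, hf.2, hxf, ?_⟩
  rwa [Finset.eq_of_subset_of_card_le (Finset.insert_subset hxt hf.1.1)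
    (by rw [Finset.card_insert_of_notMem hxf, hf.1.2, h4 t ht])]

lemma hasExtFace_of_face (hf : f ∈ extFaces T) (hx : x ∉ f) (ht : insert x f ∈ T) :
    HasExtFace T x := by
  obtain ⟨u, v, w, huv, -, -, rfl⟩ := Finset.card_eq_three.1 (mem_bdry.1 hf).1
  simp only [Finset.mem_insert, Finset.mem_singleton, not_or] at hx
  exact ⟨u, v, pair_mem_extEdges.2 ⟨huv, _, hf, by simp, by simp⟩, hx.1, hx.2.1, _, ht,
    by simp, by simp, by simp⟩

/-- Type C0 also gives a face over an external edge, namely one at an edge of the opposite external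
face. So type C2 is the absence of such a face, a condition that can be followed through splits. -/
lemma isC2_iff (h4 : ∀ t ∈ T, t.card = 4) : IsC2 T x ↔ DepthOne T x ∧ ¬ HasExtFace T x := by
  unfold IsC2 IsC1
  rw [hasExtFace_iff]
  constructor
  · tauto
  · rintro ⟨h1, h2⟩
    refine ⟨h1, fun h0 => h2 ?_, by tauto⟩
    obtain ⟨f, hf, hx, ht⟩ := h0.exists_face h4
    exact hasExtFace_of_face hf hx ht

lemma isC0_or_isC1 (h1 : DepthOne T x) (h2 : HasExtFace T x) : IsC0 T x ∨ IsC1 T x := by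
  unfold IsC1
  rw [hasExtFace_iff]
  tauto

lemma mem_extNodes_of_isDisk (h : IsDisk (link T v)) : v ∈ extNodes T := by
  obtain ⟨e, he⟩ := h.bdry_nonempty
  obtain ⟨-, s, hs, hes⟩ := mem_edges.1 (bdEdges_subset_edges he)
  have hve : v ∉ e := fun hh => (mem_link.1 hs).1 (hes hh)
  exact mem_extNodes.2 ⟨_, (insert_mem_extFaces hve).2 he, by simp⟩

namespace IsSplit

lemma ne_of_mem_intNodes (h : IsSplit T n a b c A B p q) (hx : x ∈ intNodes T) :
    x ≠ n ∧ x ≠ p ∧ x ≠ q := by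
  refine ⟨?_, fun hh => h.left_notMem (hh ▸ (mem_intNodes.1 hx).1),
    fun hh => h.right_notMem (hh ▸ (mem_intNodes.1 hx).1)⟩
  rintro rfl
  exact (Finset.mem_sdiff.1 hx).2 (mem_extNodes_of_isDisk h.disk)

lemma notMem_bdNodes (hx : x ∈ intNodes T) : x ∉ bdNodes (link T n) := fun hh => by
  obtain ⟨-, f, hf, -, hxf⟩ := pair_mem_extEdges.1 (pair_mem_extEdges_iff_bdNodes.2 hh)
  exact (mem_intNodes.1 hx).2 f hf hxf

lemma mem_intNodes_split (h : IsSplit T n a b c A B p q) (hx : x ∈ intNodes T) :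
    x ∈ intNodes (splitNode T n c A B p q) := by
  obtain ⟨hn, hp, hq⟩ := h.ne_of_mem_intNodes hx
  have hb := notMem_bdNodes (n := n) hx
  refine mem_intNodes.2 ⟨h.nodes_subset (mem_intNodes.1 hx).1 hn, fun f hf hxf => ?_⟩
  rcases h.mem_extFaces hf with h1 | ⟨g, h1, h2, h3, h4, rfl⟩ | ⟨g, h1, h2, h3, h4, rfl⟩ |
    ⟨y, hy, rfl⟩
  · exact (mem_intNodes.1 hx).2 f h1.1 hxf
  · exact hb (mem_bdNodes.2 ⟨g, h1, Finset.mem_of_mem_insert_of_ne hxf hp⟩)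
  · exact hb (mem_bdNodes.2 ⟨g, h1, Finset.mem_of_mem_insert_of_ne hxf hq⟩)
  · have hxy : x = y := by simpa [hp, hq] using hxf
    subst hxy
    rcases hy with rfl | rfl
    · exact hb h.path.head_mem
    · exact hb h.path.last_mem

/-- In the triangle of the hemisphere that contains `x` and `w`, the node `n` is replaced by `p` or
`q`. The edge from this new node to `w` is external because `w` is on the boundary of the
hemisphere. -/
lemma hasExtFace_aux (h : IsSplit T n a b c A B p q) (hx : x ∈ intNodes T)
    (hw : {n, w} ∈ extEdges T) (hxw : x ≠ w) (ht : t ∈ T) (hxt : x ∈ t) (hnt : n ∈ t)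
    (hwt : w ∈ t) : HasExtFace (splitNode T n c A B p q) x := by
  obtain ⟨hn, hp, hq⟩ := h.ne_of_mem_intNodes hx
  have hwn : w ≠ n := (pair_mem_extEdges.1 hw).1.symm
  have hwp : w ≠ p := fun hh => (h.notMem_old ht).1 (hh ▸ hwt)
  have hwq : w ≠ q := fun hh => (h.notMem_old ht).2 (hh ▸ hwt)
  have hxe : x ∈ t.erase n := by simp [hn, hxt]
  have hwe : w ∈ t.erase n := by simp [hwn, hwt]
  rw [pair_mem_extEdges_iff_bdNodes] at hw
  rcases h.erase_mem ht hnt with h1 | h1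
  · exact ⟨p, w, (h.extEdges_left hwp hwq).2 ⟨hw, mem_nodes.2 ⟨_, h1, hwe⟩⟩, hp, hxw, _, mem₂ h1,
      by simp [hxe], by simp, by simp [hwe]⟩
  · refine ⟨q, w, ?_, hq, hxw, _, mem₃ h1, by simp [hxe], by simp, by simp [hwe]⟩
    rw [splitNode_symm]
    exact (h.symm.extEdges_left hwq hwp).2 ⟨hw, mem_nodes.2 ⟨_, h1, hwe⟩⟩

lemma hasExtFace_split (h : IsSplit T n a b c A B p q) (hx : x ∈ intNodes T)
    (he : HasExtFace T x) : HasExtFace (splitNode T n c A B p q) x := by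
  obtain ⟨hn, hp, hq⟩ := h.ne_of_mem_intNodes hx
  obtain ⟨u, w, huw, hxu, hxw, t, ht, hxt, hut, hwt⟩ := he
  by_cases hun : u = n
  · subst hun
    exact h.hasExtFace_aux hx huw hxw ht hxt hut hwt
  by_cases hwn : w = n
  · subst hwn
    rw [Finset.pair_comm] at huw
    exact h.hasExtFace_aux hx huw hxu ht hxt hwt hut
  have hup : u ≠ p := fun hh => (h.notMem_old ht).1 (hh ▸ hut)
  have huq : u ≠ q := fun hh => (h.notMem_old ht).2 (hh ▸ hut)
  have hwp : w ≠ p := fun hh => (h.notMem_old ht).1 (hh ▸ hwt)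
  have hwq : w ≠ q := fun hh => (h.notMem_old ht).2 (hh ▸ hwt)
  refine ⟨u, w, (h.extEdges_old hup huq hun hwp hwq hwn).2 huw, hxu, hxw, ?_⟩
  by_cases hnt : n ∈ t
  · rcases h.erase_mem ht hnt with h1 | h1
    · exact ⟨_, mem₂ h1, by simp [hn, hxt], by simp [hun, hut], by simp [hwn, hwt]⟩
    · exact ⟨_, mem₃ h1, by simp [hn, hxt], by simp [hun, hut], by simp [hwn, hwt]⟩
  · exact ⟨t, mem₁ ht hnt, hxt, hut, hwt⟩

lemma hasExtFace_of_left (h : IsSplit T n a b c A B p q) (hx : x ∈ intNodes T) (hxc : x ∉ c)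
    (hw : {p, w} ∈ extEdges (splitNode T n c A B p q)) (hxw : x ≠ w)
    (ht : t ∈ splitNode T n c A B p q) (hxt : x ∈ t) (hpt : p ∈ t) (hwt : w ∈ t) :
    HasExtFace T x := by
  obtain ⟨hn, hp, hq⟩ := h.ne_of_mem_intNodes hx
  have hwp : w ≠ p := (pair_mem_extEdges.1 hw).1.symm
  rcases mem_splitNode.1 ht with ht | ⟨f, hf, rfl⟩ | ⟨f, hf, rfl⟩ | ⟨e, he, rfl⟩
  · exact ((h.notMem_old ht.1).1 hpt).elim
  · have hxf := Finset.mem_of_mem_insert_of_ne hxt hp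
    have hwf := Finset.mem_of_mem_insert_of_ne hwt hwp
    have hwq : w ≠ q := fun hh => (h.notMem_left hf).2.2 (hh ▸ hwf)
    have hb := ((h.extEdges_left hwp hwq).1 hw).1
    exact ⟨n, w, pair_mem_extEdges_iff_bdNodes.2 hb, hn, hxw, _, (h.of_mem_left hf).2,
      by simp [hxf], by simp, by simp [hwf]⟩
  · exact ((h.symm.notMem_left hf).2.2 (Finset.mem_of_mem_insert_of_ne hpt h.ne)).elim
  · exact (hxc (subset_of_mem_pathEdges he (Finset.mem_of_mem_insert_of_ne
      (Finset.mem_of_mem_insert_of_ne hxt hp) hq))).elim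

/-- Off the path, `x` is in no tetrahedron at both new nodes. In the others, putting `n` back for
`p` or `q` turns external edges into external edges. -/
lemma hasExtFace_of_split (h : IsSplit T n a b c A B p q) (hx : x ∈ intNodes T) (hxc : x ∉ c)
    (he : HasExtFace (splitNode T n c A B p q) x) : HasExtFace T x := by
  obtain ⟨hn, hp, hq⟩ := h.ne_of_mem_intNodes hx
  obtain ⟨u, w, huw, hxu, hxw, t, ht, hxt, hut, hwt⟩ := he
  by_cases hup : u = p
  · subst hup
    exact h.hasExtFace_of_left hx hxc huw hxw ht hxt hut hwt
  by_cases hwp : w = p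
  · subst hwp
    rw [Finset.pair_comm] at huw
    exact h.hasExtFace_of_left hx hxc huw hxu ht hxt hwt hut
  by_cases huq : u = q
  · subst huq
    rw [splitNode_symm] at ht huw
    exact h.symm.hasExtFace_of_left hx hxc huw hxw ht hxt hut hwt
  by_cases hwq : w = q
  · subst hwq
    rw [Finset.pair_comm] at huw
    rw [splitNode_symm] at ht huw
    exact h.symm.hasExtFace_of_left hx hxc huw hxu ht hxt hwt hut
  have hun : u ≠ n := fun hh => h.node_notMem_split (mem_nodes.2 ⟨t, ht, hh ▸ hut⟩)
  have hwn : w ≠ n := fun hh => h.node_notMem_split (mem_nodes.2 ⟨t, ht, hh ▸ hwt⟩)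
  refine ⟨u, w, (h.extEdges_old hup huq hun hwp hwq hwn).1 huw, hxu, hxw, ?_⟩
  rcases mem_splitNode.1 ht with ht | ⟨f, hf, rfl⟩ | ⟨f, hf, rfl⟩ | ⟨e, he, rfl⟩
  · exact ⟨t, ht.1, hxt, hut, hwt⟩
  · exact ⟨_, (h.of_mem_left hf).2, by simp [Finset.mem_of_mem_insert_of_ne hxt hp],
      by simp [Finset.mem_of_mem_insert_of_ne hut hup],
      by simp [Finset.mem_of_mem_insert_of_ne hwt hwp]⟩
  · exact ⟨_, (h.symm.of_mem_left hf).2, by simp [Finset.mem_of_mem_insert_of_ne hxt hq],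
      by simp [Finset.mem_of_mem_insert_of_ne hut huq],
      by simp [Finset.mem_of_mem_insert_of_ne hwt hwq]⟩
  · exact (hxc (subset_of_mem_pathEdges he (Finset.mem_of_mem_insert_of_ne
      (Finset.mem_of_mem_insert_of_ne hxt hp) hq))).elim

/-- Each path edge at `x` gives a tetrahedron that contains `x` and the external edge `pq`. -/
lemma hasExtFace_of_mem_path (h : IsSplit T n a b c A B p q) (hx : x ∈ intNodes T) (hxc : x ∈ c) :
    HasExtFace (splitNode T n c A B p q) x := by
  obtain ⟨hn, hp, hq⟩ := h.ne_of_mem_intNodes hx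
  obtain ⟨e, he, hxe⟩ := exists_pathEdge_of_mem h.path.two_le_length hxc
  exact ⟨p, q, h.extEdges_both, hp, hq, _, mem₄ he, by simp [hxe], by simp, by simp⟩

lemma face_aux (h : IsSplit T n a b c A B p q) (hx : x ∈ intNodes T)
    (hg : g ∈ bdEdges (link T n)) (hpg : p ∉ g) (hqg : q ∉ g)
    (ht : insert x (insert p g) ∈ splitNode T n c A B p q) (hxg : x ∉ g) :
    HasExtFace T x := by
  obtain ⟨hn, hp, hq⟩ := h.ne_of_mem_intNodes hx
  have hng : n ∉ g := fun hh => by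
    obtain ⟨-, s, hs, hgs⟩ := mem_edges.1 (bdEdges_subset_edges hg)
    exact (mem_link.1 hs).1 (hgs hh)
  rcases mem_splitNode.1 ht with ht | ⟨f, hf, h1⟩ | ⟨f, hf, h1⟩ | ⟨e, he, h1⟩
  · exact ((h.notMem_old ht.1).1 (by simp)).elim
  · have h2 : f = insert x g := by
      rw [← Finset.erase_insert (h.notMem_left hf).2.1, h1, Finset.insert_comm,
        Finset.erase_insert (by simp [hpg, hp.symm])]
    refine hasExtFace_of_face ((insert_mem_extFaces hng).2 hg) (by simp [hn, hxg]) ?_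
    rw [Finset.insert_comm, ← h2]
    exact (h.of_mem_left hf).2
  · have h2 : q ∈ insert x (insert p g) := h1 ▸ (by simp)
    simp [hq.symm, h.ne.symm, hqg] at h2
  · have h2 : q ∈ insert x (insert p g) := h1 ▸ (by simp)
    simp [hq.symm, h.ne.symm, hqg] at h2

/-- An external face opposite to `x` after the split would have given a face over an external edge
at `x` before. This ensures that promotion leads from C2 to C1 and not directly to C0. -/
lemma not_isC0_split (h : IsSplit T n a b c A B p q) (hx : x ∈ intNodes T)
    (he : ¬ HasExtFace T x) : ¬ IsC0 (splitNode T n c A B p q) x := by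
  obtain ⟨hn, hp, hq⟩ := h.ne_of_mem_intNodes hx
  intro h0
  obtain ⟨f, hf, hxf, ht⟩ := h0.exists_face h.card_split
  apply he
  rcases h.mem_extFaces hf with h1 | ⟨g, h1, h2, h3, h4, rfl⟩ | ⟨g, h1, h2, h3, h4, rfl⟩ |
    ⟨y, hy, rfl⟩
  · refine hasExtFace_of_face h1.1 hxf ?_
    rcases mem_splitNode.1 ht with ht | ⟨f', hf', h5⟩ | ⟨f', hf', h5⟩ | ⟨e, he, h5⟩
    · exact ht.1
    · have : p ∈ insert x f := h5 ▸ (by simp)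
      simp [hp.symm, h1.2.2.1] at this
    · have : q ∈ insert x f := h5 ▸ (by simp)
      simp [hq.symm, h1.2.2.2] at this
    · have : p ∈ insert x f := h5 ▸ (by simp)
      simp [hp.symm, h1.2.2.1] at this
  · exact h.face_aux hx h1 h3 h4 ht (fun hh => hxf (by simp [hh]))
  · rw [splitNode_symm] at ht
    exact h.symm.face_aux hx h1 h4 h3 ht (fun hh => hxf (by simp [hh]))
  · have hyb : y ∈ bdNodes (link T n) := by
      rcases hy with rfl | rfl
      · exact h.path.head_mem
      · exact h.path.last_mem
    have hxy : x ≠ y := fun hh => hxf (by simp [hh])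
    rcases mem_splitNode.1 ht with ht | ⟨f', hf', h5⟩ | ⟨f', hf', h5⟩ | ⟨e, he, h5⟩
    · exact ((h.notMem_old ht.1).1 (by simp)).elim
    · have : q ∈ insert p f' := h5 ▸ (by simp)
      simp [h.ne.symm, (h.notMem_left hf').2.2] at this
    · have : p ∈ insert q f' := h5 ▸ (by simp)
      simp [h.ne, (h.symm.notMem_left hf').2.2] at this
    · have hyn : y ≠ n := (pair_mem_extEdges.1 (pair_mem_extEdges_iff_bdNodes.2 hyb)).1.symm
      have hyp : y ≠ p := by
        have := mem_bdry.1 hf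
        rintro rfl
        have h6 : ({y, q, y} : Finset V) = {q, y} := by ext; simp
        rw [h6] at this
        have := Finset.card_le_two (a := q) (b := y)
        omega
      have hyq : y ≠ q := by
        have := mem_bdry.1 hf
        rintro rfl
        have h6 : ({p, y, y} : Finset V) = {p, y} := by ext; simp
        rw [h6] at this
        have := Finset.card_le_two (a := p) (b := y)
        omega
      have hxe : x ∈ insert p (insert q e) := h5 ▸ (by simp)
      have hye : y ∈ insert p (insert q e) := h5 ▸ (by simp)
      have hxe := Finset.mem_of_mem_insert_of_ne (Finset.mem_of_mem_insert_of_ne hxe hp) hq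
      have hye := Finset.mem_of_mem_insert_of_ne (Finset.mem_of_mem_insert_of_ne hye hyp) hyq
      obtain ⟨-, s, hs, hes⟩ := mem_edges.1 (h.path.edge_mem e he).1
      exact ⟨n, y, pair_mem_extEdges_iff_bdNodes.2 hyb, hn, hxy, _, (mem_link.1 hs).2,
        by simp [hes hxe], by simp, by simp [hes hye]⟩

end IsSplit

end

end BallSplit

namespace BallSplit

variable {V : Type*} [DecidableEq V]

/-! ### Extended paths and shortest paths -/

section Paths
variable {K A B : Finset (Finset V)} {a b u v w x y : V} {c l r : List V} {e : Finset V}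

lemma mem_pathEdges_prolong (ha : c.head? = some a) (hb : c.getLast? = some b)
    (hl : l = [] ∨ ∃ w, l = [w]) (hr : r = [] ∨ ∃ w, r = [w]) :
    e ∈ pathEdges (l ++ c ++ r) ↔
      (∃ w ∈ l, e = {w, a}) ∨ e ∈ pathEdges c ∨ ∃ w ∈ r, e = {b, w} := by
  have h1 : ∀ e, e ∈ pathEdges (l ++ c) ↔ (∃ w ∈ l, e = {w, a}) ∨ e ∈ pathEdges c := by
    intro e
    rcases hl with rfl | ⟨w, rfl⟩
    · simp
    · rw [List.singleton_append, pathEdges_cons ha]; simp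
  rcases hr with rfl | ⟨w, rfl⟩
  · simp [h1]
  · have h2 : (l ++ c).getLast? = some b := by
      rw [List.getLast?_append, hb]; rfl
    rw [pathEdges_append h2 (y := w) rfl]
    simp [h1, or_assoc]

lemma pathEdges_take_subset {d : List V} {i : ℕ} (he : e ∈ pathEdges (d.take i)) :
    e ∈ pathEdges d := by
  rw [mem_pathEdges_iff] at he ⊢
  obtain ⟨j, hj, rfl⟩ := he
  simp only [List.length_take] at hj
  exact ⟨j, by omega, by simp⟩

lemma pathEdges_drop_subset {d : List V} {i : ℕ} (he : e ∈ pathEdges (d.drop i)) :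
    e ∈ pathEdges d := by
  rw [mem_pathEdges_iff] at he ⊢
  obtain ⟨j, hj, rfl⟩ := he
  simp only [List.length_drop] at hj
  exact ⟨i + j, by omega, by simp [add_assoc]⟩

/-- A shortest splitting path has no shortcut by an edge between two inner nodes. -/
lemma shortcut (hc : IsSplittingPath K a b c)
    (hmin : ∀ d, IsSplittingPath K a b d → c.length ≤ d.length) (hu : u ∈ c) (hv : v ∈ c)
    (hub : u ∉ bdNodes K) (huv : {u, v} ∈ edges K) (hlt : c.idxOf u < c.idxOf v) :
    c.idxOf v = c.idxOf u + 1 ∧ {u, v} ∈ pathEdges c := by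
  have hvl : c.idxOf v < c.length := List.idxOf_lt_length_iff.2 hv
  have hul : c.idxOf u < c.length := List.idxOf_lt_length_iff.2 hu
  have hlast : (c.take (c.idxOf u + 1)).getLast? = some u := by
    rw [List.getLast?_take]
    simp [List.getElem?_eq_getElem hul]
  have hhead : (c.drop (c.idxOf v)).head? = some v := by
    rw [List.head?_drop, List.getElem?_eq_getElem hvl, List.getElem_idxOf]
  have hsub : (c.take (c.idxOf u + 1) ++ c.drop (c.idxOf v)).Sublist c := by
    conv_rhs => rw [← List.take_append_drop (c.idxOf u + 1) c]
    refine List.Sublist.append_left ?_ _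
    rw [← Nat.add_sub_cancel' (Nat.succ_le_of_lt hlt), ← List.drop_drop]
    exact List.drop_sublist _ _
  -- The stretch between `u` and `v` is replaced by the edge `uv`, which is not a boundary edge
  -- because `u` is not a boundary node.
  have hpath : IsSplittingPath K a b (c.take (c.idxOf u + 1) ++ c.drop (c.idxOf v)) := by
    refine ⟨hc.nodup.sublist hsub, ?_, ?_, hc.ends_ne, hc.head_mem, hc.last_mem,
      fun w hw => hc.interior w (hsub.subset hw), ?_⟩
    · rw [List.head?_append, List.head?_take, if_neg (by omega), hc.head_eq]
      rfl
    · rw [List.getLast?_append, List.getLast?_drop, if_neg (by omega), hc.last_eq]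
      rfl
    · intro e he
      rw [pathEdges_append hlast hhead] at he
      simp only [List.mem_append, List.mem_cons] at he
      rcases he with he | rfl | he
      · exact hc.edge_mem e (pathEdges_take_subset he)
      · exact ⟨huv, fun hh => hub (mem_bdNodes.2 ⟨_, hh, by simp⟩)⟩
      · exact hc.edge_mem e (pathEdges_drop_subset he)
  have h1 := hmin _ hpath
  rw [List.length_append, List.length_take, List.length_drop] at h1
  have h2 : c.idxOf v = c.idxOf u + 1 := by omega
  refine ⟨h2, ?_⟩
  have key : ∀ d : List V, ∀ i j (hi : i < d.length) (hj : j < d.length), j = i + 1 → d[i] = u →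
      d[j] = v → {u, v} ∈ pathEdges d := by
    rintro d i j hi hj rfl rfl rfl
    exact mem_pathEdges_iff.2 ⟨i, hj, rfl⟩
  exact key c _ _ hul hvl h2 (List.getElem_idxOf hul) (List.getElem_idxOf hvl)

lemma shortest (hc : IsSplittingPath K a b c)
    (hmin : ∀ d, IsSplittingPath K a b d → c.length ≤ d.length) (hu : u ∈ c) (hv : v ∈ c)
    (hub : u ∉ bdNodes K) (hvb : v ∉ bdNodes K) (huv : {u, v} ∈ edges K) :
    (c.idxOf u = c.idxOf v + 1 ∨ c.idxOf v = c.idxOf u + 1) ∧ {u, v} ∈ pathEdges c := by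
  rcases lt_trichotomy (c.idxOf u) (c.idxOf v) with h | h | h
  · have := shortcut hc hmin hu hv hub huv h
    exact ⟨.inr this.1, this.2⟩
  · exact (ne_of_pair_mem_edges huv ((List.idxOf_inj hu).1 h)).elim
  · rw [Finset.pair_comm] at huv ⊢
    have := shortcut hc hmin hv hu hvb huv h
    exact ⟨.inl this.1, this.2⟩

lemma IsCutAlong.mem_bdNodes_left (h : IsCutAlong K a b c A B) :
    u ∈ bdNodes A ↔ u ∈ nodes A ∧ (u ∈ bdNodes K ∨ u ∈ c) := by
  constructor
  · intro hu
    refine ⟨bdNodes_subset_nodes hu, ?_⟩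
    obtain ⟨e, he, hue⟩ := mem_bdNodes.1 hu
    rcases (h.mem_bdEdges_left.1 he).2 with h1 | h1
    · exact .inl (mem_bdNodes.2 ⟨e, h1, hue⟩)
    · exact .inr (subset_of_mem_pathEdges h1 hue)
  · rintro ⟨hA, hu⟩
    by_cases huc : u ∈ c
    · obtain ⟨e, he, hue⟩ := exists_pathEdge_of_mem h.path.two_le_length huc
      exact mem_bdNodes.2 ⟨e, h.mem_bdEdges_left.2 ⟨((h.edges_inter e).2 he).1, .inr he⟩, hue⟩
    · obtain ⟨e, he, hue⟩ := mem_bdNodes.1 (hu.resolve_right huc)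
      obtain ⟨he2, t, ht, het⟩ := mem_edges.1 (bdEdges_subset_edges he)
      have htA : t ∈ A := by
        refine (h.mem_or_mem ht).resolve_right fun hB => huc ?_
        exact h.nodes_inter.1 ⟨hA, mem_nodes.2 ⟨t, hB, het hue⟩⟩
      exact mem_bdNodes.2 ⟨e, h.mem_bdEdges_left.2 ⟨mem_edges.2 ⟨he2, t, htA, het⟩, .inl he⟩, hue⟩

lemma pair_mem_edges_link : {u, w} ∈ edges (link K v) ↔
    u ≠ w ∧ u ≠ v ∧ w ≠ v ∧ ∃ t ∈ K, v ∈ t ∧ u ∈ t ∧ w ∈ t := by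
  rw [pair_mem_edges]
  refine and_congr_right fun huw => ?_
  constructor
  · rintro ⟨t, ht, hu, hw⟩
    obtain ⟨h1, h2⟩ := mem_link.1 ht
    exact ⟨fun hh => h1 (hh ▸ hu), fun hh => h1 (hh ▸ hw), _, h2, by simp, by simp [hu],
      by simp [hw]⟩
  · rintro ⟨hu, hw, t, ht, h1, h2, h3⟩
    exact ⟨_, erase_mem_link ht h1, by simp [hu, h2], by simp [hw, h3]⟩

end Paths

/-! ### Words of the binary tree -/

section Words

/-- Both words branch off from the way between the root and `S`. If one were a proper ancestor of
the other, it would lie on this way itself, where the other branch is taken. This keeps the two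
extended ends of a path apart. -/
lemma suffix_sibling {S W S₁ S₂ W₁ W₂ : Word} {d d' e e' : Side} (hd : d ≠ d') (he : e ≠ e')
    (h1 : d' :: W₁ <:+ S) (h2 : e' :: W₂ <:+ S) (hS₁ : S₁ = d :: W₁) (hS₂ : S₂ = e :: W₂)
    (h3 : S₁ <:+ W) (h4 : S₂ <:+ W) : S₁ = S₂ := by
  have key : ∀ {d d' e e' : Side} {W₁ W₂ : Word}, d ≠ d' → d' :: W₁ <:+ S → e' :: W₂ <:+ S →
      d :: W₁ <:+ e :: W₂ → d :: W₁ = e :: W₂ := by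
    intro d d' e e' W₁ W₂ hd h1 h2 h5
    rcases List.suffix_cons_iff.1 h5 with h6 | h6
    · exact h6
    · have h7 : d :: W₁ <:+ S := (h6.trans (List.suffix_cons e' W₂)).trans h2
      have h8 := (List.suffix_of_suffix_length_le h7 h1 (by simp)).eq_of_length (by simp)
      exact (hd (List.cons.inj h8).1).elim
  subst hS₁ hS₂
  rcases List.suffix_or_suffix_of_suffix h3 h4 with h5 | h5
  · exact key hd h1 h2 h5
  · exact (key he h2 h1 h5).symm

lemma not_cons_suffix (d : Side) (S : Word) : ¬ d :: S <:+ S := fun h => by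
  have := h.length_le
  simp at this

end Words

/-! ### The invariant of a leaf -/

/-- The invariant of the algorithm for a single leaf `W` with node `v`, piece `K` and labels `lab`
in the state `s`. Here `I` is the hemisphere of the start and `φ` gives the original labels. -/
structure LeafInv (I : Finset (Finset V)) (φ : V → ℤ) (s : State V) (W : Word) (v : V)
    (K : Finset (Finset V)) (lab : V → Option Label) : Prop where
  node_notMem : v ∉ nodes I
  disk : IsDisk (link s.tets v)
  piece_disk : IsDisk K
  piece_link : K ⊆ link s.tets v
  piece_sub : K ⊆ I
  ext_iff : ∀ u ∈ nodes K, {v, u} ∈ extEdges s.tets ↔ u ∈ bdNodes I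
  bd : ∀ u ∈ nodes K, u ∈ bdNodes I → u ∈ bdNodes K
  label_none : ∀ u ∈ nodes K, lab u = none ↔ u ∉ bdNodes K
  label_original : ∀ u k, lab u = some (.original k) ↔ u ∈ bdNodes I ∧ φ u = k
  -- A label is the sibling of `W` or of an ancestor of `W`, so it names the other half of an
  -- earlier split.
  label_child : ∀ u S', lab u = some (.child S') →
    ∃ d d' S₀, d ≠ d' ∧ S' = d :: S₀ ∧ d' :: S₀ <:+ W
  label_adj : ∀ u ∈ nodes K, ∀ S', lab u = some (.child S') →
    ∃ W' ∈ s.leaves, S' <:+ W' ∧ {u, s.node W'} ∈ edges (link s.tets v)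
  -- The index is the position on the shortest path that created the label. It makes step 1
  -- possible: equal labels are adjacent only along the boundary, and never all around it.
  label_idx : ∀ S', ∃ idx : V → ℕ, ∀ u ∈ nodes K, ∀ w ∈ nodes K, lab u = some (.child S') →
    lab w = some (.child S') → (idx u = idx w → u = w) ∧
      ({u, w} ∈ edges K → (idx u = idx w + 1 ∨ idx w = idx u + 1) ∧ {u, w} ∈ bdEdges K)

namespace LeafInv

variable {I K A B : Finset (Finset V)} {φ : V → ℤ} {s s' : State V} {W S : Word}
  {lab : V → Option Label} {a b a' b' u v w x y : V} {c p l r : List V} {d d' : Side}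
  {e : Finset V}

lemma prolongs_cases (h : LeafInv I φ s W (s.node W) K (s.label W)) (hl : Prolongs s W u l) :
    (u ∈ bdNodes I ∧ l = []) ∨ (u ∉ bdNodes I ∧ ∃ S' W', s.label W u = some (.child S') ∧
      W' ∈ s.leaves ∧ S' <:+ W' ∧ {u, s.node W'} ∈ edges (link s.tets (s.node W)) ∧
      l = [s.node W']) := by
  rcases hl with ⟨k, hk, rfl⟩ | ⟨S', W', h1, h2⟩
  · exact .inl ⟨((h.label_original u k).1 hk).1, rfl⟩
  · refine .inr ⟨fun hu => ?_, S', W', h1, h2⟩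
    have := (h.label_original u _).2 ⟨hu, rfl⟩
    rw [h1] at this
    simp at this

lemma prolongs_eq (h : LeafInv I φ s W (s.node W) K (s.label W)) (hl : Prolongs s W u l) :
    l = [] ∨ ∃ w, l = [w] := by
  rcases h.prolongs_cases hl with h1 | ⟨-, S', W', -, -, -, -, rfl⟩
  · exact .inl h1.2
  · exact .inr ⟨_, rfl⟩

end LeafInv

/-- The extension `p` of the path `c` from `a` to `b` by `l` and `r`, where `l` and `r` avoid the
nodes of `I`. -/
structure IsExt (I : Finset (Finset V)) (a b : V) (c l r p : List V) : Prop where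
  head_eq : c.head? = some a
  last_eq : c.getLast? = some b
  left : l = [] ∨ ∃ w, l = [w]
  right : r = [] ∨ ∃ w, r = [w]
  left_notMem : ∀ w ∈ l, w ∉ nodes I
  right_notMem : ∀ w ∈ r, w ∉ nodes I
  eq : p = l ++ c ++ r

namespace IsExt
variable {I : Finset (Finset V)} {a b x : V} {c l r p : List V} {e : Finset V}

lemma mem_pathEdges (h : IsExt I a b c l r p) : e ∈ pathEdges p ↔
      (∃ w ∈ l, e = {w, a}) ∨ e ∈ pathEdges c ∨ ∃ w ∈ r, e = {b, w} := by
  rw [h.eq, mem_pathEdges_prolong h.head_eq h.last_eq h.left h.right]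

lemma mem_of_mem (h : IsExt I a b c l r p) (hx : x ∈ p) (hI : x ∈ nodes I) : x ∈ c := by
  rw [h.eq, List.mem_append, List.mem_append] at hx
  rcases hx with (hx | hx) | hx
  · exact (h.left_notMem x hx hI).elim
  · exact hx
  · exact (h.right_notMem x hx hI).elim

lemma subset (h : IsExt I a b c l r p) (hx : x ∈ c) : x ∈ p := by
  rw [h.eq]; simp [hx]

lemma edge_of_edge (h : IsExt I a b c l r p) (he : e ∈ pathEdges p) (hI : ∀ x ∈ e, x ∈ nodes I) :
    e ∈ pathEdges c := by
  rcases h.mem_pathEdges.1 he with ⟨w, hw, rfl⟩ | he | ⟨w, hw, rfl⟩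
  · exact (h.left_notMem w hw (hI w (by simp))).elim
  · exact he
  · exact (h.right_notMem w hw (hI w (by simp))).elim

end IsExt

/-- The cut of the hemisphere `H` along the extended path cuts the piece `K` along `c`. -/
lemma IsCutAlong.inter {I H K A B : Finset (Finset V)} {a b a' b' : V} {c l r p : List V}
    (h : IsCutAlong H a' b' p A B) (hx : IsExt I a b c l r p) (hK : IsSurface K) (hKH : K ⊆ H)
    (hKI : K ⊆ I) (hc : IsSplittingPath K a b c) : IsCutAlong K a b c (K ∩ A) (K ∩ B) where
  surface := hK
  path := hc
  union := by
    rw [← Finset.inter_union_distrib_left, h.union]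
    exact Finset.inter_eq_left.2 hKH
  disjoint := Finset.disjoint_of_subset_left Finset.inter_subset_right
    (Finset.disjoint_of_subset_right Finset.inter_subset_right h.disjoint)
  edges_inter e := by
    constructor
    · rintro ⟨h1, h2⟩
      refine hx.edge_of_edge ((h.edges_inter e).1 ⟨edges_mono Finset.inter_subset_right h1,
        edges_mono Finset.inter_subset_right h2⟩) fun z hz => ?_
      obtain ⟨-, t, ht, het⟩ := mem_edges.1 h1
      exact mem_nodes.2 ⟨t, hKI (Finset.mem_inter.1 ht).1, het hz⟩
    · intro he
      have hep : e ∈ pathEdges p := hx.mem_pathEdges.2 (.inr (.inl he))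
      obtain ⟨h1, h2⟩ := (h.edges_inter e).2 hep
      have h3 := hK.cnt_eq_two (hc.edge_mem e he).1 (hc.edge_mem e he).2
      have h4 := h.surface.cnt_eq_two (h.path.edge_mem e hep).1 (h.path.edge_mem e hep).2
      -- An inner edge of `K` is already in two triangles of `K`, and these are all its triangles in
      -- `H`.
      have h5 : (K.filter fun t => e ⊆ t) = H.filter fun t => e ⊆ t :=
        Finset.eq_of_subset_of_card_le (Finset.filter_subset_filter _ hKH) (h4.trans h3.symm).le
      have h6 : ∀ {X}, X ⊆ H → e ∈ edges X → e ∈ edges (K ∩ X) := by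
        intro X hX heX
        obtain ⟨he2, t, ht, het⟩ := mem_edges.1 heX
        have : t ∈ K.filter fun t => e ⊆ t := by rw [h5]; simp [hX ht, het]
        exact mem_edges.2 ⟨he2, t, Finset.mem_inter.2 ⟨(Finset.mem_filter.1 this).1, ht⟩, het⟩
      exact ⟨h6 h.left_subset h1, h6 h.symm.left_subset h2⟩

lemma relabel_eq_none {lab : V → Option Label} {K : Finset (Finset V)} {W : Word} {u : V} :
    relabel lab K W u = none ↔ lab u = none ∧ u ∉ bdNodes K := by
  unfold relabel
  cases lab u <;> simp

lemma relabel_eq_original {lab : V → Option Label} {K : Finset (Finset V)} {W : Word} {u : V}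
    {k : ℤ} : relabel lab K W u = some (.original k) ↔ lab u = some (.original k) := by
  unfold relabel
  cases lab u <;> simp

lemma relabel_eq_child {lab : V → Option Label} {K : Finset (Finset V)} {W S : Word} {u : V} :
    relabel lab K W u = some (.child S) ↔
      lab u = some (.child S) ∨ lab u = none ∧ u ∈ bdNodes K ∧ S = W := by
  unfold relabel
  cases lab u <;> simp [eq_comm]

namespace LeafInv

variable {I K A B : Finset (Finset V)} {φ : V → ℤ} {s s' : State V} {W S : Word}
  {lab : V → Option Label} {a b a' b' u v w x y : V} {c p l r : List V} {d d' : Side}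
  {e : Finset V}

/-- The invariant holds for a new leaf. -/
lemma left (h : LeafInv I φ s S (s.node S) K (s.label S))
    (hs : IsSplit s.tets (s.node S) a' b' p A B x y) (hx : IsExt I a b c l r p)
    (hcut : IsCut K (s.label S) a b c) (hl : Prolongs s S a l) (hr : Prolongs s S b r)
    (hI : nodes I ⊆ nodes s.tets) (htets : s'.tets = splitNode s.tets (s.node S) p A B x y)
    (hdd : d ≠ d') (hd' : d' :: S ∈ s'.leaves) (hnode : s'.node (d' :: S) = y)
    (hold : ∀ W ∈ s.leaves, W ≠ S → W ∈ s'.leaves ∧ s'.node W = s.node W) :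
    LeafInv I φ s' (d :: S) x (K ∩ A) (relabel (s.label S) (K ∩ A) (d' :: S)) := by
  have hK := hs.cut.inter hx h.piece_disk.toIsSurface h.piece_link h.piece_sub hcut.1
  have hnI : ∀ u ∈ nodes (K ∩ A), u ∈ nodes I ∧ u ∈ nodes K ∧ u ∈ nodes A := fun u hu =>
    ⟨nodes_mono (Finset.inter_subset_left.trans h.piece_sub) hu,
      nodes_mono Finset.inter_subset_left hu, nodes_mono Finset.inter_subset_right hu⟩
  -- The nodes that receive the new label are inner nodes of the cutting path.
  have hnew : ∀ u ∈ nodes (K ∩ A), s.label S u = none → u ∈ bdNodes (K ∩ A) →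
      u ∈ c ∧ u ∉ bdNodes K := fun u hu h1 h2 => by
    have h3 := (h.label_none u (hnI u hu).2.1).1 h1
    exact ⟨(hK.mem_bdNodes_left.1 h2).2.resolve_left h3, h3⟩
  have hedgesA : edges A ⊆ edges (link s'.tets x) := by
    rw [htets, hs.link_left]
    exact edges_mono Finset.subset_union_left
  -- The sibling word is fresh: an old label equal to it would make a child of `S` an ancestor of
  -- `S`.
  have hnoold : ∀ u, s.label S u ≠ some (.child (d' :: S)) := fun u hu => by
    obtain ⟨e, e', S₀, -, h1, h2⟩ := h.label_child u _ hu
    obtain ⟨-, rfl⟩ := List.cons.inj h1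
    exact not_cons_suffix _ _ h2
  constructor
  · exact fun hh => hs.left_notMem (hI hh)
  · rw [htets]; exact hs.isDisk_left
  · exact (hK.divides h.piece_disk.euler_eq).left
  · rw [htets, hs.link_left]
    exact Finset.inter_subset_right.trans Finset.subset_union_left
  · exact Finset.inter_subset_left.trans h.piece_sub
  · intro u hu
    obtain ⟨h1, h2, h3⟩ := hnI u hu
    rw [htets, hs.extEdges_left (fun hh => hs.left_notMem (hh ▸ hI h1))
      (fun hh => hs.right_notMem (hh ▸ hI h1)), ← pair_mem_extEdges_iff_bdNodes, h.ext_iff u h2]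
    exact and_iff_left h3
  · intro u hu hb
    exact hK.mem_bdNodes_left.2 ⟨hu, .inl (h.bd u (hnI u hu).2.1 hb)⟩
  · intro u hu
    rw [relabel_eq_none, h.label_none u (hnI u hu).2.1]
    refine and_iff_right_of_imp fun h1 h2 => h1 (hK.mem_bdNodes_left.2 ⟨hu, .inl h2⟩)
  · intro u k
    rw [relabel_eq_original, h.label_original]
  · intro u S' hu
    rcases relabel_eq_child.1 hu with h1 | ⟨-, -, rfl⟩
    · obtain ⟨e, e', S₀, h2, h3, h4⟩ := h.label_child u S' h1
      exact ⟨e, e', S₀, h2, h3, h4.trans (List.suffix_cons _ _)⟩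
    · exact ⟨d', d, S, hdd.symm, rfl, List.suffix_refl _⟩
  · intro u hu S' hS'
    obtain ⟨huI, huK, huA⟩ := hnI u hu
    rcases relabel_eq_child.1 hS' with h1 | ⟨h1, h2, rfl⟩
    · have main : ∃ W' ∈ s.leaves, S' <:+ W' ∧ {u, s.node W'} ∈ edges A := by
        by_cases hup : u ∈ p
        · have hub : u ∈ bdNodes K := by
            by_contra hh
            rw [← h.label_none u huK, h1] at hh
            simp at hh
          have key : ∀ {m : List V}, Prolongs s S u m →
              (∀ w ∈ m, {u, w} ∈ pathEdges p) →
              ∃ W' ∈ s.leaves, S' <:+ W' ∧ {u, s.node W'} ∈ edges A := by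
            intro m hm hmp
            rcases hm with ⟨k, hk, -⟩ | ⟨S'', W', h3, h4, h5, h6, rfl⟩
            · rw [h1] at hk; simp at hk
            · rw [h1] at h3
              obtain rfl : S' = S'' := by simpa using h3
              exact ⟨W', h4, h5, ((hs.cut.edges_inter _).2 (hmp _ (by simp))).1⟩
          rcases hcut.1.interior u (hx.mem_of_mem hup huI) hub with rfl | rfl
          · exact key hl fun w hw => hx.mem_pathEdges.2 (.inl ⟨w, hw, Finset.pair_comm _ _⟩)
          · exact key hr fun w hw => hx.mem_pathEdges.2 (.inr (.inr ⟨w, hw, rfl⟩))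
        · obtain ⟨W', h3, h4, h5⟩ := h.label_adj u huK S' h1
          refine ⟨W', h3, h4, ?_⟩
          obtain ⟨h6, t, ht, hut, hwt⟩ := pair_mem_edges.1 h5
          have htA : t ∈ A := by
            refine (hs.cut.mem_or_mem ht).resolve_right fun hB => hup ?_
            exact hs.cut.nodes_inter.1 ⟨huA, mem_nodes.2 ⟨t, hB, hut⟩⟩
          exact pair_mem_edges.2 ⟨h6, t, htA, hut, hwt⟩
      obtain ⟨W', h3, h4, h5⟩ := main
      have hWS : W' ≠ S := by
        rintro rfl
        obtain ⟨-, t, ht, -, hwt⟩ := pair_mem_edges.1 h5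
        exact (hs.notMem_left ht).1 hwt
      obtain ⟨h6, h7⟩ := hold W' h3 hWS
      exact ⟨W', h6, h4, by rw [h7]; exact hedgesA h5⟩
    · refine ⟨_, hd', List.suffix_refl _, ?_⟩
      have huc := (hnew u hu h1 h2).1
      obtain ⟨e, he, hue⟩ := exists_pathEdge_of_mem hs.path.two_le_length (hx.subset huc)
      rw [hnode, htets, hs.link_left]
      refine pair_mem_edges.2 ⟨fun hh => hs.right_notMem (hh ▸ hI huI), insert y e, ?_,
        by simp [hue], by simp⟩
      exact Finset.mem_union_right _ (Finset.mem_image_of_mem _ (by simpa using he))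
  · intro S'
    by_cases hS' : S' = d' :: S
    · subst hS'
      -- For the new label the index is the position on `c`; as `c` is shortest, adjacent inner
      -- nodes are consecutive, and their edge is now on the boundary.
      refine ⟨fun z => c.idxOf z, fun u hu w hw hlu hlw => ?_⟩
      have h1 := (relabel_eq_child.1 hlu).resolve_left (hnoold u)
      have h2 := (relabel_eq_child.1 hlw).resolve_left (hnoold w)
      obtain ⟨huc, hub⟩ := hnew u hu h1.1 h1.2.1
      obtain ⟨hwc, hwb⟩ := hnew w hw h2.1 h2.2.1
      refine ⟨fun hh => (List.idxOf_inj huc).1 hh, fun he => ?_⟩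
      have h3 := shortest hcut.1 hcut.2.2 huc hwc hub hwb
        (edges_mono Finset.inter_subset_left he)
      exact ⟨h3.1, hK.mem_bdEdges_left.2 ⟨he, .inr h3.2⟩⟩
    · obtain ⟨idx, hidx⟩ := h.label_idx S'
      refine ⟨idx, fun u hu w hw hlu hlw => ?_⟩
      have h1 := (relabel_eq_child.1 hlu).resolve_right (fun hh => hS' hh.2.2)
      have h2 := (relabel_eq_child.1 hlw).resolve_right (fun hh => hS' hh.2.2)
      obtain ⟨h3, h4⟩ := hidx u (hnI u hu).2.1 w (hnI w hw).2.1 h1 h2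
      refine ⟨h3, fun he => ?_⟩
      obtain ⟨h5, h6⟩ := h4 (edges_mono Finset.inter_subset_left he)
      exact ⟨h5, hK.mem_bdEdges_left.2 ⟨he, .inl h6⟩⟩

/-- The invariant stays true for the leaves that are not split. -/
lemma other (h : LeafInv I φ s W v K lab)
    (hs : IsSplit s.tets (s.node S) a' b' p A B x y) (hvS : v ≠ s.node S)
    (hSI : s.node S ∉ nodes I) (hadj : Adj s.tets (s.node S) v → {s.node S, v} ∈ extEdges s.tets)
    (hI : nodes I ⊆ nodes s.tets) (htets : s'.tets = splitNode s.tets (s.node S) p A B x y)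
    (hleft : ∃ W' ∈ s'.leaves, S <:+ W' ∧ s'.node W' = x)
    (hright : ∃ W' ∈ s'.leaves, S <:+ W' ∧ s'.node W' = y)
    (hinj : ∀ W ∈ s.leaves, W ≠ S → s.node W ≠ s.node S)
    (hold : ∀ W ∈ s.leaves, W ≠ S → W ∈ s'.leaves ∧ s'.node W = s.node W) :
    LeafInv I φ s' W v K lab := by
  have hvT : v ∈ nodes s.tets := by
    obtain ⟨f, hf⟩ := h.disk.nonempty
    exact mem_nodes.2 ⟨_, (mem_link.1 hf).2, by simp⟩
  have hvx : v ≠ x := fun hh => hs.left_notMem (hh ▸ hvT)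
  have hvy : v ≠ y := fun hh => hs.right_notMem (hh ▸ hvT)
  have hKI := nodes_mono h.piece_sub
  refine ⟨h.node_notMem, ?_, h.piece_disk, ?_, h.piece_sub, ?_, h.bd, h.label_none,
    h.label_original, h.label_child, ?_, h.label_idx⟩
  · rw [htets]
    refine hs.isDisk_other hvT hvS h.disk fun hv => ?_
    obtain ⟨h1, t, ht, h2, h3⟩ := mem_nodes_link.1 hv
    exact pair_mem_extEdges_iff_bdNodes.1 (hadj ⟨hvS.symm, t, ht, h2, h3⟩)
  · intro f hf
    obtain ⟨h1, h2⟩ := mem_link.1 (h.piece_link hf)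
    rw [htets]
    refine mem_link.2 ⟨h1, IsSplit.mem₁ h2 ?_⟩
    rw [Finset.mem_insert, not_or]
    exact ⟨hvS.symm, fun hh => hSI (mem_nodes.2 ⟨f, h.piece_sub hf, hh⟩)⟩
  · intro u hu
    have huI := hKI hu
    rw [htets, hs.extEdges_old hvx hvy hvS (fun hh => hs.left_notMem (hh ▸ hI huI))
      (fun hh => hs.right_notMem (hh ▸ hI huI)) (fun hh => hSI (hh ▸ huI)), h.ext_iff u hu]
  · intro u hu S' hS'
    have huI := hKI hu
    have huS : u ≠ s.node S := fun hh => hSI (hh ▸ huI)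
    have hux : u ≠ x := fun hh => hs.left_notMem (hh ▸ hI huI)
    have huy : u ≠ y := fun hh => hs.right_notMem (hh ▸ hI huI)
    obtain ⟨W', h1, h2, h3⟩ := h.label_adj u hu S' hS'
    obtain ⟨h4, h5, h6, t, ht, hvt, hut, hwt⟩ := pair_mem_edges_link.1 h3
    rw [htets]
    -- If the node of the label is the one being split, the tetrahedron that contains the edge
    -- passes to one of its two children, which takes its place.
    by_cases hWS : W' = S
    · subst hWS
      rcases hs.erase_mem ht hwt with h7 | h7
      · obtain ⟨W'', h8, h9, h10⟩ := hleft
        refine ⟨W'', h8, h2.trans h9, ?_⟩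
        rw [h10]
        exact pair_mem_edges_link.2 ⟨hux, h5, hvx.symm, _, IsSplit.mem₂ h7,
          by simp [hvS, hvt], by simp [huS, hut], by simp⟩
      · obtain ⟨W'', h8, h9, h10⟩ := hright
        refine ⟨W'', h8, h2.trans h9, ?_⟩
        rw [h10]
        exact pair_mem_edges_link.2 ⟨huy, h5, hvy.symm, _, IsSplit.mem₃ h7,
          by simp [hvS, hvt], by simp [huS, hut], by simp⟩
    · obtain ⟨h7, h8⟩ := hold W' h1 hWS
      refine ⟨W', h7, h2, ?_⟩
      rw [h8]
      by_cases hnt : s.node S ∈ t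
      · have hw := hinj W' h1 hWS
        rcases hs.erase_mem ht hnt with h9 | h9
        · exact pair_mem_edges_link.2 ⟨h4, h5, h6, _, IsSplit.mem₂ h9,
            by simp [hvS, hvt], by simp [huS, hut], by simp [hw, hwt]⟩
        · exact pair_mem_edges_link.2 ⟨h4, h5, h6, _, IsSplit.mem₃ h9,
            by simp [hvS, hvt], by simp [huS, hut], by simp [hw, hwt]⟩
      · exact pair_mem_edges_link.2 ⟨h4, h5, h6, t, IsSplit.mem₁ ht hnt, hvt, hut, hwt⟩

end LeafInv

end BallSplit

namespace BallSplit

variable {V : Type*} [DecidableEq V]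

/-! ### The invariant of a state, and the cuts it provides -/

/-- The invariant of the algorithm. -/
structure Inv (I : Finset (Finset V)) (φ : V → ℤ) (s : State V) : Prop where
  inj : Set.InjOn φ (bdNodes I)
  card_eq : ∀ t ∈ s.tets, t.card = 4
  leaf_eq : ∀ W ∈ s.leaves, ∀ W' ∈ s.leaves, W <:+ W' → W = W'
  node_inj : ∀ W ∈ s.leaves, ∀ W' ∈ s.leaves, s.node W = s.node W' → W = W'
  nodes_sub : nodes I ⊆ nodes s.tets
  piece_disj : ∀ W ∈ s.leaves, ∀ W' ∈ s.leaves, W ≠ W' → Disjoint (s.piece W) (s.piece W')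
  piece_union : s.leaves.biUnion s.piece = I
  -- So a leaf node in the hemisphere of another one is on the boundary there. This keeps
  -- hemispheres disks and lets extended paths end on the boundary.
  adj : ∀ W ∈ s.leaves, ∀ W' ∈ s.leaves, Adj s.tets (s.node W) (s.node W') →
    {s.node W, s.node W'} ∈ extEdges s.tets
  leaf : ∀ W ∈ s.leaves, LeafInv I φ s W (s.node W) (s.piece W) (s.label W)

section
variable {I T A B K : Finset (Finset V)} {φ : V → ℤ} {s s' : State V} {W S : Word}
  {a b a' b' u v w x y n : V} {c p l r : List V} {e t : Finset V}

lemma Inv.init (hT : ∀ t ∈ T, t.card = 4) (hn : IsDisk (link T n)) (h : IsInitial T n s) :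
    ∃ φ, Inv (link T n) φ s := by
  obtain ⟨h1, h2, h3, h4, φ, h5, h6⟩ := h
  have hS : ∀ W ∈ s.leaves, W = [] := fun W hW => by simpa [h2] using hW
  refine ⟨φ, h5.injOn, by rwa [h1], ?_, ?_, ?_, ?_, ?_, ?_, ?_⟩
  · intro W hW W' hW' _
    rw [hS W hW, hS W' hW']
  · intro W hW W' hW' _
    rw [hS W hW, hS W' hW']
  · rw [h1]
    intro x hx
    obtain ⟨-, t, ht, -, hxt⟩ := mem_nodes_link.1 hx
    exact mem_nodes.2 ⟨t, ht, hxt⟩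
  · intro W hW W' hW' hne
    exact (hne (by rw [hS W hW, hS W' hW'])).elim
  · rw [h2, Finset.singleton_biUnion, h4]
    rfl
  · intro W hW W' hW' had
    exact (had.1 (by rw [hS W hW, hS W' hW'])).elim
  · intro W hW
    obtain rfl := hS W hW
    have hlab : ∀ u S', s.label [] u ≠ some (.child S') := fun u S' hu => by
      rw [h6] at hu
      split_ifs at hu
      simp at hu
    rw [h3, h4]
    refine ⟨fun hh => (mem_nodes_link.1 hh).1 rfl, by rwa [h1], hn, by rw [h1]; rfl,
      Finset.Subset.refl _, ?_, fun u _ hu => hu, ?_, ?_, fun u S' hu => (hlab u S' hu).elim,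
      fun u _ S' hu => (hlab u S' hu).elim, fun S' => ⟨fun _ => 0, fun u _ w _ hu => (hlab u S' hu).elim⟩⟩
    · intro u _
      rw [h1, pair_mem_extEdges_iff_bdNodes]
    · intro u _
      rw [h6]
      split_ifs with hb <;> simp [hb]
    · intro u k
      rw [h6]
      change _ ↔ u ∈ bdNodes (hemisphere T n) ∧ _
      split_ifs with hb <;> simp [hb]

lemma Inv.ext (h : Inv I φ s) (hS : S ∈ s.leaves) (hc : IsSplittingPath (s.piece S) a b c)
    (hl : Prolongs s S a l) (hr : Prolongs s S b r) : IsExt I a b c l r (l ++ c ++ r) := by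
  have key : ∀ {u m}, Prolongs s S u m → ∀ w ∈ m, w ∉ nodes I := by
    intro u m hm w hw
    rcases (h.leaf S hS).prolongs_cases hm with ⟨-, rfl⟩ | ⟨-, S', W', -, h1, -, -, rfl⟩
    · simp at hw
    · obtain rfl : w = s.node W' := by simpa using hw
      exact (h.leaf W' h1).node_notMem
  exact ⟨hc.head_eq, hc.last_eq, (h.leaf S hS).prolongs_eq hl, (h.leaf S hS).prolongs_eq hr,
    key hl, key hr, rfl⟩

/-- The end of the extended path. -/
lemma Inv.exists_end (h : Inv I φ s) (hS : S ∈ s.leaves) (hu : u ∈ nodes (s.piece S))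
    (hl : Prolongs s S u l) : ∃ u' ∈ bdNodes (link s.tets (s.node S)),
      (l = [] ∧ u' = u ∧ u ∈ bdNodes I) ∨ (l = [u'] ∧ u ∉ bdNodes I ∧ u' ∉ nodes I ∧
        {u, u'} ∈ edges (link s.tets (s.node S)) ∧ ∃ S' W', s.label S u = some (.child S') ∧
        W' ∈ s.leaves ∧ S' <:+ W' ∧ u' = s.node W') := by
  rcases (h.leaf S hS).prolongs_cases hl with ⟨h1, rfl⟩ | ⟨h1, S', W', h2, h3, h4, h5, rfl⟩
  · exact ⟨u, pair_mem_extEdges_iff_bdNodes.1 (((h.leaf S hS).ext_iff u hu).2 h1),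
      .inl ⟨rfl, rfl, h1⟩⟩
  · refine ⟨s.node W', pair_mem_extEdges_iff_bdNodes.1 ?_,
      .inr ⟨rfl, h1, (h.leaf W' h3).node_notMem, h5, S', W', h2, h3, h4, rfl⟩⟩
    obtain ⟨-, -, h6, t, ht, h7, -, h8⟩ := pair_mem_edges_link.1 h5
    exact h.adj S hS W' h3 ⟨h6.symm, t, ht, h7, h8⟩

/-- Every extension of a path that cuts a piece is a splitting path of the hemisphere. -/
lemma Inv.isSplittingPath (h : Inv I φ s) (hS : S ∈ s.leaves)
    (hcut : IsCut (s.piece S) (s.label S) a b c) (hl : Prolongs s S a l) (hr : Prolongs s S b r) :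
    ∃ a' b', IsSplittingPath (link s.tets (s.node S)) a' b' (l ++ c ++ r) := by
  have hL := h.leaf S hS
  have hc := hcut.1
  have hx := h.ext hS hc hl hr
  have hac : a ∈ c := List.mem_of_mem_head? hc.head_eq
  have hbc : b ∈ c := List.mem_of_mem_getLast? hc.last_eq
  have hcI : ∀ z ∈ c, z ∈ nodes I := fun z hz => nodes_mono hL.piece_sub (hc.mem_nodes hz)
  obtain ⟨a', ha', ha⟩ := h.exists_end hS (hc.mem_nodes hac) hl
  obtain ⟨b', hb', hb⟩ := h.exists_end hS (hc.mem_nodes hbc) hr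
  have hbdI : ∀ u ∈ nodes (s.piece S), u ∈ bdNodes (link s.tets (s.node S)) ↔ u ∈ bdNodes I :=
    fun u hu => by rw [← pair_mem_extEdges_iff_bdNodes, hL.ext_iff u hu]
  -- Original ends are in `I` and added nodes are not. If both ends are extended to the same node,
  -- both labels are ancestors of one leaf, hence equal, against the choice of `a` and `b`.
  have hne : a' ≠ b' := by
    rcases ha with ⟨-, rfl, -⟩ | ⟨-, -, h1, -, S₁, W₁, h2, h3, h4, h5⟩ <;>
      rcases hb with ⟨-, rfl, -⟩ | ⟨-, -, h1', -, S₂, W₂, h2', h3', h4', h5'⟩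
    · exact hc.ends_ne
    · rintro rfl; exact h1' (hcI _ hac)
    · rintro rfl; exact h1 (hcI _ hbc)
    · intro hh
      rw [h5, h5'] at hh
      obtain rfl := h.node_inj _ h3 _ h3' hh
      obtain ⟨d, d', T₁, hd, e1, e2⟩ := hL.label_child _ _ h2
      obtain ⟨e, e', T₂, he, e3, e4⟩ := hL.label_child _ _ h2'
      have := suffix_sibling hd he e2 e4 e1 e3 h4 h4'
      exact hcut.2.1 (by rw [h2, h2', this])
  refine ⟨a', b', ?_, ?_, ?_, hne, ha', hb', ?_, ?_⟩
  · rw [List.nodup_append', List.nodup_append']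
    refine ⟨⟨?_, hc.nodup, ?_⟩, ?_, ?_⟩
    · rcases hx.left with rfl | ⟨w, rfl⟩ <;> simp
    · exact fun z hz hz' => hx.left_notMem z hz (hcI z hz')
    · rcases hx.right with rfl | ⟨w, rfl⟩ <;> simp
    · intro z hz hz'
      rcases List.mem_append.1 hz with hz | hz
      · rcases ha with ⟨rfl, -⟩ | ⟨rfl, -⟩
        · simp at hz
        · rcases hb with ⟨rfl, -⟩ | ⟨rfl, -⟩
          · simp at hz'
          · simp only [List.mem_singleton] at hz hz'
            exact hne (hz.symm.trans hz')
      · exact hx.right_notMem z hz' (hcI z hz)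
  · rcases ha with ⟨rfl, rfl, -⟩ | ⟨rfl, -⟩
    · simp [hc.head_eq]
    · simp
  · rcases hb with ⟨rfl, rfl, -⟩ | ⟨rfl, -⟩
    · simp [hc.last_eq]
    · simp
  · intro z hz hzb
    rw [List.mem_append, List.mem_append] at hz
    rcases hz with (hz | hz) | hz
    · left
      rcases ha with ⟨rfl, -⟩ | ⟨rfl, -⟩
      · simp at hz
      · simpa using hz
    · have hzI := (hbdI z (hc.mem_nodes hz)).1 hzb
      rcases hc.interior z hz (hL.bd z (hc.mem_nodes hz) hzI) with rfl | rfl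
      · left
        rcases ha with ⟨-, h1, -⟩ | ⟨-, h1, -⟩
        · exact h1.symm
        · exact (h1 hzI).elim
      · right
        rcases hb with ⟨-, h1, -⟩ | ⟨-, h1, -⟩
        · exact h1.symm
        · exact (h1 hzI).elim
    · right
      rcases hb with ⟨rfl, -⟩ | ⟨rfl, -⟩
      · simp at hz
      · simpa using hz
  · intro e he
    rcases hx.mem_pathEdges.1 he with ⟨w, hw, rfl⟩ | he | ⟨w, hw, rfl⟩
    · rcases ha with ⟨rfl, -⟩ | ⟨rfl, h1, -, h2, -⟩
      · simp at hw
      · obtain rfl : w = a' := by simpa using hw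
        refine ⟨by rwa [Finset.pair_comm], fun hh => h1 ?_⟩
        exact (hbdI a (hc.mem_nodes hac)).1 (mem_bdNodes.2 ⟨_, hh, by simp⟩)
    · obtain ⟨h1, h2⟩ := hc.edge_mem e he
      refine ⟨edges_mono hL.piece_link h1, fun hh => ?_⟩
      -- An inner edge of the piece already has two triangles there, so it is not a boundary edge of
      -- the larger hemisphere.
      have h3 := hL.piece_disk.cnt_eq_two h1 h2
      have h4 := cnt_mono (e := e) hL.piece_link
      rw [(mem_bdEdges.1 hh).2] at h4
      omega
    · rcases hb with ⟨rfl, -⟩ | ⟨rfl, h1, -, h2, -⟩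
      · simp at hw
      · obtain rfl : w = b' := by simpa using hw
        refine ⟨h2, fun hh => h1 ?_⟩
        exact (hbdI b (hc.mem_nodes hbc)).1 (mem_bdNodes.2 ⟨_, hh, by simp⟩)

/-- The ends of a path that cuts a piece can be extended. -/
lemma Inv.exists_prolongs (h : Inv I φ s) (hS : S ∈ s.leaves) (hu : u ∈ bdNodes (s.piece S)) :
    ∃ l, Prolongs s S u l := by
  have hL := h.leaf S hS
  have huK := bdNodes_subset_nodes hu
  cases hlab : s.label S u with
  | none => exact ((hL.label_none u huK).1 hlab hu).elim
  | some lb =>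
    cases lb with
    | original k => exact ⟨[], .inl ⟨k, hlab, rfl⟩⟩
    | child S' =>
      obtain ⟨W', h1, h2, h3⟩ := hL.label_adj u huK S' hlab
      exact ⟨_, .inr ⟨S', W', hlab, h1, h2, h3, rfl⟩⟩

/-- Adjacent nodes of the boundary of a piece that have the same label are labelled by a word. -/
lemma Inv.child_of_label_eq (h : Inv I φ s) (hS : S ∈ s.leaves) (hu : u ∈ bdNodes (s.piece S))
    (huw : u ≠ w) (hlab : s.label S u = s.label S w) : ∃ S', s.label S u = some (.child S') := by
  have hL := h.leaf S hS
  cases hlu : s.label S u with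
  | none => exact ((hL.label_none u (bdNodes_subset_nodes hu)).1 hlu hu).elim
  | some lb =>
    cases lb with
    | original k =>
      have h1 := (hL.label_original u k).1 hlu
      have h2 := (hL.label_original w k).1 (hlab ▸ hlu)
      exact (huw (h.inj h1.1 h2.1 (h1.2.trans h2.2.symm))).elim
    | child S' => exact ⟨S', rfl⟩

lemma Inv.exists_bdEdge_label_ne (h : Inv I φ s) (hS : S ∈ s.leaves) :
    ∃ u w, {u, w} ∈ bdEdges (s.piece S) ∧ s.label S u ≠ s.label S w := by
  classical
  have hL := h.leaf S hS
  by_contra hno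
  push Not at hno
  obtain ⟨e, he⟩ := hL.piece_disk.bdry_nonempty
  obtain ⟨u₀, w₀, huw₀, rfl⟩ := Finset.card_eq_two.1 (mem_bdEdges.1 he).1
  have hu₀ : u₀ ∈ bdNodes (s.piece S) := mem_bdNodes.2 ⟨_, he, by simp⟩
  obtain ⟨S', hS'⟩ := h.child_of_label_eq hS hu₀ huw₀ (hno _ _ he)
  obtain ⟨idx, hidx⟩ := hL.label_idx S'
  -- If all boundary edges had equally labelled ends, both neighbours of the node with least index
  -- along the boundary would have the next index and would coincide.
  obtain ⟨u, hu, hmin⟩ := Finset.exists_min_image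
    ((bdNodes (s.piece S)).filter fun u => s.label S u = some (.child S')) idx
    ⟨u₀, by simp [hu₀, hS']⟩
  rw [Finset.mem_filter] at hu
  obtain ⟨e₁, he₁, hue₁⟩ := mem_bdNodes.1 hu.1
  have heven := even_card_bdEdges_at hL.piece_disk.card_eq
    (fun e he => hL.piece_disk.cnt_le he) u
  have hmem : e₁ ∈ (bdEdges (s.piece S)).filter fun e => u ∈ e := by simp [he₁, hue₁]
  have hcard : 1 < ((bdEdges (s.piece S)).filter fun e => u ∈ e).card := by
    have := Finset.card_pos.2 ⟨_, hmem⟩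
    rw [even_iff_two_dvd] at heven
    omega
  obtain ⟨e₂, he₂, hne⟩ := Finset.exists_mem_ne hcard e₁
  rw [Finset.mem_filter] at he₂
  obtain ⟨w₁, hw₁, rfl⟩ := exists_pair_of_mem (mem_bdEdges.1 he₁).1 hue₁
  obtain ⟨w₂, hw₂, rfl⟩ := exists_pair_of_mem (mem_bdEdges.1 he₂.1).1 he₂.2
  have key : ∀ w, {u, w} ∈ bdEdges (s.piece S) → w ∈ bdNodes (s.piece S) ∧
      s.label S w = some (.child S') ∧ idx w = idx u + 1 := by
    intro w hw
    have hwb : w ∈ bdNodes (s.piece S) := mem_bdNodes.2 ⟨_, hw, by simp⟩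
    have hwl : s.label S w = some (.child S') := (hno u w hw).symm.trans hu.2
    refine ⟨hwb, hwl, ?_⟩
    have h1 := ((hidx u (bdNodes_subset_nodes hu.1) w (bdNodes_subset_nodes hwb) hu.2 hwl).2
      (bdEdges_subset_edges hw)).1
    have h2 := hmin w (by simp [hwb, hwl])
    omega
  obtain ⟨h1, h2, h3⟩ := key w₁ he₁
  obtain ⟨h4, h5, h6⟩ := key w₂ he₂.1
  have := (hidx w₁ (bdNodes_subset_nodes h1) w₂ (bdNodes_subset_nodes h4) h2 h5).1
    (h3.trans h6.symm)
  exact hne (by rw [this])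

/-- No other triangle shares an edge with `t`, while the triangles of a connected surface are
connected through edges. -/
lemma IsSurface.card_eq_one_of_bdEdges (hK : IsSurface K) (ht : t ∈ K)
    (h : ∀ e ∈ edges K, e ⊆ t → e ∈ bdEdges K) : K.card = 1 := by
  rw [Finset.card_eq_one]
  refine ⟨t, Finset.eq_singleton_iff_unique_mem.2 ⟨ht, fun t' ht' => ?_⟩⟩
  have := hK.eq_of_edges (fun s => s = t) (fun e he s hs s' hs' hes hes' => ?_) t' ht' t ht
  · simpa using this
  · by_cases h1 : e ⊆ t
    · rw [eq_of_bdEdge (h e he h1) hs hs' hes hes']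
    · exact propext ⟨fun hh => (h1 (hh ▸ hes)).elim, fun hh => (h1 (hh ▸ hes')).elim⟩

/-- A piece that is not a triangle can be cut. -/
lemma Inv.exists_isCut (h : Inv I φ s) (hS : S ∈ s.leaves) (hcard : (s.piece S).card ≠ 1) :
    ∃ a b d, IsCut (s.piece S) (s.label S) a b d := by
  classical
  have hL := h.leaf S hS
  suffices hex : ∃ a b d, IsSplittingPath (s.piece S) a b d ∧ s.label S a ≠ s.label S b by
    obtain ⟨a, b, d, h1, h2⟩ := hex
    have hP : ∃ k, ∃ d, IsSplittingPath (s.piece S) a b d ∧ d.length = k := ⟨_, d, h1, rfl⟩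
    obtain ⟨d', h3, h4⟩ := Nat.find_spec hP
    exact ⟨a, b, d', h3, h2, fun d'' h5 => h4.le.trans (Nat.find_min' hP ⟨d'', h5, rfl⟩)⟩
  -- An inner edge between two boundary nodes is itself a path, and equal labels at its ends would
  -- put it on the boundary. Without such an edge, the path goes around a boundary edge with
  -- different labels, through the third node of its triangle; if that node were on the boundary,
  -- the piece would be this triangle.
  by_cases hdiag : ∃ u w, {u, w} ∈ edges (s.piece S) ∧ {u, w} ∉ bdEdges (s.piece S) ∧
      u ∈ bdNodes (s.piece S) ∧ w ∈ bdNodes (s.piece S)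
  · obtain ⟨u, w, h1, h2, hu, hw⟩ := hdiag
    have huw := ne_of_pair_mem_edges h1
    refine ⟨u, w, [u, w], ⟨by simpa using huw, rfl, rfl, huw, hu, hw, by simp, ?_⟩, ?_⟩
    · simp [h1, h2]
    · intro hlab
      obtain ⟨S', hS'⟩ := h.child_of_label_eq hS hu huw hlab
      obtain ⟨idx, hidx⟩ := hL.label_idx S'
      exact h2 ((hidx u (bdNodes_subset_nodes hu) w (bdNodes_subset_nodes hw) hS'
        (hlab ▸ hS')).2 h1).2
  · push Not at hdiag
    obtain ⟨u, w, huw, hlab⟩ := h.exists_bdEdge_label_ne hS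
    obtain ⟨-, t, ht, hut, hwt⟩ := pair_mem_edges.1 (bdEdges_subset_edges huw)
    have hne := ne_of_pair_mem_edges (bdEdges_subset_edges huw)
    have hub : u ∈ bdNodes (s.piece S) := mem_bdNodes.2 ⟨_, huw, by simp⟩
    have hwb : w ∈ bdNodes (s.piece S) := mem_bdNodes.2 ⟨_, huw, by simp⟩
    obtain ⟨x, hx, hxb⟩ : ∃ x ∈ t, x ∉ bdNodes (s.piece S) := by
      by_contra hall
      push Not at hall
      refine hcard (hL.piece_disk.card_eq_one_of_bdEdges ht fun e he het => ?_)
      obtain ⟨y, z, -, rfl⟩ := Finset.card_eq_two.1 (mem_edges.1 he).1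
      rw [pair_subset_iff] at het
      by_contra hnb
      exact hdiag y z he hnb (hall y het.1) (hall z het.2)
    have hxu : u ≠ x := fun hh => hxb (hh ▸ hub)
    have hxw : w ≠ x := fun hh => hxb (hh ▸ hwb)
    refine ⟨u, w, [u, x, w], ⟨?_, rfl, rfl, hne, hub, hwb, ?_, ?_⟩, hlab⟩
    · simp [hne, hxu, hxw.symm]
    · intro v hv hvb
      simp only [List.mem_cons, List.not_mem_nil, or_false] at hv
      rcases hv with rfl | rfl | rfl
      · exact .inl rfl
      · exact (hxb hvb).elim
      · exact .inr rfl
    · intro e he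
      simp only [pathEdges_cons_cons, pathEdges_singleton, List.mem_cons, List.not_mem_nil,
        or_false] at he
      rcases he with rfl | rfl
      · exact ⟨pair_mem_edges.2 ⟨hxu, t, ht, hut, hx⟩,
          fun hh => hxb (mem_bdNodes.2 ⟨_, hh, by simp⟩)⟩
      · exact ⟨pair_mem_edges.2 ⟨hxw.symm, t, ht, hx, hwt⟩,
          fun hh => hxb (mem_bdNodes.2 ⟨_, hh, by simp⟩)⟩

/-! ### The split of a state -/

lemma mem_leaves_split : W ∈ (s.split S p A B x y).leaves ↔
    W = Side.L :: S ∨ W = Side.R :: S ∨ (W ≠ S ∧ W ∈ s.leaves) := by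
  simp [State.split]

lemma Inv.ne_cons (h : Inv I φ s) (hS : S ∈ s.leaves) (hW : W ∈ s.leaves) (d : Side) :
    W ≠ d :: S := by
  rintro rfl
  have := h.leaf_eq S hS _ hW (List.suffix_cons d S)
  simpa using congrArg List.length this

lemma node_left : (s.split S p A B x y).node (Side.L :: S) = x := by
  simp [State.split]

lemma node_right : (s.split S p A B x y).node (Side.R :: S) = y := by
  simp [State.split]

lemma piece_left : (s.split S p A B x y).piece (Side.L :: S) = s.piece S ∩ A := by
  simp [State.split]

lemma piece_right : (s.split S p A B x y).piece (Side.R :: S) = s.piece S ∩ B := by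
  simp [State.split]

lemma label_left : (s.split S p A B x y).label (Side.L :: S) =
    relabel (s.label S) (s.piece S ∩ A) (Side.R :: S) := by
  simp [State.split]

lemma label_right : (s.split S p A B x y).label (Side.R :: S) =
    relabel (s.label S) (s.piece S ∩ B) (Side.L :: S) := by
  simp [State.split]

lemma Inv.split_old (h : Inv I φ s) (hS : S ∈ s.leaves) (hW : W ∈ s.leaves) :
    (s.split S p A B x y).node W = s.node W ∧ (s.split S p A B x y).piece W = s.piece W ∧
      (s.split S p A B x y).label W = s.label W := by
  have h1 := h.ne_cons hS hW Side.L
  have h2 := h.ne_cons hS hW Side.R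
  simp [State.split, Function.update_of_ne h1, Function.update_of_ne h2]

omit [DecidableEq V] in
lemma Adj.symm (h : Adj K u v) : Adj K v u := by
  obtain ⟨h1, t, ht, h2, h3⟩ := h
  exact ⟨h1.symm, t, ht, h3, h2⟩

/-- The invariant stays true in a step. -/
lemma Inv.split (h : Inv I φ s) (hS : S ∈ s.leaves)
    (hcut : IsCut (s.piece S) (s.label S) a b c) (hl : Prolongs s S a l) (hr : Prolongs s S b r)
    (hs : IsSplit s.tets (s.node S) a' b' (l ++ c ++ r) A B x y) :
    Inv I φ (s.split S (l ++ c ++ r) A B x y) := by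
  have hx := h.ext hS hcut.1 hl hr
  have hL := h.leaf S hS
  have hK := hs.cut.inter hx hL.piece_disk.toIsSurface hL.piece_link hL.piece_sub hcut.1
  set s' := s.split S (l ++ c ++ r) A B x y with hs'
  have htets : s'.tets = splitNode s.tets (s.node S) (l ++ c ++ r) A B x y := rfl
  have hold : ∀ W ∈ s.leaves, W ≠ S → W ∈ s'.leaves ∧ s'.node W = s.node W := fun W hW hWS =>
    ⟨mem_leaves_split.2 (.inr (.inr ⟨hWS, hW⟩)), (h.split_old hS hW).1⟩
  have hleaf : Side.L :: S ∈ s'.leaves := mem_leaves_split.2 (.inl rfl)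
  have hleaf' : Side.R :: S ∈ s'.leaves := mem_leaves_split.2 (.inr (.inl rfl))
  have hinj : ∀ W ∈ s.leaves, W ≠ S → s.node W ≠ s.node S := fun W hW hWS hh =>
    hWS (h.node_inj W hW S hS hh)
  have hnT : ∀ W ∈ s.leaves, s.node W ∈ nodes s.tets := fun W hW => by
    obtain ⟨f, hf⟩ := (h.leaf W hW).disk.nonempty
    exact mem_nodes.2 ⟨_, (mem_link.1 hf).2, by simp⟩
  have hnx : ∀ W ∈ s.leaves, s.node W ≠ x := fun W hW hh => hs.left_notMem (hh ▸ hnT W hW)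
  have hny : ∀ W ∈ s.leaves, s.node W ≠ y := fun W hW hh => hs.right_notMem (hh ▸ hnT W hW)
  -- A leaf node adjacent to a new node was adjacent to the split node, hence on the boundary of its
  -- hemisphere, where edges to the new node are external.
  have hadj : ∀ {A B x y}, IsSplit s.tets (s.node S) a' b' (l ++ c ++ r) A B x y →
      ∀ W ∈ s.leaves, s.node W ≠ x → s.node W ≠ y →
      Adj (splitNode s.tets (s.node S) (l ++ c ++ r) A B x y) x (s.node W) →
      {x, s.node W} ∈ extEdges (splitNode s.tets (s.node S) (l ++ c ++ r) A B x y) := by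
    intro A B x y hs W hW h1 h2 h3
    have h4 := (hs.adj_left h1 h2).1 h3
    refine (hs.extEdges_left h1 h2).2 ⟨pair_mem_extEdges_iff_bdNodes.1 (h.adj S hS W hW ?_), h4⟩
    obtain ⟨f, hf, hwf⟩ := mem_nodes.1 h4
    exact ⟨fun hh => hs.node_notMem_left (hh ▸ h4), _, (hs.of_mem_left hf).2, by simp,
      by simp [hwf]⟩
  have hadjL := hadj hs
  have hadjR := hadj hs.symm
  rw [← splitNode_symm] at hadjR
  refine ⟨h.inj, hs.card_split, ?_, ?_, ?_, ?_, ?_, ?_, ?_⟩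
  · have key : ∀ d, ∀ W ∈ s.leaves, W ≠ S → ¬ (d :: S <:+ W) ∧ ¬ (W <:+ d :: S) := by
      intro d W hW hWS
      refine ⟨fun hh => ?_, fun hh => ?_⟩
      · exact hWS (h.leaf_eq S hS W hW ((List.suffix_cons d S).trans hh)).symm
      · rcases List.suffix_cons_iff.1 hh with h1 | h1
        · exact h.ne_cons hS hW d h1
        · exact hWS (h.leaf_eq W hW S hS h1)
    have key2 : ∀ d d' : Side, d :: S <:+ d' :: S → d :: S = d' :: S := fun d d' hh =>
      hh.eq_of_length (by simp)
    intro W hW W' hW' hsuf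
    rcases mem_leaves_split.1 hW with rfl | rfl | ⟨h1, h2⟩ <;>
      rcases mem_leaves_split.1 hW' with rfl | rfl | ⟨h3, h4⟩
    · rfl
    · exact key2 _ _ hsuf
    · exact ((key _ W' h4 h3).1 hsuf).elim
    · exact key2 _ _ hsuf
    · rfl
    · exact ((key _ W' h4 h3).1 hsuf).elim
    · exact ((key _ W h2 h1).2 hsuf).elim
    · exact ((key _ W h2 h1).2 hsuf).elim
    · exact h.leaf_eq W h2 W' h4 hsuf
  · intro W hW W' hW' hnode
    rcases mem_leaves_split.1 hW with rfl | rfl | ⟨h1, h2⟩ <;>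
      rcases mem_leaves_split.1 hW' with rfl | rfl | ⟨h3, h4⟩
    · rfl
    · rw [node_left, node_right] at hnode; exact (hs.ne hnode).elim
    · rw [node_left, (hold _ h4 h3).2] at hnode; exact (hnx _ h4 hnode.symm).elim
    · rw [node_left, node_right] at hnode; exact (hs.ne hnode.symm).elim
    · rfl
    · rw [node_right, (hold _ h4 h3).2] at hnode; exact (hny _ h4 hnode.symm).elim
    · rw [node_left, (hold _ h2 h1).2] at hnode; exact (hnx _ h2 hnode).elim
    · rw [node_right, (hold _ h2 h1).2] at hnode; exact (hny _ h2 hnode).elim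
    · rw [(hold _ h2 h1).2, (hold _ h4 h3).2] at hnode
      exact h.node_inj W h2 W' h4 hnode
  · intro z hz
    exact hs.nodes_subset (h.nodes_sub hz) fun hh => hL.node_notMem (hh ▸ hz)
  · have key : ∀ {X Y}, ∀ W ∈ s.leaves, W ≠ S → X ⊆ s.piece S → Y = s.piece W → Disjoint X Y := by
      rintro X Y W hW hWS hX rfl
      exact Finset.disjoint_of_subset_left hX (h.piece_disj S hS W hW hWS.symm)
    intro W hW W' hW' hne
    rcases mem_leaves_split.1 hW with rfl | rfl | ⟨h1, h2⟩ <;>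
      rcases mem_leaves_split.1 hW' with rfl | rfl | ⟨h3, h4⟩
    · exact (hne rfl).elim
    · rw [piece_left, piece_right]; exact hK.disjoint
    · rw [piece_left]
      exact key W' h4 h3 Finset.inter_subset_left (h.split_old hS h4).2.1
    · rw [piece_left, piece_right]; exact hK.disjoint.symm
    · exact (hne rfl).elim
    · rw [piece_right]
      exact key W' h4 h3 Finset.inter_subset_left (h.split_old hS h4).2.1
    · rw [piece_left]
      exact (key W h2 h1 Finset.inter_subset_left (h.split_old hS h2).2.1).symm
    · rw [piece_right]
      exact (key W h2 h1 Finset.inter_subset_left (h.split_old hS h2).2.1).symm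
    · rw [(h.split_old hS h2).2.1, (h.split_old hS h4).2.1]
      exact h.piece_disj W h2 W' h4 hne
  · rw [← h.piece_union]
    ext t
    simp only [Finset.mem_biUnion]
    constructor
    · rintro ⟨W, hW, ht⟩
      rcases mem_leaves_split.1 hW with rfl | rfl | ⟨h1, h2⟩
      · rw [piece_left] at ht
        exact ⟨S, hS, (Finset.mem_inter.1 ht).1⟩
      · rw [piece_right] at ht
        exact ⟨S, hS, (Finset.mem_inter.1 ht).1⟩
      · rw [(h.split_old hS h2).2.1] at ht
        exact ⟨W, h2, ht⟩
    · rintro ⟨W, hW, ht⟩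
      by_cases hWS : W = S
      · subst hWS
        rcases hK.mem_or_mem ht with h1 | h1
        · exact ⟨_, hleaf, by rwa [piece_left]⟩
        · exact ⟨_, hleaf', by rwa [piece_right]⟩
      · exact ⟨W, (hold W hW hWS).1, by rwa [(h.split_old hS hW).2.1]⟩
  · intro W hW W' hW' had
    rw [htets] at had ⊢
    rcases mem_leaves_split.1 hW with rfl | rfl | ⟨h1, h2⟩ <;>
      rcases mem_leaves_split.1 hW' with rfl | rfl | ⟨h3, h4⟩
    · exact (had.1 rfl).elim
    · rw [node_left, node_right]; exact hs.extEdges_both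
    · rw [node_left, (hold _ h4 h3).2] at had ⊢
      exact hadjL W' h4 (hnx _ h4) (hny _ h4) had
    · rw [node_left, node_right, Finset.pair_comm]; exact hs.extEdges_both
    · exact (had.1 rfl).elim
    · rw [node_right, (hold _ h4 h3).2] at had ⊢
      exact hadjR W' h4 (hny _ h4) (hnx _ h4) had
    · rw [node_left, (hold _ h2 h1).2] at had ⊢
      rw [Finset.pair_comm]
      exact hadjL W h2 (hnx _ h2) (hny _ h2) had.symm
    · rw [node_right, (hold _ h2 h1).2] at had ⊢
      rw [Finset.pair_comm]
      exact hadjR W h2 (hny _ h2) (hnx _ h2) had.symm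
    · rw [(hold _ h2 h1).2, (hold _ h4 h3).2] at had ⊢
      rw [hs.adj_old (hnx _ h2) (hny _ h2) (hinj _ h2 h1) (hnx _ h4) (hny _ h4) (hinj _ h4 h3)] at had
      rw [hs.extEdges_old (hnx _ h2) (hny _ h2) (hinj _ h2 h1) (hnx _ h4) (hny _ h4) (hinj _ h4 h3)]
      exact h.adj W h2 W' h4 had
  · intro W hW
    rcases mem_leaves_split.1 hW with rfl | rfl | ⟨h1, h2⟩
    · rw [node_left, piece_left, label_left]
      exact hL.left hs hx hcut hl hr h.nodes_sub htets (by simp) hleaf' node_right hold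
    · rw [node_right, piece_right, label_right]
      exact hL.left hs.symm hx hcut hl hr h.nodes_sub (by rw [htets, splitNode_symm]) (by simp)
        hleaf node_left hold
    · obtain ⟨h3, h4, h5⟩ := h.split_old (p := l ++ c ++ r) (A := A) (B := B) (x := x) (y := y) hS h2
      rw [h3, h4, h5]
      exact (h.leaf W h2).other hs (hinj W h2 h1) hL.node_notMem (h.adj S hS W h2) h.nodes_sub
        htets ⟨_, hleaf, List.suffix_cons _ _, node_left⟩
        ⟨_, hleaf', List.suffix_cons _ _, node_right⟩ hinj hold

/-- The data of a step. -/
lemma Inv.step (h : Inv I φ s) (hst : Step s S c p s') : ∃ a b a' b' l r A B x y,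
    S ∈ s.leaves ∧ IsCut (s.piece S) (s.label S) a b c ∧ IsExt I a b c l r p ∧
    IsSplit s.tets (s.node S) a' b' p A B x y ∧
    IsCutAlong (s.piece S) a b c (s.piece S ∩ A) (s.piece S ∩ B) ∧ s' = s.split S p A B x y ∧
    Inv I φ s' := by
  obtain ⟨hS, -, ⟨a, b, hcut, l, r, hl, hr, rfl⟩, ⟨a', b', hp⟩, A, B, x, y, hdiv, hx, hy, hxy, rfl⟩ :=
    hst
  have hL := h.leaf S hS
  have hs : IsSplit s.tets (s.node S) a' b' (l ++ c ++ r) A B x y :=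
    ⟨h.card_eq, hL.disk, hp, hdiv, hx, hy, hxy⟩
  have hext := h.ext hS hcut.1 hl hr
  exact ⟨a, b, a', b', l, r, A, B, x, y, hS, hcut, hext, hs,
    hs.cut.inter hext hL.piece_disk.toIsSurface hL.piece_link hL.piece_sub hcut.1, rfl,
    h.split hS hcut hl hr hs⟩

lemma Inv.card_leaves_split (h : Inv I φ s) (hS : S ∈ s.leaves) :
    (s.split S p A B x y).leaves.card = s.leaves.card + 1 := by
  have h1 : Side.R :: S ∉ s.leaves.erase S := fun hh =>
    h.ne_cons hS (Finset.mem_of_mem_erase hh) _ rfl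
  have h2 : Side.L :: S ∉ insert (Side.R :: S) (s.leaves.erase S) := by
    rw [Finset.mem_insert, not_or]
    exact ⟨by simp, fun hh => h.ne_cons hS (Finset.mem_of_mem_erase hh) _ rfl⟩
  have h3 := Finset.card_pos.2 ⟨S, hS⟩
  change (insert (Side.L :: S) (insert (Side.R :: S) (s.leaves.erase S))).card = _
  rw [Finset.card_insert_of_notMem h2, Finset.card_insert_of_notMem h1,
    Finset.card_erase_of_mem hS]
  omega

lemma Inv.card_leaves_le (h : Inv I φ s) : s.leaves.card ≤ I.card := by
  rw [← h.piece_union, Finset.card_biUnion fun W hW W' hW' => h.piece_disj W hW W' hW']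
  rw [Finset.card_eq_sum_ones]
  exact Finset.sum_le_sum fun W hW => Finset.card_pos.2 (h.leaf W hW).piece_disk.nonempty

/-- A piece that is not a triangle can be cut and the node of its leaf can be split. -/
lemma Inv.exists_step [Infinite V] (h : Inv I φ s) (hS : S ∈ s.leaves)
    (hcard : (s.piece S).card ≠ 1) (hcut : IsCut (s.piece S) (s.label S) a b c)
    (hp : Extends s S a b c p) :
    (∃ a' b', IsSplittingPath (hemisphere s.tets (s.node S)) a' b' p) ∧ ∃ s', Step s S c p s' := by
  obtain ⟨l, r, hl, hr, hp'⟩ := id hp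
  obtain ⟨a', b', hpath⟩ := h.isSplittingPath hS hcut hl hr
  rw [← hp'] at hpath
  obtain ⟨A, B, hdiv⟩ := (h.leaf S hS).disk.exists_divides hpath
  obtain ⟨x, hx⟩ := Infinite.exists_notMem_finset (nodes s.tets)
  obtain ⟨y, hy⟩ := Infinite.exists_notMem_finset (insert x (nodes s.tets))
  rw [Finset.mem_insert, not_or] at hy
  have hpos := Finset.card_pos.2 (h.leaf S hS).piece_disk.nonempty
  exact ⟨⟨a', b', hpath⟩, _, hS, by omega, ⟨a, b, hcut, hp⟩, ⟨a', b', hpath⟩, A, B, x, y, hdiv, hx,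
    hy.2, fun hh => hy.1 hh.symm, rfl⟩

lemma Inv.exists_extends (h : Inv I φ s) (hS : S ∈ s.leaves)
    (hcut : IsCut (s.piece S) (s.label S) a b c) : ∃ p, Extends s S a b c p := by
  obtain ⟨l, hl⟩ := h.exists_prolongs hS hcut.1.head_mem
  obtain ⟨r, hr⟩ := h.exists_prolongs hS hcut.1.last_mem
  exact ⟨_, l, r, hl, hr, rfl⟩

/-- Each triangle of a piece stays in the hemisphere of its leaf node, which is external because its
link is a disk. -/
lemma Inv.depthOne (h : Inv I φ s) (hx : x ∈ nodes I) (hint : x ∈ intNodes s.tets) :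
    DepthOne s.tets x := by
  rw [← h.piece_union] at hx
  obtain ⟨t, ht, hxt⟩ := mem_nodes.1 hx
  obtain ⟨W, hW, ht⟩ := Finset.mem_biUnion.1 ht
  obtain ⟨h1, h2⟩ := mem_link.1 ((h.leaf W hW).piece_link ht)
  exact ⟨hint, s.node W, mem_extNodes_of_isDisk (h.leaf W hW).disk, fun hh => h1 (hh ▸ hxt), _, h2,
    by simp [hxt], by simp⟩

end

end BallSplit

namespace BallSplit

variable {V : Type*} [DecidableEq V]

/-! ### Inner edges and boundary nodes of the pieces in one step -/

section
variable {I T A B K : Finset (Finset V)} {φ : V → ℤ} {s s' : State V} {W S : Word}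
  {a b u v w x y n : V} {c p l r : List V} {e t : Finset V}

lemma IsBall.isDisk_link (hT : IsBall T) (hn : n ∈ extNodes T) : IsDisk (link T n) := by
  obtain ⟨f, hf, hnf⟩ := mem_extNodes.1 hn
  have hne : n ∉ f.erase n := Finset.notMem_erase n f
  rw [← Finset.insert_erase hnf, insert_mem_extFaces hne] at hf
  obtain ⟨-, t, ht, -⟩ := mem_edges.1 (bdEdges_subset_edges hf)
  refine (hT.flower n (mem_nodes.2 ⟨_, (mem_link.1 ht).2, by simp⟩)).resolve_right fun h => ?_
  simp [h.bdry_empty] at hf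

lemma exists_isInitial (T : Finset (Finset V)) (n : V) : ∃ s, IsInitial T n s := by
  set D := bdNodes (hemisphere T n) with hD
  obtain ⟨f, hf⟩ : ∃ f : V → ℤ, Set.BijOn f D (Set.Icc (-(D.card : ℤ)) (-1)) := by
    have hc : (D : Set V).encard = (Set.Icc (-(D.card : ℤ)) (-1)).encard := by
      rw [← Finset.coe_Icc, Set.encard_coe_eq_coe_finsetCard, Set.encard_coe_eq_coe_finsetCard]
      simp
    exact D.finite_toSet.exists_bijOn_of_encard_eq hc
  exact ⟨⟨T, {[]}, fun _ => n, fun _ => hemisphere T n,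
    fun _ v => if v ∈ D then some (Label.original (f v)) else none⟩, rfl, rfl, rfl, rfl, f, hf,
    fun _ => rfl⟩

/-- Some piece has `e` as an edge that is not on its boundary. -/
def IsInnerEdge (s : State V) (e : Finset V) : Prop := ∃ W ∈ s.leaves, cnt (s.piece W) e = 2

/-- Some piece has `x` as a node of its boundary. -/
def IsBdNode (s : State V) (x : V) : Prop := ∃ W ∈ s.leaves, x ∈ bdNodes (s.piece W)

lemma Inv.isInnerEdge_of_step (h : Inv I φ s) (hst : Step s S c p s') (he : e ∈ edges I)
    (hep : e ∈ pathEdges p) : IsInnerEdge s e := by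
  obtain ⟨a, b, a', b', l, r, A, B, x, y, hS, hcut, hx, -⟩ := h.step hst
  obtain ⟨-, t, ht, het⟩ := mem_edges.1 he
  obtain ⟨h1, h2⟩ := hcut.1.edge_mem e
    (hx.edge_of_edge hep fun z hz => mem_nodes.2 ⟨t, ht, het hz⟩)
  exact ⟨S, hS, (h.leaf S hS).piece_disk.cnt_eq_two h1 h2⟩

lemma Inv.isInnerEdge_of_isInnerEdge (h : Inv I φ s) (hst : Step s S c p s') (he : e.card = 2)
    (hs : IsInnerEdge s' e) : IsInnerEdge s e := by
  obtain ⟨a, b, a', b', l, r, A, B, x, y, hS, -, -, -, -, rfl, -⟩ := h.step hst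
  have key : ∀ X, cnt (s.piece S ∩ X) e = 2 → IsInnerEdge s e := by
    intro X hX
    have h1 := cnt_mono (e := e) (Finset.inter_subset_left : s.piece S ∩ X ⊆ s.piece S)
    have h2 := (h.leaf S hS).piece_disk.cnt_le (mem_edges.2 ⟨he, cnt_pos.1 (by omega)⟩)
    exact ⟨S, hS, by omega⟩
  obtain ⟨W, hW, hc⟩ := hs
  rcases mem_leaves_split.1 hW with rfl | rfl | ⟨-, h2⟩
  · rw [piece_left] at hc
    exact key _ hc
  · rw [piece_right] at hc
    exact key _ hc
  · rw [(h.split_old hS h2).2.1] at hc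
    exact ⟨W, h2, hc⟩

/-- The edge is in one triangle of each new piece. Another piece cannot contain two more, as the
edge is in at most two triangles of `I` and the pieces are disjoint. -/
lemma Inv.not_isInnerEdge (h : Inv I φ s) (hI : IsSurface I) (hst : Step s S c p s')
    (he : e ∈ edges I) (hep : e ∈ pathEdges p) : ¬ IsInnerEdge s' e := by
  obtain ⟨a, b, a', b', l, r, A, B, x, y, hS, hcut, hx, -, hK, rfl, -⟩ := h.step hst
  obtain ⟨-, t, ht, het⟩ := mem_edges.1 he
  have hec := hx.edge_of_edge hep fun z hz => mem_nodes.2 ⟨t, ht, het hz⟩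
  rintro ⟨W, hW, hc⟩
  rcases mem_leaves_split.1 hW with rfl | rfl | ⟨h1, h2⟩
  · rw [piece_left, hK.cnt_of_mem_path hec] at hc
    omega
  · rw [piece_right, hK.symm.cnt_of_mem_path hec] at hc
    omega
  · rw [(h.split_old hS h2).2.1] at hc
    obtain ⟨h3, h4⟩ := hcut.1.edge_mem e hec
    have h5 := (h.leaf S hS).piece_disk.cnt_eq_two h3 h4
    have h6 := cnt_mono (e := e)
      (Finset.union_subset (h.leaf W h2).piece_sub (h.leaf S hS).piece_sub)
    rw [cnt_union (h.piece_disj W h2 S hS h1)] at h6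
    have := hI.cnt_le he
    omega

/-- The boundary of a new piece consists of old boundary and of the path. -/
lemma Inv.not_isBdNode (h : Inv I φ s) (hst : Step s S c p s') (hxp : x ∉ p)
    (hs : ¬ IsBdNode s x) : ¬ IsBdNode s' x := by
  obtain ⟨a, b, a', b', l, r, A, B, y, z, hS, -, hx, -, hK, rfl, -⟩ := h.step hst
  have hxc : x ∉ c := fun hh => hxp (hx.subset hh)
  rintro ⟨W, hW, hb⟩
  rcases mem_leaves_split.1 hW with rfl | rfl | ⟨-, h2⟩
  · rw [piece_left, hK.mem_bdNodes_left] at hb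
    exact hb.2.elim (fun hh => hs ⟨S, hS, hh⟩) hxc
  · rw [piece_right, hK.symm.mem_bdNodes_left] at hb
    exact hb.2.elim (fun hh => hs ⟨S, hS, hh⟩) hxc
  · rw [(h.split_old hS h2).2.1] at hb
    exact hs ⟨W, h2, hb⟩

/-- A node of a single triangle is on its boundary. -/
lemma mem_bdNodes_of_card_eq_one (h3 : ∀ t ∈ K, t.card = 3) (hK : K.card = 1) (hx : x ∈ nodes K) :
    x ∈ bdNodes K := by
  obtain ⟨t, rfl⟩ := Finset.card_eq_one.1 hK
  have hxt : x ∈ t := by simpa [mem_nodes] using hx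
  obtain ⟨y, hy, hyx⟩ := Finset.exists_mem_ne (by rw [h3 t (by simp)]; omega : 1 < t.card) x
  refine mem_bdNodes.2 ⟨{x, y}, mem_bdEdges.2 ⟨Finset.card_pair hyx.symm, ?_⟩, by simp⟩
  have hs : ({x, y} : Finset V) ⊆ t := pair_subset_iff.2 ⟨hxt, hy⟩
  simp [cnt, Finset.filter_singleton, hs]

lemma Inv.isBdNode_of_finished (h : Inv I φ s) (hs : s.Finished) (hx : x ∈ nodes I) :
    IsBdNode s x := by
  rw [← h.piece_union] at hx
  obtain ⟨t, ht, hxt⟩ := mem_nodes.1 hx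
  obtain ⟨W, hW, ht⟩ := Finset.mem_biUnion.1 ht
  exact ⟨W, hW, mem_bdNodes_of_card_eq_one (h.leaf W hW).piece_disk.card_eq (hs W hW)
    (mem_nodes.2 ⟨t, ht, hxt⟩)⟩

end

/-! ### Runs: length, uniqueness of inner edges, promotion and completion -/

section
variable {T : Finset (Finset V)} {n x : V} {φ : V → ℤ} {m i j : ℕ} {s : ℕ → State V}
  {S : ℕ → Word} {c p : ℕ → List V} {e : Finset V}

namespace IsRun

lemma exists_inv (h : IsRun T n m s S c p) (hT : ∀ t ∈ T, t.card = 4) (hn : IsDisk (link T n)) :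
    ∃ φ, ∀ i ≤ m, Inv (link T n) φ (s i) := by
  obtain ⟨φ, hφ⟩ := Inv.init hT hn h.init
  refine ⟨φ, fun i => ?_⟩
  induction i with
  | zero => exact fun _ => hφ
  | succ i ih =>
    intro hi
    obtain ⟨_, _, _, _, _, _, _, _, _, _, -, -, -, -, -, -, h1⟩ := (ih (by omega)).step (h.step i hi)
    exact h1

lemma card_leaves (h : IsRun T n m s S c p) (hI : ∀ i ≤ m, Inv (link T n) φ (s i)) :
    ∀ i ≤ m, (s i).leaves.card = i + 1 := by
  intro i
  induction i with
  | zero => simp [h.init.leaves_eq]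
  | succ i ih =>
    intro hi
    obtain ⟨_, _, _, _, _, _, _, _, _, _, hS, -, -, -, -, h1, -⟩ :=
      (hI i (by omega)).step (h.step i hi)
    rw [h1, (hI i (by omega)).card_leaves_split hS, ih (by omega)]

/-- There are `m + 1` leaves, with disjoint non-empty pieces. -/
lemma lt_card (h : IsRun T n m s S c p) (hI : ∀ i ≤ m, Inv (link T n) φ (s i)) :
    m < (link T n).card := by
  have h1 := h.card_leaves hI m le_rfl
  have h2 := (hI m le_rfl).card_leaves_le
  omega

lemma divides (h : IsRun T n m s S c p) (hI : ∀ i ≤ m, Inv (link T n) φ (s i)) (hi : i < m) :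
    Divides ((s i).piece (S i)) (c i)
      ((s (i + 1)).piece (Side.L :: S i)) ((s (i + 1)).piece (Side.R :: S i)) := by
  obtain ⟨_, _, _, _, _, _, _, _, _, _, hS, -, -, -, hK, h1, -⟩ :=
    (hI i hi.le).step (h.step i hi)
  rw [h1, piece_left, piece_right]
  exact hK.divides ((hI i hi.le).leaf _ hS).piece_disk.euler_eq

lemma isInnerEdge_mono (h : IsRun T n m s S c p) (hI : ∀ i ≤ m, Inv (link T n) φ (s i))
    (he : e.card = 2) (hij : i ≤ j) (hj : j ≤ m) (hs : IsInnerEdge (s j) e) :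
    IsInnerEdge (s i) e := by
  induction j, hij using Nat.le_induction with
  | base => exact hs
  | succ j hij ih =>
    exact ih (by omega) ((hI j (by omega)).isInnerEdge_of_isInnerEdge (h.step j hj) he hs)

lemma notMem_pathEdges_of_lt (h : IsRun T n m s S c p) (hn : IsDisk (link T n))
    (hI : ∀ i ≤ m, Inv (link T n) φ (s i)) (he : e ∈ edges (link T n)) (hij : i < j) (hj : j < m)
    (hi : e ∈ pathEdges (p i)) : e ∉ pathEdges (p j) := fun hh =>
  (hI i (by omega)).not_isInnerEdge hn.toIsSurface (h.step i (by omega)) he hi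
    (h.isInnerEdge_mono hI (mem_edges.1 he).1 hij hj.le
      ((hI j hj.le).isInnerEdge_of_step (h.step j hj) he hh))

lemma mem_intNodes (h : IsRun T n m s S c p) (hI : ∀ i ≤ m, Inv (link T n) φ (s i))
    (hx : x ∈ intNodes T) : ∀ i ≤ m, x ∈ intNodes (s i).tets := by
  intro i
  induction i with
  | zero => simpa [h.init.tets_eq] using hx
  | succ i ih =>
    intro hi
    obtain ⟨_, _, _, _, _, _, _, _, _, _, -, -, -, hs, -, h1, -⟩ :=
      (hI i (by omega)).step (h.step i hi)
    rw [h1]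
    exact hs.mem_intNodes_split (ih (by omega))

/-- At the start `x` is not on the boundary of the only piece, and at the end it is a node of a
single triangle, where every node is on the boundary. -/
lemma exists_mem_path (h : IsRun T n m s S c p) (hI : ∀ i ≤ m, Inv (link T n) φ (s i))
    (hfin : (s m).Finished) (hx : x ∈ nodes (link T n)) (hxb : x ∉ bdNodes (link T n)) :
    ∃ i < m, x ∈ p i := by
  by_contra! hno
  have key : ∀ i ≤ m, ¬ IsBdNode (s i) x := by
    intro i
    induction i with
    | zero =>
      rintro - ⟨W, hW, hb⟩
      obtain rfl : W = [] := by simpa [h.init.leaves_eq] using hW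
      rw [h.init.piece_eq] at hb
      exact hxb hb
    | succ i ih =>
      exact fun hi => (hI i (by omega)).not_isBdNode (h.step i hi) (hno i hi) (ih (by omega))
  exact key m le_rfl ((hI m le_rfl).isBdNode_of_finished hfin hx)

/-- A node of type C2 is promoted in the first step whose path contains it. -/
lemma promoted (h : IsRun T n m s S c p) (hI : ∀ i ≤ m, Inv (link T n) φ (s i))
    (hfin : (s m).Finished) (hx : x ∈ nodes (link T n)) (hC : IsC2 T x) :
    ∃ i < m, (∀ j ≤ i, IsC2 (s j).tets x) ∧ IsC1 (s (i + 1)).tets x ∧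
      ∀ j, i < j → j ≤ m → IsC0 (s j).tets x ∨ IsC1 (s j).tets x := by
  classical
  have hint := h.mem_intNodes hI hC.1.1
  have hdep : ∀ i ≤ m, DepthOne (s i).tets x := fun i hi => (hI i hi).depthOne hx (hint i hi)
  have hex := h.exists_mem_path hI hfin hx (IsSplit.notMem_bdNodes hC.1.1)
  obtain ⟨him, hxp⟩ := Nat.find_spec hex
  have hmin : ∀ j < Nat.find hex, x ∉ p j := fun j hj hh =>
    Nat.find_min hex hj ⟨hj.trans him, hh⟩
  generalize Nat.find hex = i at him hxp hmin
  -- Before the first path through `x`, no split can create a face over an external edge at `x`.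
  have hext : ∀ j ≤ i, ¬ HasExtFace (s j).tets x := by
    intro j
    induction j with
    | zero =>
      intro _
      rw [← h.init.tets_eq] at hC
      exact ((isC2_iff (hI 0 (by omega)).card_eq).1 hC).2
    | succ j ih =>
      intro hj hh
      obtain ⟨_, _, _, _, _, _, _, _, _, _, -, -, -, hs, -, h1, -⟩ :=
        (hI j (by omega)).step (h.step j (by omega))
      rw [h1] at hh
      exact ih (by omega) (hs.hasExtFace_of_split (hint j (by omega)) (hmin j hj) hh)
  obtain ⟨_, _, _, _, _, _, _, _, _, _, -, -, -, hs, -, h1, -⟩ := (hI i him.le).step (h.step i him)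
  have hext' : HasExtFace (s (i + 1)).tets x := by
    rw [h1]
    exact hs.hasExtFace_of_mem_path (hint i him.le) hxp
  have hlater : ∀ j, i + 1 ≤ j → j ≤ m → HasExtFace (s j).tets x := by
    intro j hij
    induction j, hij using Nat.le_induction with
    | base => exact fun _ => hext'
    | succ j hij ih =>
      intro hj
      obtain ⟨_, _, _, _, _, _, _, _, _, _, -, -, -, hs', -, h2, -⟩ :=
        (hI j (by omega)).step (h.step j hj)
      rw [h2]
      exact hs'.hasExtFace_split (hint j (by omega)) (ih (by omega))
  refine ⟨i, him, fun j hj => (isC2_iff (hI j (by omega)).card_eq).2 ⟨hdep j (by omega), hext j hj⟩,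
    ?_, fun j hij hj => isC0_or_isC1 (hdep j hj) (hlater j hij hj)⟩
  refine (isC0_or_isC1 (hdep _ him) hext').resolve_left ?_
  rw [h1]
  exact hs.not_isC0_split (hint i him.le) (hext i le_rfl)

lemma exists_succ [Infinite V] (h : IsRun T n m s S c p)
    (hI : ∀ i ≤ m, Inv (link T n) φ (s i)) (hfin : ¬ (s m).Finished) :
    ∃ s S c p, IsRun T n (m + 1) s S c p := by
  unfold State.Finished at hfin
  push Not at hfin
  obtain ⟨W, hW, hcard⟩ := hfin
  have hm := hI m le_rfl
  obtain ⟨a, b, d, hcut⟩ := hm.exists_isCut hW hcard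
  obtain ⟨q, hq⟩ := hm.exists_extends hW hcut
  obtain ⟨-, t, ht⟩ := hm.exists_step hW hcard hcut hq
  refine ⟨Function.update s (m + 1) t, Function.update S m W, Function.update c m d,
    Function.update p m q, ?_, fun i hi => ?_⟩
  · rw [Function.update_of_ne (by omega)]
    exact h.init
  · rw [Function.update_of_ne (by omega : i ≠ m + 1)]
    rcases Nat.lt_succ_iff_lt_or_eq.1 hi with hi | rfl
    · rw [Function.update_of_ne hi.ne, Function.update_of_ne hi.ne, Function.update_of_ne hi.ne,
        Function.update_of_ne (by omega)]
      exact h.step i hi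
    · simpa using ht

end IsRun

/-- Otherwise every run could be continued, giving one with as many steps as there are triangles,
which the bound on the length excludes. -/
lemma exists_finished_run [Infinite V] (hT : ∀ t ∈ T, t.card = 4) (hn : IsDisk (link T n)) :
    ∃ m s S c p, IsRun T n m s S c p ∧ (s m).Finished := by
  by_contra! hno
  have key : ∀ k, ∃ s S c p, IsRun T n k s S c p := by
    intro k
    induction k with
    | zero =>
      obtain ⟨s, hs⟩ := exists_isInitial T n
      exact ⟨fun _ => s, fun _ => [], fun _ => [], fun _ => [], hs, fun i hi => by omega⟩
    | succ k ih =>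
      obtain ⟨s, S, c, p, h⟩ := ih
      obtain ⟨φ, hI⟩ := h.exists_inv hT hn
      exact h.exists_succ hI (hno k s S c p h)
  obtain ⟨s, S, c, p, h⟩ := key (link T n).card
  obtain ⟨φ, hI⟩ := h.exists_inv hT hn
  exact (h.lt_card hI).false

end

end BallSplit

open BallSplit
theorem theorem4p1 {V : Type*} [DecidableEq V] [Infinite V] (T : Finset (Finset V))
    (hT : IsBall T) (n : V) (hn : n ∈ extNodes T) :
    -- some run reduces all the pieces to triangles
    (∃ m s S c p, IsRun T n m s S c p ∧ (s m).Finished) ∧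
    ∀ m s S c p, IsRun T n m s S c p →
      -- every run is finite
      m < (hemisphere T n).card ∧
      -- no run gets stuck: each piece that is not a triangle can be cut, whatever the choices
      (∀ W ∈ (s m).leaves, ((s m).piece W).card ≠ 1 →
        (∃ a b d, IsCut ((s m).piece W) ((s m).label W) a b d) ∧
        ∀ a b d, IsCut ((s m).piece W) ((s m).label W) a b d →
          (∃ q, Extends (s m) W a b d q) ∧
          ∀ q, Extends (s m) W a b d q →
            (∃ a' b', IsSplittingPath (hemisphere (s m).tets ((s m).node W)) a' b' q) ∧
            ∃ s', Step (s m) W d q s') ∧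
      -- the pieces decompose the hemisphere
      (∀ W ∈ (s m).leaves, IsDisk ((s m).piece W) ∧
        IsDisk (hemisphere (s m).tets ((s m).node W)) ∧
        (s m).piece W ⊆ hemisphere (s m).tets ((s m).node W)) ∧
      (∀ W ∈ (s m).leaves, ∀ W' ∈ (s m).leaves, W ≠ W' →
        Disjoint ((s m).piece W) ((s m).piece W')) ∧
      (s m).leaves.biUnion (s m).piece = hemisphere T n ∧
      (∀ i < m, Divides ((s i).piece (S i)) (c i)
        ((s (i + 1)).piece (Side.L :: S i)) ((s (i + 1)).piece (Side.R :: S i))) ∧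
      -- every interior edge lies in at most one path
      (∀ e ∈ edges (hemisphere T n), e ∉ bdEdges (hemisphere T n) →
        ∀ i < m, ∀ j < m, e ∈ pathEdges (p i) → e ∈ pathEdges (p j) → i = j) ∧
      -- every node of type C2 is promoted to type C1
      ((s m).Finished → ∀ x ∈ nodes (hemisphere T n), IsC2 T x →
        ∃ i < m, (∀ j ≤ i, IsC2 (s j).tets x) ∧ IsC1 (s (i + 1)).tets x ∧
          ∀ j, i < j → j ≤ m → IsC0 (s j).tets x ∨ IsC1 (s j).tets x) := by
  have hd := hT.isDisk_link hn
  refine ⟨exists_finished_run hT.card_eq hd, fun m s S c p h => ?_⟩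
  obtain ⟨φ, hI⟩ := h.exists_inv hT.card_eq hd
  have hm := hI m le_rfl
  refine ⟨h.lt_card hI, fun W hW hcard => ⟨hm.exists_isCut hW hcard, fun a b d hcut =>
      ⟨hm.exists_extends hW hcut, fun q hq => hm.exists_step hW hcard hcut hq⟩⟩,
    fun W hW => ⟨(hm.leaf W hW).piece_disk, (hm.leaf W hW).disk, (hm.leaf W hW).piece_link⟩,
    hm.piece_disj, hm.piece_union, fun i hi => h.divides hI hi, ?_,
    fun hfin x hx hC => h.promoted hI hfin hx hC⟩
  intro e he _ i hi j hj hei hej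
  rcases lt_trichotomy i j with hij | hij | hij
  · exact (h.notMem_pathEdges_of_lt hd hI he hij hj hei hej).elim
  · exact hij
  · exact (h.notMem_pathEdges_of_lt hd hI he hij hi hej hei).elim
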